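/- **Lemma (Roundness of a tubular suspension).** *Conventions.* Let $n\ge 2$. A polyhedron in $\mathbb R^n$ is a nonempty compact finite intersection of closed half-spaces. Its dimension is that of its affine hull $\mathrm{Affine}(\delta)$, and its subfaces (of all dimensions, $\delta$ included) are its nonempty faces. A $k$-dimensional complex $S$ is a finite set of $k$-dimensional polyhedra such that any two distinct subfaces have disjoint relative interiors. Write $\mathcal U(S)=\bigcup_{\delta\in S}\delta$ and $\mathcal F(S)$ for the set of all subfaces. Let $\underline R(A)=\sup\{r>0:\exists x\in\mathrm{Affine}(A),\ B(x,r)\cap \mathrm{Affine}(A)\subset A\}$ and $\overline R(A)=\inf\{r>0:\exists x,\ A\subset B(x,r)\}$. Let $\overline{\mathcal R}(S)=\max_{\delta\in\mathcal F(S)}\overline R(\delta)$, and let $\underline{\mathcal R}(S)$ be the minimum of $\underline R(\delta)$ over the $\delta\in\mathcal F(S)$ that are not vertices. $\langle A\rangle$ denotes the convex hull. A linear graph $G=(T,A)$ is a finite nonempty $T\subset\mathbb R^n$ with a set $A$ of pairs of distinct points of $T$, whose open segments are pairwise disjoint, such that $G$ is connected, every vertex has at most two neighbours and there is no 3-cycle.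 For a $k$-dimensional complex $S$ and $p:S\to T$, the suspension $\mathcal S(S,G,p)$ is the set of those among the sets $\langle\delta\cup\{p(\delta)\}\rangle$ ($\delta\in S$) and $\langle(\alpha\cap\beta)\cup\{p(\alpha),p(\beta)\}\rangle$ ($\alpha,\beta\in S$, $\{p(\alpha),p(\beta)\}\in A$) that have dimension $k+1$. A set $X$ is in simple occlusion with respect to $Y$ if $[x,y]\cap X=\{x\}$ for all $x\in X$, $y\in Y$. With $U_x=\bigcup_{p(\delta)=x}\delta$, we say that $(S,G,p)$ is *good* for an open set $O$ and sets $(\kappa_x)_{x\in T}$ if: 1. no polyhedron of $S$ meets an edge $[x,y]$, $\{x,y\}\in A$; every $U_x$ is in simple occlusion with respect to $x$; for every edge $\{x,y\}$, $U_x\cap U_y$ is in simple occlusion with respect to $[x,y]$ and $U_x\cup\bigcup_{u\in U_x\cap U_y}[u,y]$ is in simple occlusion with respect to $x$; 2. the $\kappa_x$ are open, pairwise disjoint, $\kappa_x$ is star-shaped with respect to $x$, and $U_x\subset\overline{\kappa_x}$; with $\kappa_{x,y}=\bigcup_{(u,v)\in\kappa_x\times\kappa_y}[u,v]$, one has $\kappa_z\cap\kappa_{x,y}=\emptyset$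 for $\{x,y\}\in A$ and $z\in T\setminus\{x,y\}$, and $\kappa_{a,b}\cap\kappa_{c,d}=\emptyset$ for any two edges $\{a,b\},\{c,d\}$ without common vertex; 3. $p$ is surjective, $O$ is bounded, $\mathcal U(S)=\partial O$, $\overline O=\bigcup_x\overline{\kappa_x}$, and $\overline{\kappa_x}\cap\overline{\kappa_y}=\emptyset$ for distinct non-neighbours $x,y$. *Tubular complexes.* Let $S$ be an $(n-1)$-dimensional complex, $O$ an open set with $\partial O=\mathcal U(S)$, and $G=(T,A)$ a linear graph with $T\subset O$. For $h:T^2\to\mathbb R$ anticommutative ($h(x,y)=-h(y,x)$), let $\kappa_x(h)$ be the connected component containing $x$ of the set of points $t\in O$ such that, for every neighbour $y$ of $x$, $t$ lies strictly on the side of $x$ of the hyperplane orthogonal to $[x,y]$ that meets $[x,y]$ at distance $h(x,y)+d(x,y)/2$ from $x$. Let $S(h)$ be the set of all $\delta'\cap\overline{\kappa_x(h)}$ ($\delta'\in S$, $x\in T$) of dimension $n-1$. For anticommutative $f,g$, let $\mathfrak F$ be the set of anticommutative $h$ with $\min(f,g)\le h\le\max(f,g)$. For $\epsilon>0$, $S$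 is *$\epsilon$-tubular* with respect to $G$ and $O$ (with bounds $f,g$) if * either $\#T=1$, and $O$ is bounded and star-shaped with respect to the vertex of $G$; * or $\#T>1$; for all $\{x,y\}\in A$, $|f(x,y)|,|g(x,y)|<d(x,y)/2$ and $|f(x,y)-g(x,y)|\ge\epsilon$; and for all $h\in\mathfrak F$, $S(h)$ is an $(n-1)$-dimensional complex and there is $p:S(h)\to T$ such that $p(\delta)=x\iff\delta\subset\overline{\kappa_x(h)}$ and $(S(h),G,p)$ is good for $O$ and $(\kappa_x(h))_{x\in T}$. *Shape parameters.* Let $\partial^\perp O$ be the set of points $t\in\partial O$ at which $\partial O$ has a tangent hyperplane, with unit normal $\vec n(t)$. If $T=\{x\}$, put $\alpha_-=\beta_-=d(x,\partial O)$, $\alpha_+=\beta_+=\sup_{t\in\partial O}d(x,t)$, $\gamma=\mathcal H^{n-1}(\partial O)^{1/(n-1)}$ and $\eta=\inf_{t\in\partial^\perp O}\frac{|\langle\vec n(t),t-x\rangle|}{\|t-x\|}$. If $\#T>1$, put $W_{x,y}(h)=\partial O\cap(\overline{\kappa_x(h)}\cup\overline{\kappa_y(h)})$ and $$\alpha_-=\min_{\{x,y\}\in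 A}d(x,y),\quad \alpha_+=\max_{\{x,y\}\in A}d(x,y),\quad \gamma=\Big(\sup_{h\in\mathfrak F,\,x\in T}\mathcal H^{n-1}(\partial O\cap\overline{\kappa_x(h)})\Big)^{\frac1{n-1}},$$ $$\beta_-=\inf_{h,\{x,y\},z}d(z,W_{x,y}(h)),\quad \beta_+=\sup_{h,\{x,y\},z}\ \sup_{t\in W_{x,y}(h)}d(z,t),\quad \eta=\inf_{h,\{x,y\},z}\ \inf_{t\in\partial^\perp O\cap W_{x,y}(h)}\frac{|\langle\vec n(t),t-z\rangle|}{\|t-z\|},$$ where $h\in\mathfrak F$, $\{x,y\}\in A$, $z\in[x,y]$. *Statement.* For every compact set $K\subset\,]0,+\infty[^9$ there are constants $c_1,c_2>0$ such that the following holds for every $n\ge2$, every $\epsilon>0$ and every complex $S$ in $\mathbb R^n$ that is $\epsilon$-tubular with respect to an open set $O$ and a linear graph $G$ (with bounds $f,g$). If $\rho_+,\rho_-$ are real numbers with $$\rho_+>\overline{\mathcal R}(S),\qquad \underline{\mathcal R}(S)>\rho_->0,$$ $$\Big(n,\eta,\frac{\rho_+}{\rho_-},\frac{\epsilon}{\rho_+},\frac{\alpha_-}{\rho_+},\frac{\alpha_+}{\rho_+},\frac{\beta_-}{\rho_+},\frac{\beta_+}{\rho_+},\frac{\gamma}{\rho_-}\Big)\in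 K,$$ then there is $h\in\mathfrak F$ such that, with $p:S(h)\to T$ given by $p(\delta)=x\iff\delta\subset\overline{\kappa_x(h)}$, $S'=\mathcal S(S(h),G,p)$ is an $n$-dimensional complex satisfying $$\mathcal U(S')=\overline O,\qquad \overline{\mathcal R}(S')\le c_1\,\overline{\mathcal R}(S),\qquad \underline{\mathcal R}(S')\ge c_2\,\underline{\mathcal R}(S).$$ -/

import Mathlib

namespace TubularSuspension

noncomputable section

/-! Polyhedra -/

/-- A polyhedron of `ℝⁿ`, of any dimension `≤ n`: a nonempty compact set which is a finite
intersection of closed affine half-spaces. (Its relative interior is automatically nonempty, and its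
affine hull is itself a finite intersection of half-spaces.) -/
def IsPolyhedron {n : ℕ} (δ : Set (EuclideanSpace ℝ (Fin n))) : Prop :=
  δ.Nonempty ∧ IsCompact δ ∧
    ∃ s : Finset (EuclideanSpace ℝ (Fin n) × ℝ),
      (∀ q ∈ s, q.1 ≠ 0) ∧ δ = {x | ∀ q ∈ s, inner ℝ q.1 x ≤ q.2}

/-- The dimension of the affine hull of `A`. -/
def dimension {n : ℕ} (A : Set (EuclideanSpace ℝ (Fin n))) : ℕ :=
  Module.finrank ℝ (affineSpan ℝ A).direction

/-- The set `𝓕(δ)` of subfaces of a polyhedron `δ` (all dimensions, `δ` included): its nonempty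
exposed faces. -/
def subfaces {n : ℕ} (δ : Set (EuclideanSpace ℝ (Fin n))) :
    Set (Set (EuclideanSpace ℝ (Fin n))) :=
  {α | α.Nonempty ∧ IsExposed ℝ δ α}

/-- Inner radius: supremum of the radii of the balls, relative to the affine hull of `A`,
contained in `A`. (Only ever used for sets of positive dimension.) -/
def innerRadius {n : ℕ} (A : Set (EuclideanSpace ℝ (Fin n))) : ℝ :=
  sSup {r | 0 < r ∧ ∃ x ∈ affineSpan ℝ A,
    Metric.closedBall x r ∩ (affineSpan ℝ A : Set (EuclideanSpace ℝ (Fin n))) ⊆ A}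

/-- Outer radius: infimum of the radii of the balls containing `A`. -/
def outerRadius {n : ℕ} (A : Set (EuclideanSpace ℝ (Fin n))) : ℝ :=
  sInf {r | 0 < r ∧ ∃ x, A ⊆ Metric.closedBall x r}

/-! Complexes; `𝓤(S)` is written `⋃₀ S` -/

/-- The set `𝓕(S)` of all subfaces of the polyhedra of `S`. -/
def allSubfaces {n : ℕ} (S : Set (Set (EuclideanSpace ℝ (Fin n)))) :
    Set (Set (EuclideanSpace ℝ (Fin n))) :=
  ⋃ δ ∈ S, subfaces δ

/-- `S` is a `k`-dimensional complex: a finite set of `k`-dimensional polyhedra such that distinct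
subfaces have disjoint relative interiors. -/
def IsComplex {n : ℕ} (k : ℕ) (S : Set (Set (EuclideanSpace ℝ (Fin n)))) : Prop :=
  S.Finite ∧ (∀ δ ∈ S, IsPolyhedron δ ∧ dimension δ = k) ∧
    ∀ α ∈ allSubfaces S, ∀ β ∈ allSubfaces S, α ≠ β →
      Disjoint (intrinsicInterior ℝ α) (intrinsicInterior ℝ β)

/-- Outer radius of a complex: the largest outer radius of a subface. -/
def complexOuterRadius {n : ℕ} (S : Set (Set (EuclideanSpace ℝ (Fin n)))) : ℝ :=
  sSup (outerRadius '' allSubfaces S)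

/-- Inner radius of a complex: the smallest inner radius of a subface that is not a vertex. -/
def complexInnerRadius {n : ℕ} (S : Set (Set (EuclideanSpace ℝ (Fin n)))) : ℝ :=
  sInf (innerRadius '' {δ ∈ allSubfaces S | dimension δ ≠ 0})

/-! Graphs -/

/-- A finite nonempty graph embedded in `ℝⁿ` with straight edges whose open segments are pairwise
disjoint. -/
structure EuclideanGraph (n : ℕ) where
  T : Finset (EuclideanSpace ℝ (Fin n))
  nonempty : T.Nonempty
  graph : SimpleGraph T
  edges_disjoint : ∀ a b c d : T, graph.Adj a b → graph.Adj c d → s(a, b) ≠ s(c, d) →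
    Disjoint (openSegment ℝ (a : EuclideanSpace ℝ (Fin n)) b)
      (openSegment ℝ (c : EuclideanSpace ℝ (Fin n)) d)

/-- A linear graph: connected, every vertex has at most two neighbours, no 3-cycle. -/
def EuclideanGraph.IsLinear {n : ℕ} (G : EuclideanGraph n) : Prop :=
  G.graph.Connected ∧ (∀ x, (G.graph.neighborSet x).ncard ≤ 2) ∧ G.graph.CliqueFree 3

/-! Suspension of a complex; `convexJoin ℝ A B` is the union of the segments `[a, b]`, `a ∈ A`,
`b ∈ B` -/

/-- The suspension `𝓢(S, G, p)` of a `k`-dimensional complex `S`: the `(k+1)`-dimensional sets among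
the convex hulls `⟨δ ∪ {p δ}⟩`, `δ ∈ S`, and `⟨(α ∩ β) ∪ {p α, p β}⟩`, where `α, β ∈ S` and
`{p α, p β}` is an edge. Only the values of `p` on `S` matter. -/
def suspension {n : ℕ} (k : ℕ) (S : Set (Set (EuclideanSpace ℝ (Fin n)))) (G : EuclideanGraph n)
    (p : Set (EuclideanSpace ℝ (Fin n)) → G.T) : Set (Set (EuclideanSpace ℝ (Fin n))) :=
  {δ' | dimension δ' = k + 1 ∧
    ((∃ δ ∈ S, δ' = convexHull ℝ (δ ∪ {(p δ : EuclideanSpace ℝ (Fin n))})) ∨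
     (∃ α ∈ S, ∃ β ∈ S, G.graph.Adj (p α) (p β) ∧
        δ' = convexHull ℝ ((α ∩ β) ∪ {(p α : EuclideanSpace ℝ (Fin n)), (p β : EuclideanSpace ℝ (Fin n))})))}

/-- `A` is in simple occlusion with respect to `B`. -/
def SimpleOcclusion {n : ℕ} (A B : Set (EuclideanSpace ℝ (Fin n))) : Prop :=
  ∀ x ∈ A, ∀ y ∈ B, segment ℝ x y ∩ A = {x}

/-- The union `𝓤(p⁻¹(x))` of the polyhedra of `S` associated with the vertex `x`. -/
def fiberUnion {n : ℕ} (S : Set (Set (EuclideanSpace ℝ (Fin n)))) (G : EuclideanGraph n)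
    (p : Set (EuclideanSpace ℝ (Fin n)) → G.T) (x : G.T) : Set (EuclideanSpace ℝ (Fin n)) :=
  ⋃₀ {δ ∈ S | p δ = x}

/-- `S` is in simple occlusion with respect to the graph `G` with the choice `p`. -/
def ComplexSimpleOcclusion {n : ℕ} (S : Set (Set (EuclideanSpace ℝ (Fin n))))
    (G : EuclideanGraph n) (p : Set (EuclideanSpace ℝ (Fin n)) → G.T) : Prop :=
  (∀ δ ∈ S, ∀ x y : G.T, G.graph.Adj x y →
    Disjoint δ (segment ℝ (x : EuclideanSpace ℝ (Fin n)) y)) ∧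
  (∀ x : G.T, SimpleOcclusion (fiberUnion S G p x) {(x : EuclideanSpace ℝ (Fin n))}) ∧
  (∀ x y : G.T, G.graph.Adj x y →
    SimpleOcclusion (fiberUnion S G p x ∩ fiberUnion S G p y)
      (segment ℝ (x : EuclideanSpace ℝ (Fin n)) y) ∧
    SimpleOcclusion
      (fiberUnion S G p x ∪
        convexJoin ℝ (fiberUnion S G p x ∩ fiberUnion S G p y) {(y : EuclideanSpace ℝ (Fin n))})
      {(x : EuclideanSpace ℝ (Fin n))})

/-- `κ` is a family of pairwise disjoint open sets, `κ x` being star-shaped with respect to `x` and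
its closure containing the polyhedra associated with `x`, such that the hull `κ_{x,y}` of two
neighbouring sets avoids all the other sets, and the hulls belonging to two edges without common
vertex are disjoint. -/
def SeparatingFamily {n : ℕ} (S : Set (Set (EuclideanSpace ℝ (Fin n))))
    (G : EuclideanGraph n) (p : Set (EuclideanSpace ℝ (Fin n)) → G.T)
    (κ : G.T → Set (EuclideanSpace ℝ (Fin n))) : Prop :=
  (∀ x, IsOpen (κ x)) ∧
  (∀ x y, x ≠ y → Disjoint (κ x) (κ y)) ∧
  (∀ x : G.T, StarConvex ℝ (x : EuclideanSpace ℝ (Fin n)) (κ x)) ∧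
  (∀ x, fiberUnion S G p x ⊆ closure (κ x)) ∧
  (∀ x y z, G.graph.Adj x y → z ≠ x → z ≠ y → Disjoint (κ z) (convexJoin ℝ (κ x) (κ y))) ∧
  (∀ a b c d, G.graph.Adj a b → G.graph.Adj c d → a ≠ c → a ≠ d → b ≠ c → b ≠ d →
    Disjoint (convexJoin ℝ (κ a) (κ b)) (convexJoin ℝ (κ c) (κ d)))

/-- `G` is in total occlusion with respect to `S` with the choice `p`, the open set `O` and the
family `κ` (the openness, disjointness and star-shapedness of `κ` being part of
`SeparatingFamily`). -/
def TotalOcclusion {n : ℕ} (S : Set (Set (EuclideanSpace ℝ (Fin n))))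
    (G : EuclideanGraph n) (p : Set (EuclideanSpace ℝ (Fin n)) → G.T)
    (O : Set (EuclideanSpace ℝ (Fin n))) (κ : G.T → Set (EuclideanSpace ℝ (Fin n))) : Prop :=
  (∀ x, ∃ δ ∈ S, p δ = x) ∧
  IsOpen O ∧ Bornology.IsBounded O ∧
  ⋃₀ S = frontier O ∧ closure O = ⋃ x, closure (κ x) ∧
  (∀ x y, ¬ G.graph.Adj x y → x = y ∨ Disjoint (closure (κ x)) (closure (κ y)))

/-! Tubular complexes -/

/-- `h : T² → ℝ` with `h(x, y) = - h(y, x)`. -/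
def Anticommutative {n : ℕ} {G : EuclideanGraph n} (h : G.T → G.T → ℝ) : Prop :=
  ∀ x y, h x y = - h y x

/-- The set `𝔉` of the anticommutative maps between `f` and `g`. -/
def cuts {n : ℕ} {G : EuclideanGraph n} (f g : G.T → G.T → ℝ) : Set (G.T → G.T → ℝ) :=
  {h | Anticommutative h ∧ ∀ x y, min (f x y) (g x y) ≤ h x y ∧ h x y ≤ max (f x y) (g x y)}

/-- The open half-space containing `x` bounded by the hyperplane `H(x, y, r)`, which is orthogonal
to `[x, y]` and meets it at distance `r + d(x, y) / 2` from `x`. -/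
def halfSpace {n : ℕ} (x y : EuclideanSpace ℝ (Fin n)) (r : ℝ) : Set (EuclideanSpace ℝ (Fin n)) :=
  {t | inner ℝ (t - x) (y - x) < (r + dist x y / 2) * dist x y}

/-- The cell `κ_x(h)`: the connected component containing `x` of the intersection of `O` with the
half-spaces attached to the neighbours of `x` (none if `G` has one vertex only). -/
def cell {n : ℕ} (G : EuclideanGraph n) (O : Set (EuclideanSpace ℝ (Fin n)))
    (h : G.T → G.T → ℝ) (x : G.T) : Set (EuclideanSpace ℝ (Fin n)) :=
  connectedComponentIn
    (O ∩ {t | ∀ y : G.T, G.graph.Adj x y → t ∈ halfSpace (x : EuclideanSpace ℝ (Fin n)) y (h x y)})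
    x

/-- The family `S(h)` of the `(n-1)`-dimensional pieces cut out of `S` by the closed cells. -/
def cutComplex {n : ℕ} (S : Set (Set (EuclideanSpace ℝ (Fin n)))) (G : EuclideanGraph n)
    (O : Set (EuclideanSpace ℝ (Fin n))) (h : G.T → G.T → ℝ) :
    Set (Set (EuclideanSpace ℝ (Fin n))) :=
  {δ | dimension δ = n - 1 ∧ ∃ δ' ∈ S, ∃ x, δ = δ' ∩ closure (cell G O h x)}

/-- `p` is the choice on `S(h)` given by the cells: `p δ = x` iff `δ` lies in the closed cell
of `x`. This determines `p` on `S(h)`. -/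
def IsCellChoice {n : ℕ} (S : Set (Set (EuclideanSpace ℝ (Fin n)))) (G : EuclideanGraph n)
    (O : Set (EuclideanSpace ℝ (Fin n))) (h : G.T → G.T → ℝ)
    (p : Set (EuclideanSpace ℝ (Fin n)) → G.T) : Prop :=
  ∀ δ ∈ cutComplex S G O h, ∀ x, p δ = x ↔ δ ⊆ closure (cell G O h x)

/-- `S` is `ε`-tubular with respect to `G` and `O`, the positions of the cutting hyperplanes being
bounded by `f` and `g`. If `G` has a single vertex, `f = g = 0` carry no information. -/
def IsTubular {n : ℕ} (ε : ℝ) (S : Set (Set (EuclideanSpace ℝ (Fin n)))) (G : EuclideanGraph n)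
    (O : Set (EuclideanSpace ℝ (Fin n))) (f g : G.T → G.T → ℝ) : Prop :=
  IsComplex (n - 1) S ∧ G.IsLinear ∧ IsOpen O ∧ frontier O = ⋃₀ S ∧
  (∀ x : G.T, (x : EuclideanSpace ℝ (Fin n)) ∈ O) ∧
  Anticommutative f ∧ Anticommutative g ∧
  (G.T.card = 1 → Bornology.IsBounded O ∧
    ∀ x : G.T, StarConvex ℝ (x : EuclideanSpace ℝ (Fin n)) O) ∧
  (1 < G.T.card →
    (∀ x y : G.T, G.graph.Adj x y →
      |f x y| < dist x y / 2 ∧ |g x y| < dist x y / 2 ∧ ε ≤ |f x y - g x y|) ∧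
    ∀ h ∈ cuts f g, IsComplex (n - 1) (cutComplex S G O h) ∧
      ∃ p, IsCellChoice S G O h p ∧
        ComplexSimpleOcclusion (cutComplex S G O h) G p ∧
        SeparatingFamily (cutComplex S G O h) G p (cell G O h) ∧
        TotalOcclusion (cutComplex S G O h) G p O (cell G O h))

/-! Shape parameters -/

/-- `ν` is a unit normal at `t` to `∂O`: the tangent cone to `∂O` at `t` is the hyperplane
orthogonal to `ν`. -/
def IsUnitNormal {n : ℕ} (O : Set (EuclideanSpace ℝ (Fin n))) (t ν : EuclideanSpace ℝ (Fin n)) :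
    Prop :=
  t ∈ frontier O ∧ ‖ν‖ = 1 ∧ posTangentConeAt (frontier O) t = {v | inner ℝ ν v = 0}

/-- The part of `∂O` in the closed cells of `x` and `y`. -/
def wall {n : ℕ} (G : EuclideanGraph n) (O : Set (EuclideanSpace ℝ (Fin n)))
    (h : G.T → G.T → ℝ) (x y : G.T) : Set (EuclideanSpace ℝ (Fin n)) :=
  frontier O ∩ (closure (cell G O h x) ∪ closure (cell G O h y))

/-- `β₋` -/
def betaMinus {n : ℕ} (G : EuclideanGraph n) (O : Set (EuclideanSpace ℝ (Fin n)))
    (f g : G.T → G.T → ℝ) : ℝ :=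
  if G.T.card = 1 then
    sInf {r | ∃ x : G.T, r = Metric.infDist (x : EuclideanSpace ℝ (Fin n)) (frontier O)}
  else
    sInf {r | ∃ h ∈ cuts f g, ∃ x y : G.T, G.graph.Adj x y ∧
      ∃ z ∈ segment ℝ (x : EuclideanSpace ℝ (Fin n)) y, r = Metric.infDist z (wall G O h x y)}

/-- `β₊` -/
def betaPlus {n : ℕ} (G : EuclideanGraph n) (O : Set (EuclideanSpace ℝ (Fin n)))
    (f g : G.T → G.T → ℝ) : ℝ :=
  if G.T.card = 1 then
    sSup {r | ∃ x : G.T, ∃ t ∈ frontier O, r = dist (x : EuclideanSpace ℝ (Fin n)) t}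
  else
    sSup {r | ∃ h ∈ cuts f g, ∃ x y : G.T, G.graph.Adj x y ∧
      ∃ z ∈ segment ℝ (x : EuclideanSpace ℝ (Fin n)) y, ∃ t ∈ wall G O h x y, r = dist z t}

/-- `α₋`, the smallest edge length (and `β₋` if there is a single vertex) -/
def alphaMinus {n : ℕ} (G : EuclideanGraph n) (O : Set (EuclideanSpace ℝ (Fin n)))
    (f g : G.T → G.T → ℝ) : ℝ :=
  if G.T.card = 1 then betaMinus G O f g
  else sInf {r | ∃ x y : G.T, G.graph.Adj x y ∧ r = dist x y}

/-- `α₊`, the largest edge length (and `β₊` if there is a single vertex) -/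
def alphaPlus {n : ℕ} (G : EuclideanGraph n) (O : Set (EuclideanSpace ℝ (Fin n)))
    (f g : G.T → G.T → ℝ) : ℝ :=
  if G.T.card = 1 then betaPlus G O f g
  else sSup {r | ∃ x y : G.T, G.graph.Adj x y ∧ r = dist x y}

/-- `γ` -/
def gamma {n : ℕ} (G : EuclideanGraph n) (O : Set (EuclideanSpace ℝ (Fin n)))
    (f g : G.T → G.T → ℝ) : ℝ :=
  (if G.T.card = 1 then
    MeasureTheory.Measure.hausdorffMeasure ((n : ℝ) - 1) (frontier O)
  else
    ⨆ h ∈ cuts f g, ⨆ x : G.T,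
      MeasureTheory.Measure.hausdorffMeasure ((n : ℝ) - 1)
        (frontier O ∩ closure (cell G O h x))).toReal ^ (1 / ((n : ℝ) - 1))

/-- `η` -/
def eta {n : ℕ} (G : EuclideanGraph n) (O : Set (EuclideanSpace ℝ (Fin n)))
    (f g : G.T → G.T → ℝ) : ℝ :=
  if G.T.card = 1 then
    sInf {r | ∃ x : G.T, ∃ t ν, IsUnitNormal O t ν ∧ r = |inner ℝ ν (t - x)| / ‖t - x‖}
  else
    sInf {r | ∃ h ∈ cuts f g, ∃ x y : G.T, G.graph.Adj x y ∧
      ∃ z ∈ segment ℝ (x : EuclideanSpace ℝ (Fin n)) y, ∃ t ∈ wall G O h x y, ∃ ν,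
        IsUnitNormal O t ν ∧ r = |inner ℝ ν (t - z)| / ‖t - z‖}

end

end TubularSuspension

/-! The freedom in the cuts is spent on keeping them away from the vertices of the polyhedra. Let a
polyhedron of diameter at most `R`, whose positive-dimensional faces contain relative balls of
radius `r`, be cut by a hyperplane at distance at least `d` from its vertices. The faces of the
result contain balls of radius `min 1 (d / (2 * R)) * r`: a ball contracted towards a vertex stays
on the side of this vertex, and two such balls on opposite sides interpolate to one centred on the
hyperplane (`exists_relBall_of_inter_halfSpace`). A pigeonhole argument (`exists_level`,
`exists_cut`) provides a good `d` as soon as the number of vertices to avoid is bounded for each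
cell. This number is controlled by two packing bounds: `exists_bound_card_extremePoints` for the
vertices of one round polyhedron, through its facets, and `exists_bound_ncard_relevant` for the
polyhedra attached to one vertex of the graph. The latter contain balls of definite size at bounded
distance, and occlusion keeps the centres apart.

The faces of the suspension are faces of `S(h)`, vertices and edges of the graph, cones over faces,
and joins of faces with edges. A cone of height at least `a` over a set containing a ball of radius
`r` contains a ball of radius `coneRadius r a R`, and a join is a cone over a cone
(`exists_relBall_of_face`). The heights are bounded below because the distance from a point of an
edge to the hyperplane of a polyhedron is at least `η β₋`. For the second apex of a join, the
distance from that apex to the cutting hyperplane is used as well.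

The suspension is a complex because a point determines the face whose relative interior contains it
(`eq_of_position`): occlusion treats faces with the same vertex or edge, separation of the cells the
others. It fills the closure of `O` because a ray from `x` leaves the closed cell of `x` either
through the boundary of `O`, under a cone, or through the wall shared with a neighbour `y`. In that
wall, a ray issued from the point of `[x, y]` leaves through the boundary of `O`, and the base of a
join is found there (`cell_subset_sUnion_hulls`).

This last argument needs three facts: two walls of a cell do not meet, a wall belongs to the closed
cells on both sides, and the boundary inside a closed cell is covered by the pieces of that cell.
They come from the goodness of all the nearby cuts. For instance, if a point were close to two walls
of `x`, moving both cuts towards `x` would put nearby points in the closed cells of both neighbours,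
and the graph would have a 3-cycle (`not_close_of_adj_adj`).

All lengths are measured in units of `ρ₊`, and `n` takes finitely many values, so the constants
depend on `K` only. -/

section

open Set Metric Topology

namespace TubularSuspension

/-! ### Relative interiors and extreme subsets of convex sets. -/

section Convexity

variable {E : Type*} [NormedAddCommGroup E] [InnerProductSpace ℝ E]

theorem mem_intrinsicInterior_iff_closedBall {s : Set E} {x : E} :
    x ∈ intrinsicInterior ℝ s ↔
      x ∈ s ∧ ∃ r > 0, closedBall x r ∩ affineSpan ℝ s ⊆ s := by
  rw [mem_intrinsicInterior]
  constructor
  · rintro ⟨y, hy, rfl⟩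
    refine ⟨interior_subset (s := ((↑) ⁻¹' s : Set (affineSpan ℝ s))) hy, ?_⟩
    obtain ⟨r, hr, hsub⟩ := Metric.nhds_basis_closedBall.mem_iff.1 (mem_interior_iff_mem_nhds.1 hy)
    refine ⟨r, hr, ?_⟩
    rintro z ⟨hz, hzs⟩
    exact hsub (show (⟨z, hzs⟩ : affineSpan ℝ s) ∈ closedBall y r from hz)
  · rintro ⟨hx, r, hr, hsub⟩
    refine ⟨⟨x, subset_affineSpan ℝ s hx⟩, mem_interior_iff_mem_nhds.2 ?_, rfl⟩
    refine Metric.nhds_basis_closedBall.mem_iff.2 ⟨r, hr, ?_⟩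
    intro z hz
    exact hsub ⟨hz, z.2⟩

theorem lineMap_mem_affineSpan {s : Set E} {x y : E} (hx : x ∈ affineSpan ℝ s)
    (hy : y ∈ affineSpan ℝ s) (t : ℝ) : x + t • (y - x) ∈ affineSpan ℝ s := by
  have := AffineMap.lineMap_mem t hx hy
  rwa [AffineMap.lineMap_apply, vsub_eq_sub, vadd_eq_add, add_comm] at this

theorem exists_prolongation {s : Set E} {x y : E} (hx : x ∈ intrinsicInterior ℝ s)
    (hy : y ∈ s) : ∃ t : ℝ, 0 < t ∧ x + t • (x - y) ∈ s := by
  obtain ⟨hxs, r, hr, hsub⟩ := mem_intrinsicInterior_iff_closedBall.1 hx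
  -- The added `1` keeps the denominator positive when `x = y`.
  refine ⟨r / (‖x - y‖ + 1), by positivity, hsub ⟨?_, ?_⟩⟩
  · rw [mem_closedBall, dist_eq_norm, add_sub_cancel_left, norm_smul, Real.norm_of_nonneg (by positivity),
      div_mul_eq_mul_div, div_le_iff₀ (by positivity)]
    nlinarith [norm_nonneg (x - y)]
  · have := lineMap_mem_affineSpan (subset_affineSpan ℝ s hxs) (subset_affineSpan ℝ s hy)
      (-(r / (‖x - y‖ + 1)))
    rwa [neg_smul, ← smul_neg, neg_sub] at this

theorem mem_openSegment_prolongation (g x : E) {t : ℝ} (ht : 0 < t) :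
    g ∈ openSegment ℝ x (g + t • (g - x)) := by
  have h1 : (1 + t) ≠ 0 := by positivity
  refine ⟨t / (1 + t), 1 / (1 + t), by positivity, by positivity, by field_simp; ring, ?_⟩
  have : (1 : ℝ) / (1 + t) + t / (1 + t) = 1 := by field_simp
  calc (t / (1 + t)) • x + (1 / (1 + t)) • (g + t • (g - x))
      = (1 / (1 + t) + t / (1 + t)) • g := by
        simp only [smul_add, smul_sub, smul_smul, add_smul]
        rw [show 1 / (1 + t) * t = t / (1 + t) by ring]
        abel
    _ = g := by rw [this, one_smul]

theorem exists_prolongation_openSegment {s : Set E} {x y : E} (hx : x ∈ intrinsicInterior ℝ s)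
    (hy : y ∈ s) : ∃ z ∈ s, x ∈ openSegment ℝ y z := by
  obtain ⟨t, ht, h⟩ := exists_prolongation hx hy
  exact ⟨_, h, mem_openSegment_prolongation x y ht⟩

/-- The homothety of centre `y` and ratio `a` carries the relative ball around `x` to one of radius
`a * r` around the combination. -/
theorem combo_mem_intrinsicInterior {s : Set E} (hs : Convex ℝ s) {x y : E}
    (hx : x ∈ intrinsicInterior ℝ s) (hy : y ∈ s) {a b : ℝ} (ha : 0 < a) (hb : 0 ≤ b)
    (hab : a + b = 1) : a • x + b • y ∈ intrinsicInterior ℝ s := by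
  obtain ⟨hxs, r, hr, hsub⟩ := mem_intrinsicInterior_iff_closedBall.1 hx
  refine mem_intrinsicInterior_iff_closedBall.2
    ⟨hs hxs hy ha.le hb hab, a * r, by positivity, ?_⟩
  rintro z ⟨hz, hzs⟩
  have hxa := subset_affineSpan ℝ s hxs
  have hya := subset_affineSpan ℝ s hy
  have hw : x + (1 / a) • (z - (a • x + b • y)) ∈ s := by
    refine hsub ⟨?_, ?_⟩
    · rw [mem_closedBall, dist_eq_norm, add_sub_cancel_left, norm_smul,
        Real.norm_of_nonneg (by positivity)]
      rw [mem_closedBall, dist_eq_norm] at hz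
      rw [div_mul_eq_mul_div, one_mul, div_le_iff₀ ha]
      linarith
    · have hm : a • x + b • y ∈ affineSpan ℝ s := by
        have := lineMap_mem_affineSpan hxa hya b
        convert this using 1
        rw [show a = 1 - b by linarith]; module
      have h1 : z - (a • x + b • y) ∈ (affineSpan ℝ s).direction :=
        AffineSubspace.vsub_mem_direction hzs hm
      have := AffineSubspace.vadd_mem_of_mem_direction
        (Submodule.smul_mem _ (1 / a) h1) hxa
      rwa [vadd_eq_add, add_comm] at this
  have := hs hw hy ha.le hb hab
  convert this using 1
  rw [smul_add, smul_smul, mul_one_div_cancel ha.ne', one_smul]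
  abel

/-- A relative interior point lies inside a segment of `s` issued from any given point of `s`, and
extremality passes from the inner point to the endpoints. This is how faces are identified from a
single point throughout. -/
theorem subset_of_mem_intrinsicInterior {D s t : Set E} {x : E} (hs : s ⊆ D)
    (ht : IsExtreme ℝ D t) (hx : x ∈ intrinsicInterior ℝ s) (hxt : x ∈ t) : s ⊆ t := by
  intro a ha
  obtain ⟨z, hz, hxz⟩ := exists_prolongation_openSegment hx ha
  exact ht.left_mem_of_mem_openSegment (hs ha) (hs hz) hxt hxz

theorem eq_of_isExtreme_of_mem_intrinsicInterior {D s t : Set E} {x : E} (hs : IsExtreme ℝ D s)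
    (ht : IsExtreme ℝ D t) (hx : x ∈ intrinsicInterior ℝ s) (hxt : x ∈ intrinsicInterior ℝ t) :
    s = t :=
  (subset_of_mem_intrinsicInterior hs.1 ht hx (intrinsicInterior_subset hxt)).antisymm
    (subset_of_mem_intrinsicInterior ht.1 hs hxt (intrinsicInterior_subset hx))

theorem intrinsicInterior_mono_of_affineSpan_eq {s t : Set E} (hst : s ⊆ t)
    (h : affineSpan ℝ t ≤ affineSpan ℝ s) : intrinsicInterior ℝ s ⊆ intrinsicInterior ℝ t := by
  intro x hx
  obtain ⟨hxs, r, hr, hsub⟩ := mem_intrinsicInterior_iff_closedBall.1 hx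
  exact mem_intrinsicInterior_iff_closedBall.2 ⟨hst hxs, r, hr, fun z hz =>
    hst (hsub ⟨hz.1, h hz.2⟩)⟩

end Convexity

/-! ### Faces of polyhedra, and polytopes as polyhedra. -/

section Polyhedra

variable {n : ℕ} {P : Set (EuclideanSpace ℝ (Fin n))}

/-- The set of solutions of a family of linear inequalities. -/
def solutions (s : Finset (EuclideanSpace ℝ (Fin n) × ℝ)) : Set (EuclideanSpace ℝ (Fin n)) :=
  {x | ∀ q ∈ s, inner ℝ q.1 x ≤ q.2}

theorem inner_le_of_mem_solutions {s : Finset (EuclideanSpace ℝ (Fin n) × ℝ)}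
    {x : EuclideanSpace ℝ (Fin n)} (hx : x ∈ solutions s) {q : EuclideanSpace ℝ (Fin n) × ℝ}
    (hq : q ∈ s) : inner ℝ q.1 x ≤ q.2 := hx q hq

theorem convex_solutions (s : Finset (EuclideanSpace ℝ (Fin n) × ℝ)) : Convex ℝ (solutions s) := by
  intro x hx y hy a b ha hb hab q hq
  rw [inner_add_right, inner_smul_right, inner_smul_right]
  calc a * inner ℝ q.1 x + b * inner ℝ q.1 y ≤ a * q.2 + b * q.2 :=
        add_le_add (mul_le_mul_of_nonneg_left (hx q hq) ha) (mul_le_mul_of_nonneg_left (hy q hq) hb)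
    _ = q.2 := by rw [← add_mul, hab, one_mul]

theorem IsPolyhedron.convex (hP : IsPolyhedron P) : Convex ℝ P := by
  obtain ⟨-, -, s, -, rfl⟩ := hP
  exact convex_solutions s

/-- Small prolongations of a segment stay in the half-spaces that are not active at its endpoint,
and in those that are active at both ends. -/
theorem exists_prolongation_solutions (s : Finset (EuclideanSpace ℝ (Fin n) × ℝ))
    {g x : EuclideanSpace ℝ (Fin n)} (hg : g ∈ solutions s)
    (h : ∀ q ∈ s, inner ℝ q.1 g = q.2 → q.2 ≤ inner ℝ q.1 x) :
    ∃ t : ℝ, 0 < t ∧ g + t • (g - x) ∈ solutions s := by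
  have key : ∀ q ∈ s, ∀ᶠ t : ℝ in 𝓝[>] 0, inner ℝ q.1 (g + t • (g - x)) ≤ q.2 := by
    intro q hq
    rcases (hg q hq).lt_or_eq with hlt | heq
    · have hc : Filter.Tendsto (fun t : ℝ => (inner ℝ q.1 (g + t • (g - x)) : ℝ)) (𝓝[>] 0)
          (𝓝 (inner ℝ q.1 g)) := by
        have : Continuous (fun t : ℝ => (inner ℝ q.1 (g + t • (g - x)) : ℝ)) := by fun_prop
        have h2 := this.tendsto 0
        simp only [zero_smul, add_zero] at h2
        exact h2.mono_left nhdsWithin_le_nhds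
      exact (hc.eventually (gt_mem_nhds hlt)).mono fun t ht => ht.le
    · filter_upwards [self_mem_nhdsWithin] with t ht
      rw [inner_add_right, inner_smul_right, inner_sub_right, heq]
      have := h q hq heq
      have ht : (0 : ℝ) < t := ht
      nlinarith
  have hall : ∀ᶠ t : ℝ in 𝓝[>] 0, ∀ q ∈ s, inner ℝ q.1 (g + t • (g - x)) ≤ q.2 :=
    (Filter.eventually_all_finset s).2 key
  obtain ⟨t, ht, ht0⟩ := (hall.and self_mem_nhdsWithin).exists
  exact ⟨t, ht0, ht⟩

/-- The face of a polyhedron cut out by a set of active constraints. -/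
theorem isExposed_active (s I : Finset (EuclideanSpace ℝ (Fin n) × ℝ)) (hI : I ⊆ s) :
    IsExposed ℝ (solutions s) {x ∈ solutions s | ∀ q ∈ I, inner ℝ q.1 x = q.2} := by
  rintro ⟨g, hg, hgI⟩
  -- The sum of the normals is at most the sum of the bounds, with equality exactly when every
  -- constraint of `I` is tight.
  refine ⟨innerSL ℝ (∑ q ∈ I, q.1), ?_⟩
  have hsum : ∀ x : EuclideanSpace ℝ (Fin n), innerSL ℝ (∑ q ∈ I, q.1) x
      = ∑ q ∈ I, inner ℝ q.1 x := fun x => by simp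
  ext x
  simp only [mem_ofPred_eq, hsum]
  constructor
  · rintro ⟨hx, hxI⟩
    refine ⟨hx, fun y hy => Finset.sum_le_sum fun q hq => ?_⟩
    rw [hxI q hq]
    exact hy q (hI hq)
  · rintro ⟨hx, hmax⟩
    refine ⟨hx, ?_⟩
    have h1 := hmax g hg
    rw [Finset.sum_congr rfl hgI] at h1
    have h2 : ∑ q ∈ I, inner ℝ q.1 x = ∑ q ∈ I, q.2 :=
      le_antisymm (Finset.sum_le_sum fun q hq => hx q (hI hq)) h1
    exact (Finset.sum_eq_sum_iff_of_le fun q hq => hx q (hI hq)).1 h2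

/-- Averaging produces a point `g` of `F` whose tight constraints are tight on all of `F`. A
solution `x` satisfying these constraints with equality can be prolonged beyond `g`, so extremality
puts `x` in `F`. -/
theorem exists_active_eq_of_isExtreme (s : Finset (EuclideanSpace ℝ (Fin n) × ℝ))
    {F : Set (EuclideanSpace ℝ (Fin n))} (hne : F.Nonempty) (hc : Convex ℝ F)
    (hF : IsExtreme ℝ (solutions s) F) :
    ∃ I ⊆ s, F = {x ∈ solutions s | ∀ q ∈ I, inner ℝ q.1 x = q.2} := by
  classical
  have key : ∀ J ⊆ s, ∃ g ∈ F, ∀ q ∈ J, (∃ y ∈ F, inner ℝ q.1 y < q.2) → inner ℝ q.1 g < q.2 := by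
    intro J
    induction J using Finset.induction_on with
    | empty => intro _; obtain ⟨g, hg⟩ := hne; exact ⟨g, hg, by simp⟩
    | insert q J hqJ ih =>
      intro hJ
      obtain ⟨g, hg, hgJ⟩ := ih ((Finset.subset_insert _ _).trans hJ)
      by_cases hq : ∃ y ∈ F, inner ℝ q.1 y < q.2
      · obtain ⟨y, hy, hyq⟩ := hq
        -- A midpoint is strict for every constraint that is strict at one of its two ends.
        refine ⟨(1 / 2 : ℝ) • g + (1 / 2 : ℝ) • y,
          hc hg hy (by norm_num) (by norm_num) (by norm_num), ?_⟩
        intro q' hq' hq'2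
        rw [inner_add_right, inner_smul_right, inner_smul_right]
        have h1 := inner_le_of_mem_solutions (hF.subset hg) (hJ hq')
        have h2 := inner_le_of_mem_solutions (hF.subset hy) (hJ hq')
        rcases Finset.mem_insert.1 hq' with rfl | hmem
        · linarith
        · linarith [hgJ q' hmem hq'2]
      · refine ⟨g, hg, fun q' hq' hq'2 => ?_⟩
        rcases Finset.mem_insert.1 hq' with rfl | hmem
        · exact absurd hq'2 hq
        · exact hgJ q' hmem hq'2
  obtain ⟨g, hg, hgs⟩ := key s subset_rfl
  refine ⟨s.filter fun q => ∀ y ∈ F, inner ℝ q.1 y = q.2, Finset.filter_subset _ _, ?_⟩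
  ext x
  simp only [Finset.mem_filter, mem_ofPred_eq]
  constructor
  · exact fun hx => ⟨hF.subset hx, fun q hq => hq.2 x hx⟩
  · rintro ⟨hx, hxI⟩
    obtain ⟨t, ht, hmem⟩ := exists_prolongation_solutions s (hF.subset hg) (x := x) (by
      intro q hq hgq
      refine (hxI q ⟨hq, fun y hy => ?_⟩).ge
      by_contra hne
      exact (hgs q hq ⟨y, hy, lt_of_le_of_ne (inner_le_of_mem_solutions (hF.subset hy) hq) hne⟩).ne hgq)
    exact hF.left_mem_of_mem_openSegment hx hmem hg (mem_openSegment_prolongation g x ht)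

/-- Allows faces to be handled as convex extreme subsets, a notion that is transitive, whereas
exposed faces of general convex sets are not. -/
theorem IsPolyhedron.isExposed_of_isExtreme (hP : IsPolyhedron P)
    {F : Set (EuclideanSpace ℝ (Fin n))} (hne : F.Nonempty) (hc : Convex ℝ F)
    (hF : IsExtreme ℝ P F) : IsExposed ℝ P F := by
  obtain ⟨-, -, s, -, hs⟩ := hP
  obtain ⟨I, hI, rfl⟩ := exists_active_eq_of_isExtreme s hne hc (by rwa [← show P = solutions s from hs])
  rw [show P = solutions s from hs]
  exact isExposed_active s I hI

theorem subfaces_isExtreme {F : Set (EuclideanSpace ℝ (Fin n))} (hF : F ∈ subfaces P) :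
    IsExtreme ℝ P F := hF.2.isExtreme

theorem IsPolyhedron.convex_of_subface (hP : IsPolyhedron P)
    {F : Set (EuclideanSpace ℝ (Fin n))} (hF : F ∈ subfaces P) : Convex ℝ F :=
  hF.2.convex hP.convex

theorem IsPolyhedron.mem_subfaces (hP : IsPolyhedron P)
    {F : Set (EuclideanSpace ℝ (Fin n))} (hne : F.Nonempty) (hc : Convex ℝ F)
    (hF : IsExtreme ℝ P F) : F ∈ subfaces P :=
  ⟨hne, hP.isExposed_of_isExtreme hne hc hF⟩

theorem IsPolyhedron.self_mem_subfaces (hP : IsPolyhedron P) : P ∈ subfaces P :=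
  hP.mem_subfaces hP.1 hP.convex (IsExtreme.refl ℝ P)

theorem IsPolyhedron.subface (hP : IsPolyhedron P)
    {F : Set (EuclideanSpace ℝ (Fin n))} (hF : F ∈ subfaces P) : IsPolyhedron F := by
  classical
  refine ⟨hF.1, hF.2.isCompact hP.2.1, ?_⟩
  have hc := hP.convex_of_subface hF
  obtain ⟨-, -, s, hs0, hs⟩ := hP
  obtain ⟨I, hI, hFI⟩ := exists_active_eq_of_isExtreme s hF.1 hc
    (by rw [← show P = solutions s from hs]; exact subfaces_isExtreme hF)
  refine ⟨s ∪ I.image fun q => (-q.1, -q.2), ?_, ?_⟩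
  · intro q hq
    rcases Finset.mem_union.1 hq with hq | hq
    · exact hs0 q hq
    · obtain ⟨q', hq', rfl⟩ := Finset.mem_image.1 hq
      exact neg_ne_zero.2 (hs0 q' (hI hq'))
  · rw [hFI]
    ext x
    simp only [solutions, mem_ofPred_eq, Finset.mem_union, Finset.mem_image]
    constructor
    · rintro ⟨h1, h2⟩ q (hq | ⟨q', hq', rfl⟩)
      · exact h1 q hq
      · simp [h2 q' hq', inner_neg_left]
    · intro h
      refine ⟨fun q hq => h q (Or.inl hq), fun q hq => le_antisymm (h q (Or.inl (hI hq))) ?_⟩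
      have := h (-q.1, -q.2) (Or.inr ⟨q, hq, rfl⟩)
      simpa [inner_neg_left] using this

theorem IsPolyhedron.subfaces_trans (hP : IsPolyhedron P)
    {F G : Set (EuclideanSpace ℝ (Fin n))} (hF : F ∈ subfaces P) (hG : G ∈ subfaces F) :
    G ∈ subfaces P :=
  hP.mem_subfaces hG.1 ((hP.subface hF).convex_of_subface hG)
    ((subfaces_isExtreme hF).trans (subfaces_isExtreme hG))

theorem inner_eq_of_mem_affineSpan {F : Set (EuclideanSpace ℝ (Fin n))}
    {a : EuclideanSpace ℝ (Fin n)} {b : ℝ}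
    (h : ∀ x ∈ F, inner ℝ a x = b) {x : EuclideanSpace ℝ (Fin n)} (hx : x ∈ affineSpan ℝ F) :
    inner ℝ a x = b := by
  refine affineSpan_induction (p := fun x => inner ℝ a x = b) hx h fun c u v w hu hv hw => ?_
  rw [vsub_eq_sub, vadd_eq_add, inner_add_right, inner_smul_right, inner_sub_right, hu, hv, hw]
  ring

/-- The face is given by the constraints tight at `g`: they are equalities on its affine hull, and
the other constraints persist near `g`. -/
theorem IsPolyhedron.exists_subface_mem_intrinsicInterior (hP : IsPolyhedron P)
    {g : EuclideanSpace ℝ (Fin n)} (hg : g ∈ P) :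
    ∃ F ∈ subfaces P, g ∈ intrinsicInterior ℝ F := by
  classical
  obtain ⟨-, -, s, -, hs⟩ := hP
  have hs : P = solutions s := hs
  subst hs
  set I := s.filter fun q => inner ℝ q.1 g = q.2
  have hgF : g ∈ {x ∈ solutions s | ∀ q ∈ I, inner ℝ q.1 x = q.2} :=
    ⟨hg, fun q hq => (Finset.mem_filter.1 hq).2⟩
  refine ⟨_, ⟨⟨g, hgF⟩, isExposed_active s I (Finset.filter_subset _ _)⟩, ?_⟩
  refine mem_intrinsicInterior_iff_closedBall.2 ⟨hgF, ?_⟩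
  have hev : ∀ᶠ x in 𝓝 g, ∀ q ∈ s, inner ℝ q.1 g < q.2 → inner ℝ q.1 x ≤ q.2 := by
    refine (Filter.eventually_all_finset s).2 fun q hq => ?_
    by_cases hlt : inner ℝ q.1 g < q.2
    · have : Filter.Tendsto (fun x => (inner ℝ q.1 x : ℝ)) (𝓝 g) (𝓝 (inner ℝ q.1 g)) :=
        (Continuous.tendsto (by fun_prop) g)
      exact (this.eventually (gt_mem_nhds hlt)).mono fun x hx _ => hx.le
    · exact Filter.Eventually.of_forall fun x hx => absurd hx hlt
  obtain ⟨r, hr, hsub⟩ := Metric.nhds_basis_closedBall.mem_iff.1 hev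
  refine ⟨r, hr, ?_⟩
  rintro x ⟨hx, hxa⟩
  have hxI : ∀ q ∈ I, inner ℝ q.1 x = q.2 := fun q hq =>
    inner_eq_of_mem_affineSpan (fun y hy => hy.2 q hq) hxa
  refine ⟨fun q hq => ?_, hxI⟩
  rcases (hg q hq).lt_or_eq with hlt | heq
  · exact hsub hx q hq hlt
  · exact (hxI q (Finset.mem_filter.2 ⟨hq, heq⟩)).le

theorem IsPolyhedron.inter_halfSpace (hP : IsPolyhedron P) {a : EuclideanSpace ℝ (Fin n)}
    (ha : a ≠ 0) (b : ℝ) (hne : (P ∩ {x | inner ℝ a x ≤ b}).Nonempty) :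
    IsPolyhedron (P ∩ {x | inner ℝ a x ≤ b}) := by
  classical
  refine ⟨hne, hP.2.1.inter_right (isClosed_le (by fun_prop) continuous_const), ?_⟩
  obtain ⟨-, -, s, hs0, rfl⟩ := hP
  refine ⟨insert (a, b) s, ?_, ?_⟩
  · intro q hq
    rcases Finset.mem_insert.1 hq with rfl | hq
    · exact ha
    · exact hs0 q hq
  · ext x
    simp only [mem_inter_iff, mem_ofPred_eq, Finset.mem_insert, forall_eq_or_imp]
    tauto

/-- A vertex is determined by its tight constraints: were two vertices to share them, the segment
between them could be prolonged. -/
theorem extremePoints_solutions_finite (s : Finset (EuclideanSpace ℝ (Fin n) × ℝ)) :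
    ((solutions s).extremePoints ℝ).Finite := by
  classical
  refine Set.Finite.of_finite_image (f := fun x : EuclideanSpace ℝ (Fin n) => s.filter fun q => inner ℝ q.1 x = q.2)
    ((s.powerset : Finset _).finite_toSet.subset ?_) ?_
  · rintro _ ⟨x, -, rfl⟩
    exact Finset.mem_coe.2 (Finset.mem_powerset.2 (Finset.filter_subset _ _))
  · intro x hx y hy hxy
    obtain ⟨t, ht, hmem⟩ := exists_prolongation_solutions s hx.1 (x := y) (by
      intro q hq hxq
      have : q ∈ s.filter fun q => inner ℝ q.1 x = q.2 := Finset.mem_filter.2 ⟨hq, hxq⟩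
      rw [show (s.filter fun q => inner ℝ q.1 x = q.2) = s.filter fun q => inner ℝ q.1 y = q.2
        from hxy] at this
      exact (Finset.mem_filter.1 this).2.ge)
    exact (hx.2 hy.1 hmem (mem_openSegment_prolongation x y ht)).symm

theorem IsPolyhedron.extremePoints_finite (hP : IsPolyhedron P) :
    (P.extremePoints ℝ).Finite := by
  obtain ⟨-, -, s, -, rfl⟩ := hP
  exact extremePoints_solutions_finite s

theorem convexHull_extremePoints_eq {K : Set (EuclideanSpace ℝ (Fin n))} (hK : IsCompact K)
    (hc : Convex ℝ K) (hf : (K.extremePoints ℝ).Finite) :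
    convexHull ℝ (K.extremePoints ℝ) = K := by
  conv_rhs => rw [← closure_convexHull_extremePoints hK hc]
  exact ((hf.isCompact_convexHull ℝ).isClosed.closure_eq).symm

/-- Minkowski-Weyl: a full-dimensional polytope is a polyhedron. -/
theorem isPolyhedron_convexHull_of_finite {V : Set (EuclideanSpace ℝ (Fin n))} (hV : V.Finite)
    (hint : (interior (convexHull ℝ V)).Nonempty) : IsPolyhedron (convexHull ℝ V) := by
  classical
  obtain ⟨c, hc⟩ := hint
  have hcomp : IsCompact (convexHull ℝ V) := hV.isCompact_convexHull ℝ
  refine ⟨⟨c, interior_subset hc⟩, hcomp, ?_⟩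
  obtain ⟨r, hr, hball⟩ := Metric.nhds_basis_closedBall.mem_iff.1 (mem_interior_iff_mem_nhds.1 hc)
  -- `solutions s` is the polar body of the hull about `c`. It is bounded thanks to the ball around
  -- `c`, hence the hull of its finitely many extreme points, and these will be the normals of the
  -- wanted half-spaces.
  set s : Finset (EuclideanSpace ℝ (Fin n) × ℝ) := hV.toFinset.image fun v => (v - c, 1) with hs
  have hmem : ∀ y, y ∈ solutions s ↔ ∀ v ∈ V, inner ℝ (v - c) y ≤ 1 := by
    intro y; simp [solutions, hs]
  have hhull : ∀ y ∈ solutions s, ∀ x ∈ convexHull ℝ V, inner ℝ y (x - c) ≤ 1 := by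
    intro y hy x hx
    have hconv : Convex ℝ {x : EuclideanSpace ℝ (Fin n) | inner ℝ y (x - c) ≤ 1} := by
      intro u hu v hv a b ha hb hab
      simp only [mem_ofPred_eq] at *
      have : a • u + b • v - c = a • (u - c) + b • (v - c) := by
        rw [show b = 1 - a by linarith]; module
      rw [this, inner_add_right, inner_smul_right, inner_smul_right]
      nlinarith
    refine convexHull_min (fun v hv => ?_) hconv hx
    have := (hmem y).1 hy v hv
    rwa [real_inner_comm] at this
  have hbdd : solutions s ⊆ closedBall 0 (1 / r) := by
    intro y hy
    rw [mem_closedBall_zero_iff]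
    by_cases hy0 : y = 0
    · simp [hy0]; positivity
    have hny : 0 < ‖y‖ := norm_pos_iff.2 hy0
    have := hhull y hy (c + (r / ‖y‖) • y) (hball (by
      rw [mem_closedBall, dist_eq_norm, add_sub_cancel_left, norm_smul,
        Real.norm_of_nonneg (by positivity)]
      field_simp; rfl))
    rw [add_sub_cancel_left, inner_smul_right, real_inner_self_eq_norm_sq] at this
    rw [le_div_iff₀ hr]
    have h2 : r / ‖y‖ * ‖y‖ ^ 2 = ‖y‖ * r := by field_simp
    linarith
  have hclosed : IsClosed (solutions s) := by
    have : solutions s = ⋂ q ∈ s, {x | inner ℝ q.1 x ≤ q.2} := by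
      ext x; simp [solutions]
    rw [this]
    exact isClosed_biInter fun q _ => isClosed_le (by fun_prop) continuous_const
  have hK : IsCompact (solutions s) := (isCompact_closedBall 0 (1 / r)).of_isClosed_subset hclosed hbdd
  have hW := extremePoints_solutions_finite s
  have hWhull := convexHull_extremePoints_eq hK (convex_solutions s) hW
  refine ⟨(hW.toFinset.filter (· ≠ 0)).image fun w => (w, 1 + inner ℝ w c), ?_, ?_⟩
  · intro q hq
    obtain ⟨w, hw, rfl⟩ := Finset.mem_image.1 hq
    exact (Finset.mem_filter.1 hw).2
  · ext x
    simp only [Finset.mem_image, Finset.mem_filter, Finite.mem_toFinset, mem_ofPred_eq]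
    constructor
    · rintro hx _ ⟨w, ⟨hw, -⟩, rfl⟩
      have := hhull w hw.1 x hx
      rw [inner_sub_right] at this
      simp only
      linarith
    · intro h
      by_contra hx
      -- Bipolar argument: a functional separating `x`, normalised about `c`, lies in the polar
      -- body, hence is a combination of its extreme points. The inequalities at those points then
      -- contradict the separation.
      obtain ⟨f, u, hfu, hux⟩ := geometric_hahn_banach_closed_point (convex_convexHull ℝ V)
        hcomp.isClosed hx
      set a := (InnerProductSpace.toDual ℝ (EuclideanSpace ℝ (Fin n))).symm f with ha
      have hfa : ∀ z, f z = inner ℝ a z := fun z => by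
        rw [ha, InnerProductSpace.toDual_symm_apply]
      have hfc := hfu c (interior_subset hc)
      have hpos : 0 < u - f c := by linarith
      set y := (1 / (u - f c)) • a with hy
      have hysol : y ∈ solutions s := by
        rw [hmem]
        intro v hv
        have := hfu v (subset_convexHull ℝ V hv)
        rw [hy, inner_smul_right, real_inner_comm, inner_sub_right, ← hfa, ← hfa,
          one_div, inv_mul_le_iff₀ hpos]
        linarith
      have hyx : 1 < inner ℝ y (x - c) := by
        rw [hy, inner_smul_left, inner_sub_right, ← hfa, ← hfa]
        simp only [one_div, map_inv₀, conj_trivial]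
        rw [lt_inv_mul_iff₀ hpos]
        linarith
      have hle : y ∈ {y : EuclideanSpace ℝ (Fin n) | inner ℝ y (x - c) ≤ 1} := by
        rw [← hWhull] at hysol
        refine convexHull_min ?_ ?_ hysol
        · intro w hw
          by_cases hw0 : w = 0
          · simp [hw0]
          have := h (w, 1 + inner ℝ w c) ⟨w, ⟨hw, hw0⟩, rfl⟩
          simp only [mem_ofPred_eq, inner_sub_right]
          simp only at this
          linarith
        · intro p hp q hq α β hα hβ hαβ
          simp only [mem_ofPred_eq] at *
          rw [inner_add_left, inner_smul_left, inner_smul_left]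
          simp only [conj_trivial]
          nlinarith
      exact absurd hle (not_le.2 hyx)

end Polyhedra

/-! ### Intersections of polyhedra in a complex. -/

section Complexes

variable {n k : ℕ} {S : Set (Set (EuclideanSpace ℝ (Fin n)))}

theorem IsComplex.isPolyhedron (hS : IsComplex k S) {δ : Set (EuclideanSpace ℝ (Fin n))}
    (hδ : δ ∈ S) : IsPolyhedron δ := (hS.2.1 δ hδ).1

theorem mem_allSubfaces {δ φ : Set (EuclideanSpace ℝ (Fin n))} (hδ : δ ∈ S)
    (hφ : φ ∈ subfaces δ) : φ ∈ allSubfaces S := mem_biUnion hδ hφ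

theorem IsComplex.eq_of_mem (hS : IsComplex k S) {α β : Set (EuclideanSpace ℝ (Fin n))}
    (hα : α ∈ allSubfaces S) (hβ : β ∈ allSubfaces S) {x : EuclideanSpace ℝ (Fin n)}
    (hxα : x ∈ intrinsicInterior ℝ α) (hxβ : x ∈ intrinsicInterior ℝ β) : α = β := by
  by_contra h
  exact disjoint_left.1 (hS.2.2 α hα β hβ h) hxα hxβ

/-- The face of `α` and the face of `β` having `g` in their relative interiors are equal, so a
segment of `α` through `g` has its ends in a face of `β`. -/
theorem IsComplex.inter_mem_subfaces (hS : IsComplex k S) {α β : Set (EuclideanSpace ℝ (Fin n))}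
    (hα : α ∈ S) (hβ : β ∈ S) (hne : (α ∩ β).Nonempty) : α ∩ β ∈ subfaces α := by
  have hPα := hS.isPolyhedron hα
  have hPβ := hS.isPolyhedron hβ
  refine hPα.mem_subfaces hne (hPα.convex.inter hPβ.convex) ⟨inter_subset_left, ?_⟩
  intro a ha b hb g hg hgab
  obtain ⟨F, hF, hgF⟩ := hPα.exists_subface_mem_intrinsicInterior hg.1
  obtain ⟨F', hF', hgF'⟩ := hPβ.exists_subface_mem_intrinsicInterior hg.2
  have : F = F' := hS.eq_of_mem (mem_allSubfaces hα hF) (mem_allSubfaces hβ hF') hgF hgF'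
  subst this
  have haF := (subfaces_isExtreme hF).left_mem_of_mem_openSegment ha hb
    (intrinsicInterior_subset hgF) hgab
  exact ⟨ha, hF'.2.subset haF⟩

theorem affineSpan_eq_of_dimension_le {A B : Set (EuclideanSpace ℝ (Fin n))} (hne : A.Nonempty)
    (h : A ⊆ B) (hd : dimension B ≤ dimension A) : affineSpan ℝ A = affineSpan ℝ B := by
  have hle := affineSpan_mono ℝ h
  obtain ⟨a, ha⟩ := hne
  refine AffineSubspace.eq_of_direction_eq_of_nonempty_of_le ?_ ⟨a, subset_affineSpan ℝ A ha⟩ hle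
  exact Submodule.eq_of_le_of_finrank_le (AffineSubspace.direction_le hle) hd

/-- A point of a cell of a complex that lies in the relative interior of another cell. -/
theorem IsComplex.eq_of_mem_intrinsicInterior (hS : IsComplex k S)
    {α β : Set (EuclideanSpace ℝ (Fin n))} (hα : α ∈ S) (hβ : β ∈ S)
    {x : EuclideanSpace ℝ (Fin n)} (hxα : x ∈ α) (hxβ : x ∈ intrinsicInterior ℝ β) : α = β := by
  have hPα := hS.isPolyhedron hα
  have hPβ := hS.isPolyhedron hβ
  obtain ⟨F, hF, hxF⟩ := hPα.exists_subface_mem_intrinsicInterior hxα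
  have hFβ := hS.eq_of_mem (mem_allSubfaces hα hF) (mem_allSubfaces hβ hPβ.self_mem_subfaces) hxF hxβ
  subst hFβ
  have hspan : affineSpan ℝ F = affineSpan ℝ α := affineSpan_eq_of_dimension_le hF.1 hF.2.subset
    (by rw [(hS.2.1 α hα).2, (hS.2.1 F hβ).2])
  have := intrinsicInterior_mono_of_affineSpan_eq hF.2.subset hspan.ge hxF
  exact eq_of_isExtreme_of_mem_intrinsicInterior (IsExtreme.refl ℝ α) (subfaces_isExtreme hF) this hxF

end Complexes

end TubularSuspension

end

section

open Set Metric Topology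

namespace TubularSuspension

/-! ### Relative balls, homotheties and cones. -/

section Balls

variable {E : Type*} [NormedAddCommGroup E] [InnerProductSpace ℝ E]

/-- The ball of centre `c` and radius `r` relative to the affine hull of `A` is contained in `A`. -/
def RelBall (c : E) (r : ℝ) (A : Set E) : Prop :=
  c ∈ affineSpan ℝ A ∧ closedBall c r ∩ affineSpan ℝ A ⊆ A

theorem RelBall.mem {c : E} {r : ℝ} {A : Set E} (h : RelBall c r A) (hr : 0 ≤ r) : c ∈ A :=
  h.2 ⟨mem_closedBall_self hr, h.1⟩

theorem RelBall.mono {c : E} {r r' : ℝ} {A : Set E} (h : RelBall c r A) (hr : r' ≤ r) :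
    RelBall c r' A :=
  ⟨h.1, fun _ hx => h.2 ⟨closedBall_subset_closedBall hr hx.1, hx.2⟩⟩

theorem RelBall.mem_intrinsicInterior {c : E} {r : ℝ} {A : Set E} (h : RelBall c r A)
    (hr : 0 < r) : c ∈ intrinsicInterior ℝ A :=
  mem_intrinsicInterior_iff_closedBall.2 ⟨h.mem hr.le, r, hr, h.2⟩

theorem RelBall.exists_homothety {A : Set E} {c v q : E} {r t : ℝ} (h : RelBall c r A)
    (hv : v ∈ A) (ht : 0 < t) (hq : q ∈ closedBall (v + t • (c - v)) (t * r))
    (hqa : q ∈ affineSpan ℝ A) : ∃ p ∈ A, q = v + t • (p - v) := by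
  have hva := subset_affineSpan ℝ A hv
  refine ⟨v + (1 / t) • (q - v), h.2 ⟨?_, lineMap_mem_affineSpan hva hqa _⟩, ?_⟩
  · rw [mem_closedBall, dist_eq_norm] at hq ⊢
    have : v + (1 / t) • (q - v) - c = (1 / t) • (q - (v + t • (c - v))) := by
      have h1 : (1 / t) * t = 1 := by field_simp
      simp only [smul_sub, smul_add, smul_smul, h1, one_smul]
      abel
    rw [this, norm_smul, Real.norm_of_nonneg (by positivity), one_div, inv_mul_le_iff₀ ht]
    exact hq
  · rw [add_sub_cancel_left, smul_smul, mul_one_div_cancel ht.ne']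
    module

theorem _root_.Convex.homothety_mem {A : Set E} (hA : Convex ℝ A) {v p : E} (hv : v ∈ A) (hp : p ∈ A)
    {t : ℝ} (ht : 0 ≤ t) (ht1 : t ≤ 1) : v + t • (p - v) ∈ A := by
  have := hA hv hp (sub_nonneg.2 ht1) ht (by ring)
  convert this using 1
  module

theorem RelBall.homothety {A : Set E} (hA : Convex ℝ A) {c v : E} {r t : ℝ} (h : RelBall c r A)
    (hv : v ∈ A) (ht : 0 < t) (ht1 : t ≤ 1) : RelBall (v + t • (c - v)) (t * r) A := by
  refine ⟨lineMap_mem_affineSpan (subset_affineSpan ℝ A hv) h.1 t, ?_⟩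
  rintro q ⟨hq, hqa⟩
  obtain ⟨p, hp, rfl⟩ := h.exists_homothety hv ht hq hqa
  exact hA.homothety_mem hv hp ht.le ht1

/-- The radius of a ball contained in the middle of a cone of height at least `a` and slant at most
`R` over a set containing a ball of radius `r`. -/
noncomputable def coneRadius (r a R : ℝ) : ℝ := min (a / 4) (r / (4 * (1 + R / a)))

theorem coneRadius_pos {r a R : ℝ} (hr : 0 < r) (ha : 0 < a) (hR : 0 ≤ R) :
    0 < coneRadius r a R := by
  unfold coneRadius; positivity

theorem coneRadius_mul {ρ : ℝ} (hρ : 0 < ρ) (r a R : ℝ) :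
    coneRadius (ρ * r) (ρ * a) (ρ * R) = ρ * coneRadius r a R := by
  unfold coneRadius
  rw [mul_div_mul_left _ _ hρ.ne', mul_div_assoc, mul_div_assoc, ← mul_min_of_nonneg _ _ hρ.le]

theorem coneRadius_le {r a R : ℝ} (hr : 0 ≤ r) (ha : 0 < a) (hR : 0 ≤ R) :
    coneRadius r a R ≤ r := by
  refine (min_le_right _ _).trans (div_le_self hr ?_)
  have : 0 ≤ R / a := by positivity
  linarith

/-- The height `a` controls the weight of the apex `x` in `q`, and the slant `R` then controls the
component of `q` along the base. Both constraints in `coneRadius` are used, one for each. -/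
theorem exists_combo_of_near_midpoint {A : Set E} {c x q : E} {r a R : ℝ} (h : RelBall c r A)
    (hr : 0 < r) (ha : 0 < a) (hdist : ∀ u ∈ affineSpan ℝ A, a ≤ ‖x - u‖) (hR : ‖x - c‖ ≤ R)
    (hq : q ∈ affineSpan ℝ (insert x A)) (hqs : ‖q - midpoint ℝ c x‖ ≤ coneRadius r a R) :
    ∃ u ∈ A, ∃ t : ℝ, 1 / 4 ≤ t ∧ t ≤ 3 / 4 ∧ q = (1 - t) • u + t • x := by
  have hR0 : 0 ≤ R := (norm_nonneg _).trans hR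
  rw [← affineSpan_insert_affineSpan, AffineSubspace.mem_affineSpan_insert_iff h.1] at hq
  obtain ⟨t, p, hp, rfl⟩ := hq
  simp only [vsub_eq_sub, vadd_eq_add] at hqs ⊢
  set s := coneRadius r a R with hs
  have hs1 : s ≤ a / 4 := min_le_left _ _
  have hs2 : s ≤ r / (4 * (1 + R / a)) := min_le_right _ _
  have hdec : t • (x - c) + p - midpoint ℝ c x = (p - c) + (t - 1 / 2) • (x - c) := by
    rw [midpoint_eq_smul_add, invOf_eq_inv]; module
  rw [hdec] at hqs
  have ht : |t - 1 / 2| * a ≤ s := by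
    rcases eq_or_ne t (1 / 2) with rfl | hne
    · simpa using (norm_nonneg _).trans hqs
    · have hne' : t - 1 / 2 ≠ 0 := sub_ne_zero.2 hne
      have hu : c + (-(1 / (t - 1 / 2))) • (p - c) ∈ affineSpan ℝ A :=
        lineMap_mem_affineSpan h.1 hp _
      have h1 := hdist _ hu
      have h2 : (p - c) + (t - 1 / 2) • (x - c)
          = (t - 1 / 2) • (x - (c + (-(1 / (t - 1 / 2))) • (p - c))) := by
        have : (t - 1 / 2) * (1 / (t - 1 / 2)) = 1 := mul_one_div_cancel hne'
        simp only [smul_sub, smul_add, neg_smul, smul_neg, smul_smul, this, one_smul]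
        abel
      rw [h2, norm_smul, Real.norm_eq_abs] at hqs
      exact (mul_le_mul_of_nonneg_left h1 (abs_nonneg _)).trans hqs
  have ht4 : |t - 1 / 2| ≤ 1 / 4 := by
    by_contra hcon
    push Not at hcon
    nlinarith
  have htb := abs_le.1 ht4
  have ht1 : (1 - t) ≠ 0 := by linarith
  -- The bound `r / 4` becomes `r` after division by `1 - t ≥ 1 / 4`.
  have hpc : ‖p - c‖ ≤ r / 4 := by
    have h1 : ‖p - c‖ ≤ s + |t - 1 / 2| * R := by
      have : p - c = ((p - c) + (t - 1 / 2) • (x - c)) - (t - 1 / 2) • (x - c) := by abel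
      rw [this]
      refine (norm_sub_le _ _).trans (add_le_add hqs ?_)
      rw [norm_smul, Real.norm_eq_abs]
      exact mul_le_mul_of_nonneg_left hR (abs_nonneg _)
    have h2 : |t - 1 / 2| ≤ s / a := by rwa [le_div_iff₀ ha]
    have h3 : s * (1 + R / a) ≤ r / 4 := by
      have hpos : 0 < 1 + R / a := by positivity
      rw [le_div_iff₀ (by positivity)] at hs2
      linarith
    have h4 : |t - 1 / 2| * R ≤ s / a * R := mul_le_mul_of_nonneg_right h2 hR0
    have h5 : s / a * R = s * (R / a) := by ring
    linarith
  refine ⟨c + (1 / (1 - t)) • (p - c), h.2 ⟨?_, lineMap_mem_affineSpan h.1 hp _⟩, t, by linarith,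
    by linarith, ?_⟩
  · rw [mem_closedBall, dist_eq_norm, add_sub_cancel_left, norm_smul,
      Real.norm_of_nonneg (by rw [one_div, inv_nonneg]; linarith), one_div,
      inv_mul_le_iff₀ (by linarith)]
    nlinarith
  · rw [smul_add, smul_smul, mul_one_div_cancel ht1]
    module

theorem RelBall.cone {A : Set E} {c x : E} {r a R : ℝ} (h : RelBall c r A)
    (hr : 0 < r) (ha : 0 < a) (hdist : ∀ u ∈ affineSpan ℝ A, a ≤ ‖x - u‖) (hR : ‖x - c‖ ≤ R) :
    RelBall (midpoint ℝ c x) (coneRadius r a R) (convexHull ℝ (insert x A)) := by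
  refine ⟨?_, ?_⟩
  · rw [affineSpan_convexHull]
    exact AffineMap.lineMap_mem _ (affineSpan_mono ℝ (subset_insert _ _) h.1)
      (subset_affineSpan ℝ _ (mem_insert _ _))
  · rintro q ⟨hq, hqa⟩
    rw [affineSpan_convexHull] at hqa
    obtain ⟨u, hu, t, ht, ht', rfl⟩ := exists_combo_of_near_midpoint h hr ha hdist hR hqa
      (by rwa [mem_closedBall, dist_eq_norm] at hq)
    exact convex_convexHull ℝ _ (subset_convexHull ℝ _ (mem_insert_of_mem _ hu))
      (subset_convexHull ℝ _ (mem_insert _ _)) (by linarith) (by linarith) (by ring)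

end Balls

/-! ### Separated points in a ball. -/

section Packing

/-- A finite cover of the ball of radius `R` by balls of radius `s / 2` has at most one rescaled
point in each member. The bound does not depend on the scale `ρ`, which is what makes the final
constants homogeneous. -/
theorem exists_packing_bound {E : Type*} [NormedAddCommGroup E] [NormedSpace ℝ E] [ProperSpace E]
    (R : ℝ) {s : ℝ} (hs : 0 < s) : ∃ M : ℕ, ∀ (ι : Type) (t : Finset ι) (q : ι → E) (z : E) (ρ : ℝ), 0 < ρ →
      (∀ i ∈ t, ‖q i - z‖ ≤ ρ * R) → (∀ i ∈ t, ∀ j ∈ t, ‖q i - q j‖ < ρ * s → i = j) →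
      t.card ≤ M := by
  obtain ⟨C, -, hC, hcov⟩ := (isCompact_closedBall (0 : E) R).finite_cover_balls (half_pos hs)
  refine ⟨hC.toFinset.card, fun ι t q z ρ hρ hball hsep => ?_⟩
  have hnorm : ∀ v : E, ‖ρ⁻¹ • v‖ = ρ⁻¹ * ‖v‖ := fun v => by
    rw [norm_smul, Real.norm_eq_abs, abs_of_pos (inv_pos.2 hρ)]
  have : ∀ i ∈ t, ∃ p ∈ C, ρ⁻¹ • (q i - z) ∈ ball p (s / 2) := fun i hi => by
    have h1 : ρ⁻¹ • (q i - z) ∈ closedBall (0 : E) R := by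
      rw [mem_closedBall_zero_iff, hnorm, inv_mul_le_iff₀ hρ]
      exact hball i hi
    simpa using hcov h1
  choose! f hfC hf using this
  refine Finset.card_le_card_of_injOn f (fun i hi => by simpa using hfC i hi) ?_
  intro i hi j hj hij
  refine hsep i hi j hj ?_
  have h1 := hf i hi
  have h2 := hf j hj
  rw [← hij] at h2
  have h3 := dist_triangle_right (ρ⁻¹ • (q i - z)) (ρ⁻¹ • (q j - z)) (f i)
  rw [mem_ball] at h1 h2
  rw [dist_eq_norm, ← smul_sub, sub_sub_sub_cancel_right, hnorm] at h3
  rw [← inv_mul_lt_iff₀ hρ]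
  linarith

end Packing

/-! ### Polyhedra cut by a hyperplane away from their vertices. -/

section Cuts

variable {n : ℕ} {P : Set (EuclideanSpace ℝ (Fin n))}

theorem eq_of_dimension_eq_zero {A : Set (EuclideanSpace ℝ (Fin n))} (h : dimension A = 0)
    {x y : EuclideanSpace ℝ (Fin n)} (hx : x ∈ affineSpan ℝ A) (hy : y ∈ affineSpan ℝ A) :
    x = y := by
  have hb : (affineSpan ℝ A).direction = ⊥ := Submodule.finrank_eq_zero.1 h
  have := AffineSubspace.vsub_mem_direction hx hy
  rw [hb, Submodule.mem_bot, vsub_eq_sub, sub_eq_zero] at this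
  exact this

theorem relBall_of_dimension_eq_zero {A : Set (EuclideanSpace ℝ (Fin n))} (h : dimension A = 0)
    {x : EuclideanSpace ℝ (Fin n)} (hx : x ∈ A) (r : ℝ) : RelBall x r A := by
  refine ⟨subset_affineSpan ℝ A hx, fun y hy => ?_⟩
  rwa [eq_of_dimension_eq_zero h hy.2 (subset_affineSpan ℝ A hx)]

theorem exists_extremePoint_inner_le {K : Set (EuclideanSpace ℝ (Fin n))} (hK : IsCompact K)
    (hne : K.Nonempty) (a : EuclideanSpace ℝ (Fin n)) :
    ∃ v ∈ K.extremePoints ℝ, ∀ x ∈ K, inner ℝ a x ≤ inner ℝ a v := by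
  have hexp : IsExposed ℝ K ((innerSL ℝ a).toExposed K) :=
    ContinuousLinearMap.toExposed.isExposed
  obtain ⟨m, hm, hmax⟩ := hK.exists_isMaxOn hne (f := fun x => inner ℝ a x) (by fun_prop)
  have hne' : ((innerSL ℝ a).toExposed K).Nonempty := ⟨m, hm, fun y hy => by
    simpa using hmax hy⟩
  obtain ⟨v, hv⟩ := (hexp.isCompact hK).extremePoints_nonempty hne'
  refine ⟨v, hexp.isExtreme.extremePoints_subset_extremePoints hv, fun x hx => ?_⟩
  simpa using hv.1.2 x hx

/-- A segment of `P` through `v` can be contracted towards `v` until it lies in the half-space. -/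
theorem mem_extremePoints_of_inter_halfSpace {a v : EuclideanSpace ℝ (Fin n)} {b : ℝ}
    (hP : Convex ℝ P) (hv : v ∈ (P ∩ {x | inner ℝ a x ≤ b}).extremePoints ℝ)
    (hlt : inner ℝ a v < b) : v ∈ P.extremePoints ℝ := by
  refine ⟨hv.1.1, fun x hx y hy hvxy => ?_⟩
  obtain ⟨α, β, hα, hβ, hαβ, rfl⟩ := hvxy
  set v := α • x + β • y with hvdef
  have hvP : v ∈ P := hv.1.1
  have hev : ∀ z : EuclideanSpace ℝ (Fin n), ∀ᶠ t : ℝ in 𝓝[>] 0, inner ℝ a (v + t • (z - v)) ≤ b := by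
    intro z
    have hc : Continuous (fun t : ℝ => (inner ℝ a (v + t • (z - v)) : ℝ)) := by fun_prop
    have h2 := hc.tendsto 0
    simp only [zero_smul, add_zero] at h2
    exact ((h2.mono_left nhdsWithin_le_nhds).eventually (gt_mem_nhds hlt)).mono fun t ht => ht.le
  obtain ⟨t, ⟨⟨htx, hty⟩, ht1⟩, ht0⟩ := (((hev x).and (hev y)).and
    (nhdsWithin_le_nhds (gt_mem_nhds (zero_lt_one (α := ℝ)))) |>.and self_mem_nhdsWithin).exists
  have ht0 : 0 < t := ht0
  have hin : ∀ z ∈ P, v + t • (z - v) ∈ P := fun z hz => by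
    have := hP hvP hz (sub_nonneg.2 ht1.le) ht0.le (by ring)
    convert this using 1; module
  have := hv.2 ⟨hin x hx, htx⟩ ⟨hin y hy, hty⟩ ⟨α, β, hα, hβ, hαβ, by
    have : α • (v + t • (x - v)) + β • (v + t • (y - v))
        = (α + β) • v + t • ((α • x + β • y) - (α + β) • v) := by module
    rw [this, hαβ, one_smul, ← hvdef, sub_self, smul_zero, add_zero]⟩
  have h2 : t • (x - v) = 0 := by simpa using this
  exact sub_eq_zero.1 ((smul_eq_zero.1 h2).resolve_left ht0.ne')

/-- The positive-dimensional faces of a polyhedron cut by a hyperplane away from its vertices. -/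
theorem exists_relBall_of_inter_halfSpace (hP : IsPolyhedron P) {a : EuclideanSpace ℝ (Fin n)}
    (ha : ‖a‖ = 1) {b d r R : ℝ} (hr0 : 0 ≤ r) (hd : 0 < d) (hR : 0 < R)
    (hdiam : ∀ u ∈ P, ∀ v ∈ P, ‖u - v‖ ≤ R)
    (hball : ∀ F ∈ subfaces P, dimension F ≠ 0 → ∃ c, RelBall c r F)
    (hvert : ∀ v ∈ P.extremePoints ℝ, d ≤ |inner ℝ a v - b|)
    {φ : Set (EuclideanSpace ℝ (Fin n))} (hφ : φ ∈ subfaces (P ∩ {x | inner ℝ a x ≤ b}))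
    (hdim : dimension φ ≠ 0) : ∃ c, RelBall c (min 1 (d / (2 * R)) * r) φ := by
  set D := P ∩ {x | inner ℝ a x ≤ b} with hD
  have hPc := hP.convex
  have hHc : Convex ℝ {x : EuclideanSpace ℝ (Fin n) | inner ℝ a x ≤ b} :=
    convex_halfSpace_le (IsLinearMap.mk (fun x y => inner_add_right _ _ _)
      (fun c x => inner_smul_right _ _ _)) b
  have hHc' : Convex ℝ {x : EuclideanSpace ℝ (Fin n) | inner ℝ a x = b} :=
    convex_hyperplane (IsLinearMap.mk (fun x y => inner_add_right _ _ _)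
      (fun c x => inner_smul_right _ _ _)) b
  have hφc : Convex ℝ φ := hφ.2.convex (hPc.inter hHc)
  obtain ⟨g, hg⟩ := hφ.1.intrinsicInterior hφc
  have hgφ := intrinsicInterior_subset hg
  have hgD : g ∈ D := hφ.2.subset hgφ
  -- `α` is the face of the uncut polyhedron that carries `φ`; the ball is built from a ball of `α`.
  obtain ⟨α, hα, hgα⟩ := hP.exists_subface_mem_intrinsicInterior hgD.1
  have hαc := hP.convex_of_subface hα
  have hαext := subfaces_isExtreme hα
  have hαcomp : IsCompact α := hα.2.isCompact hP.2.1
  set t := min 1 (d / (2 * R)) with ht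
  have ht0 : 0 < t := by positivity
  have ht1 : t ≤ 1 := min_le_left _ _
  have htR : t * R ≤ d / 2 := by
    have : t ≤ d / (2 * R) := min_le_right _ _
    rw [le_div_iff₀ (by positivity)] at this
    linarith
  have hcs : ∀ u v : EuclideanSpace ℝ (Fin n), |inner ℝ a u - inner ℝ a v| ≤ ‖u - v‖ := by
    intro u v
    rw [← inner_sub_right]
    simpa [ha] using abs_real_inner_le_norm a (u - v)
  have hφα : φ ⊆ α := (subset_of_mem_intrinsicInterior (D := P)
    (hφ.2.subset.trans inter_subset_left) hαext hg (intrinsicInterior_subset hgα))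
  have hαdim : dimension α ≠ 0 := by
    intro h0
    refine hdim ?_
    have := Submodule.finrank_mono (AffineSubspace.direction_le (affineSpan_mono ℝ hφα))
    exact Nat.le_zero.1 (this.trans h0.le)
  obtain ⟨c, hc⟩ := hball α hα hαdim
  -- The lowest vertex of `α` is no higher than `g`, so it is below the hyperplane, by at least `d`.
  obtain ⟨v, hv, hvmin⟩ := exists_extremePoint_inner_le hαcomp hα.1 (-a)
  have hvP := hvert v (hαext.extremePoints_subset_extremePoints hv)
  have hvα := hv.1
  have hvg := hvmin g (intrinsicInterior_subset hgα)
  simp only [inner_neg_left, neg_le_neg_iff] at hvg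
  have hgb : inner ℝ a g ≤ b := hgD.2
  have hvd : inner ℝ a v ≤ b - d := by
    rcases abs_cases (inner ℝ a v - b) with h | h <;> linarith
  -- Contraction by `t` towards a vertex changes heights by at most `t * R ≤ d / 2`: the contracted
  -- ball stays on the side of the vertex.
  have hnear : ∀ w ∈ α, ∀ q ∈ closedBall (w + t • (c - w)) (t * r) ∩ affineSpan ℝ α,
      q ∈ α ∧ |inner ℝ a q - inner ℝ a w| ≤ d / 2 := by
    rintro w hw q ⟨hq, hqa⟩
    obtain ⟨p, hp, rfl⟩ := hc.exists_homothety hw ht0 hq hqa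
    refine ⟨hαc.homothety_mem hw hp ht0.le ht1, (hcs _ _).trans ?_⟩
    rw [add_sub_cancel_left, norm_smul, Real.norm_of_nonneg ht0.le]
    exact (mul_le_mul_of_nonneg_left (hdiam _ (hα.2.subset hp) _ (hα.2.subset hw)) ht0.le).trans htR
  have hcen : ∀ w ∈ α, w + t • (c - w) ∈ affineSpan ℝ α := fun w hw =>
    lineMap_mem_affineSpan (subset_affineSpan ℝ α hw) hc.1 t
  have hspan := affineSpan_mono ℝ hφα
  obtain ⟨hgα', ρ, hρ, hsubρ⟩ := mem_intrinsicInterior_iff_closedBall.1 hgα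
  -- If `g` is strictly below the hyperplane, `φ` is all the part of `α` below it; otherwise `φ` is
  -- the section of `α` by the hyperplane.
  rcases hgb.lt_or_eq with hlt | heq
  · have hsub : α ∩ {x | inner ℝ a x ≤ b} ⊆ φ := by
      refine subset_of_mem_intrinsicInterior (D := D)
        (inter_subset_inter_left _ hα.2.subset) (subfaces_isExtreme hφ) (x := g) ?_ hgφ
      refine mem_intrinsicInterior_iff_closedBall.2 ⟨⟨hgα', hgb⟩, min ρ (b - inner ℝ a g),
        lt_min hρ (by linarith), ?_⟩
      rintro y ⟨hy, hys⟩
      refine ⟨hsubρ ⟨closedBall_subset_closedBall (min_le_left _ _) hy,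
        affineSpan_mono ℝ inter_subset_left hys⟩, ?_⟩
      have h1 := (hcs y g).trans ((mem_closedBall_iff_norm.1 hy).trans (min_le_right _ _))
      have := (abs_le.1 h1).2
      simp only [mem_ofPred_eq]; linarith
    have hin : ∀ q ∈ closedBall (v + t • (c - v)) (t * r) ∩ affineSpan ℝ α, q ∈ φ := by
      intro q hq
      obtain ⟨h1, h2⟩ := hnear v hvα q hq
      refine hsub ⟨h1, ?_⟩
      have := (abs_le.1 h2).2
      simp only [mem_ofPred_eq]; linarith
    exact ⟨v + t • (c - v), subset_affineSpan ℝ φ (hin _ ⟨mem_closedBall_self (by positivity),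
      hcen v hvα⟩), fun q hq => hin q ⟨hq.1, hspan hq.2⟩⟩
  · have hsub : α ∩ {x | inner ℝ a x = b} ⊆ φ := by
      refine subset_of_mem_intrinsicInterior (D := D) (fun x hx => ⟨hα.2.subset hx.1, hx.2.le⟩)
        (subfaces_isExtreme hφ) (x := g) ?_ hgφ
      refine mem_intrinsicInterior_iff_closedBall.2 ⟨⟨hgα', heq⟩, ρ, hρ, ?_⟩
      rintro y ⟨hy, hys⟩
      exact ⟨hsubρ ⟨hy, affineSpan_mono ℝ inter_subset_left hys⟩,
        inner_eq_of_mem_affineSpan (fun x hx => hx.2) hys⟩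
    obtain ⟨w, hw, hwmax⟩ := exists_extremePoint_inner_le hαcomp hα.1 a
    have hwP := hvert w (hαext.extremePoints_subset_extremePoints hw)
    have hwα := hw.1
    have hwg := hwmax g hgα'
    have hwd : b + d ≤ inner ℝ a w := by
      rcases abs_cases (inner ℝ a w - b) with h | h <;> linarith
    set v' := v + t • (c - v) with hv'
    set w' := w + t • (c - w) with hw'
    have htr : 0 ≤ t * r := by positivity
    have hv'b := (hnear v hvα v' ⟨mem_closedBall_self htr, hcen v hvα⟩).2
    have hw'b := (hnear w hwα w' ⟨mem_closedBall_self htr, hcen w hwα⟩).2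
    have h1 : inner ℝ a v' ≤ b - d / 2 := by have := (abs_le.1 hv'b).2; linarith
    have h2 : b + d / 2 ≤ inner ℝ a w' := by have := (abs_le.1 hw'b).1; linarith
    have hpos : 0 < inner ℝ a w' - inner ℝ a v' := by linarith
    -- Balls of equal radius about `v'` and `w'`, on opposite sides, have combinations filling a
    -- ball of the same radius; `l` places its centre on the hyperplane.
    set l : ℝ := (b - inner ℝ a v') / (inner ℝ a w' - inner ℝ a v') with hl
    have hl0 : 0 ≤ l := div_nonneg (by linarith) hpos.le
    have hl1 : l ≤ 1 := (div_le_one hpos).2 (by linarith)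
    have hball : ∀ q ∈ closedBall (v' + l • (w' - v')) (t * r) ∩ affineSpan ℝ α, q ∈ α := by
      rintro q ⟨hq, hqa⟩
      have hz : v' + l • (w' - v') ∈ affineSpan ℝ α :=
        lineMap_mem_affineSpan (hcen v hvα) (hcen w hwα) l
      have hdir : q - (v' + l • (w' - v')) ∈ (affineSpan ℝ α).direction :=
        AffineSubspace.vsub_mem_direction hqa hz
      have htrans : ∀ u ∈ affineSpan ℝ α, q - (v' + l • (w' - v')) + u ∈ affineSpan ℝ α :=
        fun u hu => AffineSubspace.vadd_mem_of_mem_direction hdir hu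
      have hn : ‖q - (v' + l • (w' - v'))‖ ≤ t * r := mem_closedBall_iff_norm.1 hq
      have m1 := (hnear v hvα (q - (v' + l • (w' - v')) + v') ⟨by
        rw [mem_closedBall_iff_norm, add_sub_cancel_right]; exact hn, htrans _ (hcen v hvα)⟩).1
      have m2 := (hnear w hwα (q - (v' + l • (w' - v')) + w') ⟨by
        rw [mem_closedBall_iff_norm, add_sub_cancel_right]; exact hn, htrans _ (hcen w hwα)⟩).1
      have := hαc m1 m2 (sub_nonneg.2 hl1) hl0 (by ring)
      convert this using 1
      module
    have hzH : inner ℝ a (v' + l • (w' - v')) = b := by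
      rw [inner_add_right, inner_smul_right, inner_sub_right, hl, div_mul_cancel₀ _ hpos.ne']
      ring
    have hzα := hball _ ⟨mem_closedBall_self htr,
      lineMap_mem_affineSpan (hcen v hvα) (hcen w hwα) l⟩
    refine ⟨v' + l • (w' - v'), subset_affineSpan ℝ φ (hsub ⟨hzα, hzH⟩), fun q hq =>
      hsub ⟨hball q ⟨hq.1, hspan hq.2⟩, ?_⟩⟩
    refine inner_eq_of_mem_affineSpan (F := φ) (fun x hx => ?_) hq.2
    -- The hyperplane cuts `D` along a face; this face contains the relative interior point `g` of
    -- `φ`, hence all of `φ`.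
    have hface : IsExtreme ℝ D (D ∩ {x | inner ℝ a x = b}) := by
      refine ⟨inter_subset_left, fun x hx y hy z hz hzxy => ⟨hx, ?_⟩⟩
      obtain ⟨p, q, hp, hq, hpq, rfl⟩ := hzxy
      have hz2 : inner ℝ a (p • x + q • y) = b := hz.2
      rw [inner_add_right, inner_smul_right, inner_smul_right] at hz2
      have hx2 : inner ℝ a x ≤ b := hx.2
      have hy2 : inner ℝ a y ≤ b := hy.2
      refine le_antisymm hx2 ?_
      by_contra hcon
      push Not at hcon
      have hq' : q = 1 - p := by linarith
      subst hq'
      nlinarith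
    exact (subset_of_mem_intrinsicInterior hφ.2.subset hface hg ⟨hgD, heq⟩ hx).2

end Cuts

end TubularSuspension

end

section

open Set Metric Topology

namespace TubularSuspension

/-! ### Facets of a round polyhedron and a bound on its number of vertices. -/

section Facets

variable {n : ℕ}

/-- Among the subsets of constraints that define the polyhedron inside its affine hull, take one of
least cardinality. Dropping `i` lets in a point `y` that violates `i` alone. -/
theorem exists_minimal_constraints (s : Finset (EuclideanSpace ℝ (Fin n) × ℝ)) :
    ∃ I ⊆ s, solutions s = {x ∈ (affineSpan ℝ (solutions s) : Set (EuclideanSpace ℝ (Fin n))) |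
        x ∈ solutions I} ∧
      ∀ i ∈ I, ∃ y ∈ affineSpan ℝ (solutions s), i.2 < inner ℝ i.1 y ∧
        ∀ j ∈ I, j ≠ i → inner ℝ j.1 y ≤ j.2 := by
  classical
  set A := affineSpan ℝ (solutions s) with hA
  set F : Finset (Finset (EuclideanSpace ℝ (Fin n) × ℝ)) := s.powerset.filter fun I =>
    solutions s = {x ∈ (A : Set (EuclideanSpace ℝ (Fin n))) | x ∈ solutions I} with hF
  have hne : F.Nonempty := ⟨s, by
    simp only [hF, Finset.mem_filter, Finset.mem_powerset, Finset.Subset.refl, true_and]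
    ext x
    exact ⟨fun hx => ⟨subset_affineSpan ℝ _ hx, hx⟩, fun hx => hx.2⟩⟩
  obtain ⟨I, hI, hmin⟩ := F.exists_min_image Finset.card hne
  simp only [hF, Finset.mem_filter, Finset.mem_powerset] at hI hmin
  refine ⟨I, hI.1, hI.2, fun i hi => ?_⟩
  by_contra hcon
  push Not at hcon
  have := hmin (I.erase i) ⟨(Finset.erase_subset _ _).trans hI.1, by
    rw [hI.2]
    ext x
    constructor
    · rintro ⟨hx, hxI⟩
      exact ⟨hx, fun q hq => hxI q (Finset.mem_of_mem_erase hq)⟩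
    · rintro ⟨hx, hxI⟩
      refine ⟨hx, fun q hq => ?_⟩
      rcases eq_or_ne q i with rfl | hqi
      · by_contra hlt
        obtain ⟨j, hj, hji, hlt2⟩ := hcon x hx (not_le.1 hlt)
        exact absurd (hxI j (Finset.mem_erase.2 ⟨hji, hj⟩)) (not_le.2 hlt2)
      · exact hxI q (Finset.mem_erase.2 ⟨hqi, hq⟩)⟩
  have h2 := Finset.card_erase_lt_of_mem hi
  omega

/-- The intersection of a set with a hyperplane. -/
def hyperplaneSection (P : Set (EuclideanSpace ℝ (Fin n))) (i : EuclideanSpace ℝ (Fin n) × ℝ) :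
    Set (EuclideanSpace ℝ (Fin n)) := {x ∈ P | inner ℝ i.1 x = i.2}

/-- The facet defined by an irredundant constraint contains a ball of its hyperplane. -/
theorem exists_ball_subset_hyperplaneSection {P : Set (EuclideanSpace ℝ (Fin n))}
    {I : Finset (EuclideanSpace ℝ (Fin n) × ℝ)} {c y : EuclideanSpace ℝ (Fin n)} {r : ℝ}
    (hr : 0 < r) (hI : P = {x ∈ (affineSpan ℝ P : Set (EuclideanSpace ℝ (Fin n))) | x ∈ solutions I})
    (hc : RelBall c r P) {i : EuclideanSpace ℝ (Fin n) × ℝ} (hi : i ∈ I)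
    (hy : y ∈ affineSpan ℝ P) (hyi : i.2 < inner ℝ i.1 y)
    (hyj : ∀ j ∈ I, j ≠ i → inner ℝ j.1 y ≤ j.2) :
    inner ℝ i.1 c < i.2 ∧ ∃ g ∈ hyperplaneSection P i, ∃ ρ > 0,
      ∀ v ∈ (affineSpan ℝ P).direction, inner ℝ i.1 v = 0 → ‖v‖ ≤ ρ →
        v + g ∈ hyperplaneSection P i := by
  have hsol : ∀ x ∈ P, ∀ q ∈ I, inner ℝ q.1 x ≤ q.2 := fun x hx q hq => by
    rw [hI] at hx; exact hx.2 q hq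
  have hcP := hc.mem hr.le
  -- If `i` were tight at `c`, a small step towards `y` would stay in the ball but violate `i`.
  have hlt : inner ℝ i.1 c < i.2 := by
    refine lt_of_le_of_ne (hsol c hcP i hi) fun heq => ?_
    have hmem : c + (r / (‖y - c‖ + 1)) • (y - c) ∈ P := by
      refine hc.2 ⟨?_, lineMap_mem_affineSpan hc.1 hy _⟩
      rw [mem_closedBall_iff_norm, add_sub_cancel_left, norm_smul, Real.norm_of_nonneg (by positivity),
        div_mul_eq_mul_div, div_le_iff₀ (by positivity)]
      nlinarith [norm_nonneg (y - c)]
    have := hsol _ hmem i hi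
    rw [inner_add_right, inner_smul_right, inner_sub_right] at this
    have hpos : 0 < r / (‖y - c‖ + 1) := by positivity
    nlinarith
  refine ⟨hlt, ?_⟩
  have hden : 0 < inner ℝ i.1 y - inner ℝ i.1 c := by linarith
  set s : ℝ := (i.2 - inner ℝ i.1 c) / (inner ℝ i.1 y - inner ℝ i.1 c) with hs
  have hs0 : 0 < s := div_pos (by linarith) hden
  have hs1 : s < 1 := (div_lt_one hden).2 (by linarith)
  have hseq : s * (inner ℝ i.1 y - inner ℝ i.1 c) = i.2 - inner ℝ i.1 c := by
    rw [hs, div_mul_cancel₀ _ hden.ne']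
  -- The point of `[c, y]` on the hyperplane of `i` is the image of `c` by the homothety of centre
  -- `y` and ratio `1 - s`, which maps the ball of radius `r` to one of radius `(1 - s) * r`. The
  -- constraints other than `i` hold at both ends.
  have hmain : ∀ v ∈ (affineSpan ℝ P).direction, inner ℝ i.1 v = 0 → ‖v‖ ≤ (1 - s) * r →
      v + (c + s • (y - c)) ∈ hyperplaneSection P i := by
    intro v hv hv0 hvn
    have h1s : 0 < 1 - s := by linarith
    have hcv : (1 / (1 - s)) • v + c ∈ P := by
      refine hc.2 ⟨?_, AffineSubspace.vadd_mem_of_mem_direction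
        (Submodule.smul_mem _ _ hv) hc.1⟩
      rw [mem_closedBall_iff_norm, add_sub_cancel_right, norm_smul,
        Real.norm_of_nonneg (by positivity), one_div, inv_mul_le_iff₀ h1s]
      exact hvn
    have hval : inner ℝ i.1 (v + (c + s • (y - c))) = i.2 := by
      rw [inner_add_right, inner_add_right, inner_smul_right, inner_sub_right, hv0]
      linarith
    have hdec : v + (c + s • (y - c)) = (1 - s) • ((1 / (1 - s)) • v + c) + s • y := by
      rw [smul_add, smul_smul, mul_one_div_cancel h1s.ne']
      module
    refine ⟨?_, hval⟩
    rw [hI]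
    refine ⟨AffineSubspace.vadd_mem_of_mem_direction hv (lineMap_mem_affineSpan hc.1 hy s), ?_⟩
    intro j hj
    rcases eq_or_ne j i with rfl | hji
    · exact hval.le
    · rw [hdec, inner_add_right, inner_smul_right, inner_smul_right]
      have h1 := hsol _ hcv j hj
      have h2 := hyj j hj hji
      nlinarith
  refine ⟨c + s • (y - c), ?_, (1 - s) * r, mul_pos (by linarith) hr, hmain⟩
  have := hmain 0 (Submodule.zero_mem _) (inner_zero_right _)
    (by rw [norm_zero]; exact mul_nonneg (by linarith) hr.le)
  rwa [zero_add] at this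

/-- If a polyhedron has irredundant constraints `I`, the centres of its facets, moved half-way
towards an interior point, are far apart. -/
theorem mem_hyperplaneSection_of_near {P : Set (EuclideanSpace ℝ (Fin n))}
    {I : Finset (EuclideanSpace ℝ (Fin n) × ℝ)} {c ci cj : EuclideanSpace ℝ (Fin n)} {r R : ℝ}
    (hr : 0 < r) (hI : P = {x ∈ (affineSpan ℝ P : Set (EuclideanSpace ℝ (Fin n))) | x ∈ solutions I})
    (hirr : ∀ i ∈ I, ∃ y ∈ affineSpan ℝ P, i.2 < inner ℝ i.1 y ∧
        ∀ j ∈ I, j ≠ i → inner ℝ j.1 y ≤ j.2)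
    (hdiam : ∀ u ∈ P, ∀ v ∈ P, ‖u - v‖ ≤ R)
    (hc : RelBall c r P) {i j : EuclideanSpace ℝ (Fin n) × ℝ} (hi : i ∈ I) (hj : j ∈ I)
    (hci : RelBall ci r (hyperplaneSection P i)) (hcj : RelBall cj r (hyperplaneSection P j))
    (hnear : ‖midpoint ℝ ci c - midpoint ℝ cj c‖ < coneRadius r r R) :
    hyperplaneSection P j ⊆ hyperplaneSection P i := by
  have hsol : ∀ x ∈ P, ∀ q ∈ I, inner ℝ q.1 x ≤ q.2 := fun x hx q hq => by
    rw [hI] at hx; exact hx.2 q hq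
  have hcP := hc.mem hr.le
  obtain ⟨yi, hyi, hyi1, hyi2⟩ := hirr i hi
  obtain ⟨yj, hyj, hyj1, hyj2⟩ := hirr j hj
  obtain ⟨hcilt, gi, hgi, ρi, hρi, hfilli⟩ :=
    exists_ball_subset_hyperplaneSection hr hI hc hi hyi hyi1 hyi2
  obtain ⟨hcjlt, gj, hgj, ρj, hρj, hfillj⟩ :=
    exists_ball_subset_hyperplaneSection hr hI hc hj hyj hyj1 hyj2
  -- A facet spans the whole kernel of its constraint in the direction of `P`, since it contains a
  -- small ball of it.
  have hdir : ∀ (k : EuclideanSpace ℝ (Fin n) × ℝ) (g : EuclideanSpace ℝ (Fin n)) (ρ : ℝ), 0 < ρ →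
      g ∈ hyperplaneSection P k →
      (∀ v ∈ (affineSpan ℝ P).direction, inner ℝ k.1 v = 0 → ‖v‖ ≤ ρ →
        v + g ∈ hyperplaneSection P k) →
      ∀ v ∈ (affineSpan ℝ P).direction, inner ℝ k.1 v = 0 →
        v ∈ (affineSpan ℝ (hyperplaneSection P k)).direction := by
    intro k g ρ hρ hg hfill v hv hv0
    have h1 := hfill ((ρ / (‖v‖ + 1)) • v) (Submodule.smul_mem _ _ hv)
      (by rw [inner_smul_right, hv0, mul_zero]) (by
        rw [norm_smul, Real.norm_of_nonneg (by positivity), div_mul_eq_mul_div,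
          div_le_iff₀ (by positivity)]
        nlinarith [norm_nonneg v])
    have h2 := AffineSubspace.vsub_mem_direction (subset_affineSpan ℝ _ h1)
      (subset_affineSpan ℝ _ hg)
    rw [vsub_eq_sub, add_sub_cancel_right] at h2
    have h3 := Submodule.smul_mem _ ((‖v‖ + 1) / ρ) h2
    rwa [smul_smul, div_mul_div_cancel₀ hρ.ne', div_self (by positivity), one_smul] at h3
  have hspani : ∀ u ∈ affineSpan ℝ (hyperplaneSection P i), inner ℝ i.1 u = i.2 := fun u hu =>
    inner_eq_of_mem_affineSpan (fun x hx => hx.2) hu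
  have hsub : affineSpan ℝ (hyperplaneSection P i) ≤ affineSpan ℝ P :=
    affineSpan_mono ℝ fun x hx => hx.1
  have hciP : ci ∈ P := (hci.mem hr.le).1
  have hcjP : cj ∈ P := (hcj.mem hr.le).1
  have hcii : inner ℝ i.1 ci = i.2 := (hci.mem hr.le).2
  have hcjj : inner ℝ j.1 cj = j.2 := (hcj.mem hr.le).2
  -- The ball of radius `r` about `c` lies in `P` and cannot cross the hyperplane of a facet.
  have hdist : ∀ u ∈ affineSpan ℝ (hyperplaneSection P i), r ≤ ‖c - u‖ := by
    intro u hu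
    by_contra hlt
    push Not at hlt
    have hui := hspani u hu
    have hne : 0 < ‖c - u‖ := norm_pos_iff.2 (sub_ne_zero.2 fun h => by
      rw [h, hui] at hcilt; exact lt_irrefl _ hcilt)
    have hmem : c + (r / ‖c - u‖) • (u - c) ∈ P := by
      refine hc.2 ⟨?_, lineMap_mem_affineSpan hc.1 (hsub hu) _⟩
      rw [mem_closedBall_iff_norm, add_sub_cancel_left, norm_smul, Real.norm_of_nonneg (by positivity),
        norm_sub_rev u c, div_mul_cancel₀ _ hne.ne']
    have h1 := hsol _ hmem i hi
    rw [inner_add_right, inner_smul_right, inner_sub_right, hui] at h1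
    have h2 : 1 < r / ‖c - u‖ := (one_lt_div hne).2 hlt
    nlinarith
  have hspan : midpoint ℝ cj c ∈ affineSpan ℝ (insert c (hyperplaneSection P i)) := by
    rw [← affineSpan_insert_affineSpan, AffineSubspace.mem_affineSpan_insert_iff hci.1]
    have hx : midpoint ℝ cj c - c ∈ (affineSpan ℝ P).direction :=
      AffineSubspace.vsub_mem_direction (AffineMap.lineMap_mem _
        (subset_affineSpan ℝ _ hcjP) hc.1) hc.1
    have hw : c - ci ∈ (affineSpan ℝ P).direction :=
      AffineSubspace.vsub_mem_direction hc.1 (subset_affineSpan ℝ _ hciP)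
    have hne : inner ℝ i.1 (c - ci) ≠ 0 := by rw [inner_sub_right, hcii]; linarith
    set τ : ℝ := inner ℝ i.1 (midpoint ℝ cj c - c) / inner ℝ i.1 (c - ci) with hτ
    have hv := hdir i gi ρi hρi hgi hfilli (midpoint ℝ cj c - c - τ • (c - ci))
      (Submodule.sub_mem _ hx (Submodule.smul_mem _ _ hw)) (by
        rw [inner_sub_right i.1 (midpoint ℝ cj c - c), inner_smul_right, hτ, div_mul_cancel₀ _ hne,
          sub_self])
    refine ⟨τ + 1, (midpoint ℝ cj c - c - τ • (c - ci)) + ci,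
      AffineSubspace.vadd_mem_of_mem_direction hv hci.1, ?_⟩
    simp only [vsub_eq_sub, vadd_eq_add]
    module
  obtain ⟨u, hu, t, ht, ht', hut⟩ := exists_combo_of_near_midpoint hci hr hr hdist
    (hdiam _ hcP _ hciP) hspan (by rw [norm_sub_rev]; exact hnear.le)
  -- So `cj` and the point `u` of the facet `i` are on one ray from `c`.
  have hcju : cj - c = (2 * (1 - t)) • (u - c) := by
    rw [midpoint_eq_smul_add, invOf_eq_inv] at hut
    have h2 : cj + c = (2 : ℝ) • ((1 - t) • u + t • c) := by
      rw [← hut, smul_smul]; norm_num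
    rw [eq_sub_of_add_eq h2]
    module
  have hui : inner ℝ i.1 u = i.2 := hu.2
  have e1 : inner ℝ i.1 cj - inner ℝ i.1 c = 2 * (1 - t) * (inner ℝ i.1 u - inner ℝ i.1 c) := by
    rw [← inner_sub_right, hcju, inner_smul_right, inner_sub_right]
  have e2 : inner ℝ j.1 cj - inner ℝ j.1 c = 2 * (1 - t) * (inner ℝ j.1 u - inner ℝ j.1 c) := by
    rw [← inner_sub_right, hcju, inner_smul_right, inner_sub_right]
  -- `cj` satisfies the constraint `i`, which is tight at `u`, and `u` satisfies `j`, which is tight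
  -- at `cj`. As `c` is strict for both, the ratio `2 * (1 - t)` must be `1`.
  have l1 : 2 * (1 - t) ≤ 1 := by
    have := hsol cj hcjP i hi
    by_contra hcon
    push Not at hcon
    nlinarith
  have l2 : 1 ≤ 2 * (1 - t) := by
    have := hsol u hu.1 j hj
    by_contra hcon
    push Not at hcon
    nlinarith
  have hcji : inner ℝ i.1 cj = i.2 := by
    rw [le_antisymm l1 l2, one_mul, hui] at e1; linarith
  -- The constraint `i` is tight at the centre of a ball of the facet `j`, so it cannot increase
  -- along this facet.
  have hperp : ∀ v ∈ (affineSpan ℝ P).direction, inner ℝ j.1 v = 0 → inner ℝ i.1 v ≤ 0 := by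
    intro v hv hv0
    have hvd := hdir j gj ρj hρj hgj hfillj v hv hv0
    have hmem : (r / (‖v‖ + 1)) • v + cj ∈ hyperplaneSection P j := by
      refine hcj.2 ⟨?_, AffineSubspace.vadd_mem_of_mem_direction (Submodule.smul_mem _ _ hvd) hcj.1⟩
      rw [mem_closedBall_iff_norm, add_sub_cancel_right, norm_smul,
        Real.norm_of_nonneg (by positivity), div_mul_eq_mul_div, div_le_iff₀ (by positivity)]
      nlinarith [norm_nonneg v]
    have h1 := hsol _ hmem.1 i hi
    rw [inner_add_right, inner_smul_right, hcji] at h1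
    have hpos : 0 < r / (‖v‖ + 1) := by positivity
    by_contra hcon
    push Not at hcon
    nlinarith [mul_pos hpos hcon]
  intro x hx
  refine ⟨hx.1, ?_⟩
  have hv : x - cj ∈ (affineSpan ℝ P).direction := AffineSubspace.vsub_mem_direction
    (subset_affineSpan ℝ _ hx.1) (subset_affineSpan ℝ _ hcjP)
  have hv0 : inner ℝ j.1 (x - cj) = 0 := by rw [inner_sub_right, hx.2, hcjj, sub_self]
  have h1 := hperp _ hv hv0
  have h2 := hperp _ (Submodule.neg_mem _ hv) (by rw [inner_neg_right, hv0, neg_zero])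
  rw [inner_neg_right] at h2
  rw [inner_sub_right] at h1 h2
  linarith

/-- The number of vertices of a polyhedron is bounded in terms of the roundness of its faces. -/
theorem exists_bound_card_extremePoints (n : ℕ) {r R : ℝ} (hr : 0 < r) :
    ∃ N : ℕ, ∀ (P : Set (EuclideanSpace ℝ (Fin n))) (ρ : ℝ), 0 < ρ → IsPolyhedron P →
      (∀ u ∈ P, ∀ v ∈ P, ‖u - v‖ ≤ ρ * R) →
      (∀ F ∈ subfaces P, dimension F ≠ 0 → ∃ c, RelBall c (ρ * r) F) →
      (P.extremePoints ℝ).ncard ≤ N := by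
  classical
  rcases lt_or_ge R 0 with hR | hR
  · refine ⟨0, fun P ρ hρ hP hdiam _ => ?_⟩
    obtain ⟨x, hx⟩ := hP.1
    exact absurd ((norm_nonneg _).trans (hdiam x hx x hx)) (not_le.2 (mul_neg_of_pos_of_neg hρ hR))
  obtain ⟨M, hM⟩ := exists_packing_bound (E := EuclideanSpace ℝ (Fin n)) R
    (coneRadius_pos hr hr hR)
  refine ⟨2 ^ M, fun P ρ hρ hP hdiam hball => ?_⟩
  replace hr : 0 < ρ * r := mul_pos hρ hr
  have hball' : ∀ F ∈ subfaces P, ∃ c, RelBall c (ρ * r) F := by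
    intro F hF
    by_cases h0 : dimension F = 0
    · obtain ⟨x, hx⟩ := hF.1
      exact ⟨x, relBall_of_dimension_eq_zero h0 hx _⟩
    · exact hball F hF h0
  choose! cen hcen using hball'
  have hself := hP.self_mem_subfaces
  have hc := hcen P hself
  have hPc := hP.convex
  obtain ⟨-, -, s, -, hs⟩ := hP
  have hs : P = solutions s := hs
  obtain ⟨I, -, hI, hirr⟩ := exists_minimal_constraints s
  rw [← hs] at hI hirr
  have hsol : ∀ x ∈ P, ∀ q ∈ I, inner ℝ q.1 x ≤ q.2 := fun x hx q hq => by
    rw [hI] at hx; exact hx.2 q hq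
  have hsec : ∀ i ∈ I, hyperplaneSection P i ∈ subfaces P := by
    intro i hi
    obtain ⟨y, hy, hy1, hy2⟩ := hirr i hi
    obtain ⟨-, g, hg, -⟩ := exists_ball_subset_hyperplaneSection hr hI hc hi hy hy1 hy2
    refine ⟨⟨g, hg⟩, fun _ => ⟨innerSL ℝ i.1, ?_⟩⟩
    ext x
    simp only [hyperplaneSection, mem_ofPred_eq, innerSL_apply_apply]
    constructor
    · rintro ⟨hx, hxi⟩
      exact ⟨hx, fun y hy => by rw [hxi]; exact hsol y hy i hi⟩
    · rintro ⟨hx, hmax⟩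
      refine ⟨hx, le_antisymm (hsol x hx i hi) ?_⟩
      have := hmax g hg.1
      rwa [hg.2] at this
  set 𝓖 : Finset (Set (EuclideanSpace ℝ (Fin n))) := I.image (hyperplaneSection P) with h𝓖
  have hcard : 𝓖.card ≤ M := by
    have := hM _ 𝓖 (fun G => midpoint ℝ (cen G) (cen P)) (cen P) ρ hρ ?_ ?_
    · exact this
    · intro G hG
      obtain ⟨i, hi, rfl⟩ := Finset.mem_image.1 hG
      have h1 : midpoint ℝ (cen (hyperplaneSection P i)) (cen P) ∈ P :=
        hPc.midpoint_mem ((hcen _ (hsec i hi)).mem hr.le).1 (hc.mem hr.le)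
      exact hdiam _ h1 _ (hc.mem hr.le)
    · intro G hG G' hG' hlt
      rw [← coneRadius_mul hρ] at hlt
      obtain ⟨i, hi, rfl⟩ := Finset.mem_image.1 hG
      obtain ⟨j, hj, rfl⟩ := Finset.mem_image.1 hG'
      refine Subset.antisymm ?_ ?_
      · exact mem_hyperplaneSection_of_near hr hI hirr hdiam hc hj hi (hcen _ (hsec j hj))
          (hcen _ (hsec i hi)) (by rwa [norm_sub_rev])
      · exact mem_hyperplaneSection_of_near hr hI hirr hdiam hc hi hj (hcen _ (hsec i hi))
          (hcen _ (hsec j hj)) hlt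
  -- A vertex is determined by the set of facets that contain it.
  have hle : (P.extremePoints ℝ).ncard ≤ 𝓖.powerset.card := by
    rw [← Set.ncard_coe_finset]
    refine Set.ncard_le_ncard_of_injOn (fun v => 𝓖.filter fun G => v ∈ G) ?_ ?_
      (Finset.finite_toSet _)
    · intro v _
      exact Finset.mem_coe.2 (Finset.mem_powerset.2 (Finset.filter_subset _ _))
    · intro v hv w hw hvw
      have hvI : v ∈ solutions I := fun q hq => hsol v hv.1 q hq
      obtain ⟨t, ht, hmem⟩ := exists_prolongation_solutions I hvI (x := w) (by
        intro i hi hvi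
        have hG : hyperplaneSection P i ∈ 𝓖 := Finset.mem_image_of_mem _ hi
        have h1 : hyperplaneSection P i ∈ 𝓖.filter fun G => v ∈ G :=
          Finset.mem_filter.2 ⟨hG, hv.1, hvi⟩
        simp only at hvw
        rw [hvw] at h1
        exact (Finset.mem_filter.1 h1).2.2.ge)
      have hP' : v + t • (v - w) ∈ P := by
        rw [hI]
        refine ⟨?_, hmem⟩
        have := lineMap_mem_affineSpan (subset_affineSpan ℝ P hv.1) (subset_affineSpan ℝ P hw.1) (-t)
        rwa [neg_smul, ← smul_neg, neg_sub] at this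
      exact (hv.2 hw.1 hP' (mem_openSegment_prolongation v w ht)).symm
  refine hle.trans ?_
  rw [Finset.card_powerset]
  exact Nat.pow_le_pow_right (by norm_num) hcard

end Facets

end TubularSuspension

end

section

open Set Metric Topology

namespace TubularSuspension

/-! ### The affine functions that define the cutting hyperplanes. -/

section Side

variable {n : ℕ}

/-- The affine function vanishing on the hyperplane `H(x, y, r)`, negative on the side of `x`. -/
noncomputable def side (x y : EuclideanSpace ℝ (Fin n)) (r : ℝ) (t : EuclideanSpace ℝ (Fin n)) : ℝ :=
  inner ℝ (t - x) (y - x) - (r + dist x y / 2) * dist x y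

theorem mem_halfSpace_iff {x y t : EuclideanSpace ℝ (Fin n)} {r : ℝ} :
    t ∈ halfSpace x y r ↔ side x y r t < 0 := by
  simp [halfSpace, side]

theorem continuous_side (x y : EuclideanSpace ℝ (Fin n)) (r : ℝ) : Continuous (side x y r) := by
  unfold side; fun_prop

theorem side_combo (x y : EuclideanSpace ℝ (Fin n)) (r : ℝ) {a b : ℝ} (hab : a + b = 1)
    (u v : EuclideanSpace ℝ (Fin n)) :
    side x y r (a • u + b • v) = a * side x y r u + b * side x y r v := by
  have : a • u + b • v - x = a • (u - x) + b • (v - x) := by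
    rw [show b = 1 - a by linarith]; module
  simp only [side, this, inner_add_left, inner_smul_left, conj_trivial]
  rw [show b = 1 - a by linarith]; ring

theorem side_combo₃ (x y : EuclideanSpace ℝ (Fin n)) (r : ℝ) {a b c : ℝ} (habc : a + b + c = 1)
    (u v w : EuclideanSpace ℝ (Fin n)) :
    side x y r (a • u + b • v + c • w)
      = a * side x y r u + b * side x y r v + c * side x y r w := by
  have : a • u + b • v + c • w - x = a • (u - x) + b • (v - x) + c • (w - x) := by
    rw [show c = 1 - a - b by linarith]; module
  simp only [side, this, inner_add_left, inner_smul_left, conj_trivial]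
  rw [show c = 1 - a - b by linarith]; ring

theorem side_swap (x y t : EuclideanSpace ℝ (Fin n)) (r : ℝ) :
    side y x (-r) t = - side x y r t := by
  have h1 : t - y = (t - x) - (y - x) := by abel
  have h2 : x - y = -(y - x) := by abel
  have h3 : dist x y = ‖y - x‖ := by rw [dist_eq_norm, norm_sub_rev]
  simp only [side, dist_comm y x]
  rw [h1, h2, inner_neg_right, inner_sub_left, real_inner_self_eq_norm_sq, h3]
  ring

theorem side_self_left (x y : EuclideanSpace ℝ (Fin n)) (r : ℝ) :
    side x y r x = -((r + dist x y / 2) * dist x y) := by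
  simp [side]

theorem side_self_right (x y : EuclideanSpace ℝ (Fin n)) (r : ℝ) :
    side x y r y = (dist x y / 2 - r) * dist x y := by
  have h3 : dist x y = ‖y - x‖ := by rw [dist_eq_norm, norm_sub_rev]
  rw [side, real_inner_self_eq_norm_sq, h3]
  ring

theorem side_sub (x y t : EuclideanSpace ℝ (Fin n)) (r r' : ℝ) :
    side x y r t = side x y r' t + (r' - r) * dist x y := by
  simp only [side]; ring

theorem convex_side_lt (x y : EuclideanSpace ℝ (Fin n)) (r : ℝ) :
    Convex ℝ {t | side x y r t < 0} := by
  intro u hu v hv a b ha hb hab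
  simp only [mem_ofPred_eq] at *
  rw [side_combo x y r hab]
  rcases ha.eq_or_lt with rfl | ha
  · rw [zero_add] at hab; subst hab; simpa using hv
  · nlinarith

end Side

/-! ### Cells as connected components, and their monotonicity in the cuts. -/

section Cell

variable {n : ℕ} {G : EuclideanGraph n} {O : Set (EuclideanSpace ℝ (Fin n))} {h h' : G.T → G.T → ℝ}
  {x y : G.T} {t : EuclideanSpace ℝ (Fin n)}

/-- The open half-spaces attached to the neighbours of `x`. -/
def sector (G : EuclideanGraph n) (h : G.T → G.T → ℝ) (x : G.T) : Set (EuclideanSpace ℝ (Fin n)) :=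
  {t | ∀ y : G.T, G.graph.Adj x y → side (x : EuclideanSpace ℝ (Fin n)) y (h x y) t < 0}

/-- The closed half-spaces attached to the neighbours of `x`. -/
def closedSector (G : EuclideanGraph n) (h : G.T → G.T → ℝ) (x : G.T) :
    Set (EuclideanSpace ℝ (Fin n)) :=
  {t | ∀ y : G.T, G.graph.Adj x y → side (x : EuclideanSpace ℝ (Fin n)) y (h x y) t ≤ 0}

theorem sector_subset_closedSector : sector G h x ⊆ closedSector G h x :=
  fun _ ht y hy => (ht y hy).le

theorem cell_eq : cell G O h x = connectedComponentIn (O ∩ sector G h x) x := by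
  simp only [cell, sector, mem_halfSpace_iff]

theorem isOpen_sector : IsOpen (sector G h x) := by
  have : sector G h x = ⋂ y : G.T, {t | G.graph.Adj x y →
      side (x : EuclideanSpace ℝ (Fin n)) y (h x y) t < 0} := by
    ext t; simp [sector]
  rw [this]
  refine isOpen_iInter_of_finite fun y => ?_
  by_cases hxy : G.graph.Adj x y
  · simpa [hxy] using isOpen_lt (continuous_side _ _ _) continuous_const
  · simp [hxy]

theorem isClosed_closedSector : IsClosed (closedSector G h x) := by
  have : closedSector G h x = ⋂ y : G.T, {t | G.graph.Adj x y →
      side (x : EuclideanSpace ℝ (Fin n)) y (h x y) t ≤ 0} := by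
    ext t; simp [closedSector]
  rw [this]
  refine isClosed_iInter fun y => ?_
  by_cases hxy : G.graph.Adj x y
  · simpa [hxy] using isClosed_le (continuous_side _ _ _) continuous_const
  · simp [hxy]

theorem convex_sector : Convex ℝ (sector G h x) := by
  have : sector G h x = ⋂ y : G.T, ⋂ _ : G.graph.Adj x y,
      {t | side (x : EuclideanSpace ℝ (Fin n)) y (h x y) t < 0} := by
    ext t; simp [sector]
  rw [this]
  exact convex_iInter fun y => convex_iInter fun _ => convex_side_lt _ _ _

/-- A segment from the open sector to the closed sector stays in the open sector, except possibly at
its end. -/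
theorem combo_mem_sector {u v : EuclideanSpace ℝ (Fin n)} (hu : u ∈ sector G h x)
    (hv : v ∈ closedSector G h x) {a b : ℝ} (ha : 0 < a) (hb : 0 ≤ b) (hab : a + b = 1) :
    a • u + b • v ∈ sector G h x := by
  intro y hy
  rw [side_combo _ _ _ hab]
  nlinarith [mul_pos ha (neg_pos.2 (hu y hy)), mul_nonneg hb (neg_nonneg.2 (hv y hy))]

theorem self_mem_sector (hb : ∀ y, G.graph.Adj x y → |h x y| < dist (x : EuclideanSpace ℝ (Fin n)) y / 2) :
    (x : EuclideanSpace ℝ (Fin n)) ∈ sector G h x := by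
  intro y hy
  rw [side_self_left]
  have h1 := hb y hy
  have h2 := (abs_lt.1 h1).1
  have h3 : 0 < dist (x : EuclideanSpace ℝ (Fin n)) y := by linarith [abs_nonneg (h x y)]
  nlinarith

theorem cell_subset : cell G O h x ⊆ O ∩ sector G h x := by
  rw [cell_eq]; exact connectedComponentIn_subset _ _

theorem isOpen_cell (hO : IsOpen O) : IsOpen (cell G O h x) := by
  rw [cell_eq]; exact (hO.inter isOpen_sector).connectedComponentIn

theorem closure_cell_subset_closedSector : closure (cell G O h x) ⊆ closedSector G h x :=
  closure_minimal ((cell_subset.trans inter_subset_right).trans sector_subset_closedSector)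
    isClosed_closedSector

theorem closure_cell_subset_closure : closure (cell G O h x) ⊆ closure O :=
  closure_mono (cell_subset.trans inter_subset_left)

/-- The way membership in a cell is proved everywhere: by a segment, a ball or a half-ball that
meets the cell. -/
theorem subset_cell_of_isPreconnected {A : Set (EuclideanSpace ℝ (Fin n))} (hA : IsPreconnected A)
    (hsub : A ⊆ O ∩ sector G h x) (hne : (A ∩ cell G O h x).Nonempty) : A ⊆ cell G O h x := by
  obtain ⟨y, hyA, hyc⟩ := hne
  rw [cell_eq] at hyc ⊢
  rw [connectedComponentIn_eq hyc]
  exact hA.subset_connectedComponentIn hyA hsub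

theorem mem_cell_of_mem_closure (hO : IsOpen O) (ht : t ∈ O ∩ sector G h x)
    (htc : t ∈ closure (cell G O h x)) : t ∈ cell G O h x := by
  obtain ⟨r, hr, hball⟩ := Metric.isOpen_iff.1 (hO.inter isOpen_sector) t ht
  refine subset_cell_of_isPreconnected (convex_ball t r).isPreconnected hball ?_ (mem_ball_self hr)
  exact mem_closure_iff_nhds.1 htc _ (ball_mem_nhds t hr)

theorem self_mem_cell (hx : (x : EuclideanSpace ℝ (Fin n)) ∈ O)
    (hb : ∀ y, G.graph.Adj x y → |h x y| < dist (x : EuclideanSpace ℝ (Fin n)) y / 2) :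
    (x : EuclideanSpace ℝ (Fin n)) ∈ cell G O h x := by
  rw [cell_eq]; exact mem_connectedComponentIn ⟨hx, self_mem_sector hb⟩

theorem sector_mono (hh : ∀ y, G.graph.Adj x y → h x y ≤ h' x y) : sector G h x ⊆ sector G h' x := by
  intro t ht y hy
  have := ht y hy
  rw [side_sub _ _ _ _ (h' x y)] at this
  nlinarith [mul_nonneg (sub_nonneg.2 (hh y hy)) (dist_nonneg (x := (x : EuclideanSpace ℝ (Fin n))) (y := y))]

theorem cell_mono (hh : ∀ y, G.graph.Adj x y → h x y ≤ h' x y) : cell G O h x ⊆ cell G O h' x := by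
  rw [cell_eq, cell_eq]
  exact connectedComponentIn_mono _ (inter_subset_inter_right _ (sector_mono hh))

theorem cell_congr (hh : ∀ y, G.graph.Adj x y → h x y = h' x y) : cell G O h x = cell G O h' x :=
  (cell_mono fun y hy => (hh y hy).le).antisymm (cell_mono fun y hy => (hh y hy).ge)

end Cell

/-! ### Crossing a frontier; closures of star-shaped sets. -/

section Topology

theorem exists_mem_frontier_of_isPreconnected {X : Type*} [TopologicalSpace X] {A O : Set X}
    (hA : IsPreconnected A) (h1 : (A ∩ O).Nonempty) (h2 : (A ∩ Oᶜ).Nonempty) :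
    ∃ q ∈ A, q ∈ frontier O := by
  by_contra hcon
  push Not at hcon
  have hcov : A ⊆ interior O ∪ (closure O)ᶜ := by
    intro q hq
    by_cases hqc : q ∈ closure O
    · left
      by_contra hqi
      exact hcon q hq ⟨hqc, hqi⟩
    · exact Or.inr hqc
  obtain ⟨a, haA, haO⟩ := h1
  obtain ⟨b, hbA, hbO⟩ := h2
  obtain ⟨q, -, hq1, hq2⟩ := hA _ _ isOpen_interior isClosed_closure.isOpen_compl hcov
    ⟨a, haA, (hcov haA).resolve_right fun h => h (subset_closure haO)⟩
    ⟨b, hbA, (hcov hbA).resolve_left fun h => hbO (interior_subset h)⟩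
  exact hq2 (subset_closure (interior_subset hq1))

theorem starConvex_closure {E : Type*} [NormedAddCommGroup E] [NormedSpace ℝ E] {x : E} {s : Set E}
    (hs : StarConvex ℝ x s) : StarConvex ℝ x (closure s) := by
  intro y hy a b ha hb hab
  exact map_mem_closure (f := fun y => a • x + b • y) (by fun_prop) hy fun z hz => hs hz ha hb hab

end Topology

/-! ### Relative interiors and faces of convex joins. -/

section Join

variable {E : Type*} [NormedAddCommGroup E] [InnerProductSpace ℝ E]

theorem exists_combo_of_mem_convexHull_union {A B : Set E} (hA : Convex ℝ A) (hB : Convex ℝ B)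
    (hAne : A.Nonempty) (hBne : B.Nonempty) {w : E} (hw : w ∈ convexHull ℝ (A ∪ B)) :
    ∃ u ∈ A, ∃ z ∈ B, ∃ a b : ℝ, 0 ≤ a ∧ 0 ≤ b ∧ a + b = 1 ∧ w = a • u + b • z := by
  rw [hA.convexHull_union hB hAne hBne] at hw
  obtain ⟨u, hu, z, hz, a, b, ha, hb, hab, rfl⟩ := mem_convexJoin.1 hw
  exact ⟨u, hu, z, hz, a, b, ha, hb, hab, rfl⟩

/-- Prolonging from the midpoint of relative interior points `u₀`, `z₀` through `w` writes `w` with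
positive weight on both, and mixing them into any other points of `A` and `B` keeps the result in
the relative interiors. -/
theorem exists_openCombo_of_mem_intrinsicInterior [FiniteDimensional ℝ E] {A B : Set E} (hA : Convex ℝ A) (hB : Convex ℝ B)
    (hAne : A.Nonempty) (hBne : B.Nonempty) {w : E}
    (hw : w ∈ intrinsicInterior ℝ (convexHull ℝ (A ∪ B))) :
    ∃ u ∈ intrinsicInterior ℝ A, ∃ z ∈ intrinsicInterior ℝ B, ∃ a b : ℝ,
      0 < a ∧ 0 < b ∧ a + b = 1 ∧ w = a • u + b • z := by
  obtain ⟨u₀, hu₀⟩ := hAne.intrinsicInterior hA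
  obtain ⟨z₀, hz₀⟩ := hBne.intrinsicInterior hB
  have hm : (1 / 2 : ℝ) • u₀ + (1 / 2 : ℝ) • z₀ ∈ convexHull ℝ (A ∪ B) := by
    have h1 : u₀ ∈ convexHull ℝ (A ∪ B) :=
      subset_convexHull ℝ _ (Or.inl (intrinsicInterior_subset hu₀))
    have h2 : z₀ ∈ convexHull ℝ (A ∪ B) :=
      subset_convexHull ℝ _ (Or.inr (intrinsicInterior_subset hz₀))
    exact convex_convexHull ℝ (A ∪ B) h1 h2 (by norm_num) (by norm_num) (by norm_num)
  obtain ⟨w', hw', α, β, hα, hβ, hαβ, hww'⟩ := exists_prolongation_openSegment hw hm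
  obtain ⟨u', hu', z', hz', a, b, ha, hb, hab, rfl⟩ :=
    exists_combo_of_mem_convexHull_union hA hB hAne hBne hw'
  have hp : 0 < α / 2 + β * a := by positivity
  have hq : 0 < α / 2 + β * b := by positivity
  refine ⟨(α / 2 / (α / 2 + β * a)) • u₀ + (β * a / (α / 2 + β * a)) • u',
    combo_mem_intrinsicInterior hA hu₀ hu' (by positivity) (by positivity) (by field_simp),
    (α / 2 / (α / 2 + β * b)) • z₀ + (β * b / (α / 2 + β * b)) • z',
    combo_mem_intrinsicInterior hB hz₀ hz' (by positivity) (by positivity) (by field_simp),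
    α / 2 + β * a, α / 2 + β * b, hp, hq, by nlinarith, ?_⟩
  rw [← hww']
  simp only [smul_add, smul_smul, mul_div_cancel₀ _ hp.ne', mul_div_cancel₀ _ hq.ne']
  rw [show α * (1 / 2) = α / 2 by ring]
  abel

/-- A convex combination reaches the maximum of the exposing functional only if all the generators
with nonzero weight reach it. -/
theorem subface_convexHull {V F : Set E} (hF : IsExposed ℝ (convexHull ℝ V) F) (hne : F.Nonempty) :
    F = convexHull ℝ (V ∩ F) := by
  refine Subset.antisymm ?_ (convexHull_min inter_subset_right (hF.convex (convex_convexHull ℝ V)))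
  obtain ⟨l, hl⟩ := hF hne
  obtain ⟨g, hg⟩ := hne
  have hmax : ∀ w ∈ convexHull ℝ V, l w ≤ l g := by
    rw [hl] at hg; exact hg.2
  have hFmem : ∀ w ∈ convexHull ℝ V, l g ≤ l w → w ∈ F := by
    intro w hw hle
    rw [hl]
    exact ⟨hw, fun y hy => (hmax y hy).trans hle⟩
  have hsub : convexHull ℝ V ⊆ {w ∈ convexHull ℝ V | l w < l g ∨ w ∈ convexHull ℝ (V ∩ F)} := by
    refine convexHull_min ?_ ?_
    · intro v hv
      refine ⟨subset_convexHull ℝ V hv, ?_⟩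
      rcases lt_or_ge (l v) (l g) with h | h
      · exact Or.inl h
      · exact Or.inr (subset_convexHull ℝ _ ⟨hv, hFmem v (subset_convexHull ℝ V hv) h⟩)
    · intro p hp q hq a b ha hb hab
      refine ⟨convex_convexHull ℝ V hp.1 hq.1 ha hb hab, ?_⟩
      rcases ha.eq_or_lt with rfl | ha
      · rw [zero_add] at hab; subst hab
        simpa using hq.2
      rcases hb.eq_or_lt with rfl | hb
      · rw [add_zero] at hab; subst hab
        simpa using hp.2
      have h1 := hmax p hp.1
      have h2 := hmax q hq.1
      have hval : l (a • p + b • q) = a * l p + b * l q := by simp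
      rcases hp.2 with hp2 | hp2
      · left; rw [hval, show b = 1 - a by linarith]; rw [show b = 1 - a by linarith] at hb; nlinarith
      rcases hq.2 with hq2 | hq2
      · left; rw [hval, show b = 1 - a by linarith]; rw [show b = 1 - a by linarith] at hb; nlinarith
      exact Or.inr (convex_convexHull ℝ _ hp2 hq2 ha.le hb.le hab)
  intro w hw
  have hwV : w ∈ convexHull ℝ V := hF.subset hw
  refine (hsub hwV).2.resolve_left (not_lt.2 ?_)
  rw [hl] at hw
  exact hw.2 g (hF.subset hg)

theorem isExposed_inter_of_subset {C A F : Set E} (hF : IsExposed ℝ C F) (hA : A ⊆ C) :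
    IsExposed ℝ A (A ∩ F) := by
  rintro ⟨g, hgA, hgF⟩
  obtain ⟨l, hl⟩ := hF ⟨g, hgF⟩
  refine ⟨l, ?_⟩
  ext x
  constructor
  · rintro ⟨hxA, hxF⟩
    rw [hl] at hxF
    exact ⟨hxA, fun y hy => hxF.2 y (hA hy)⟩
  · rintro ⟨hxA, hmax⟩
    refine ⟨hxA, ?_⟩
    rw [hl] at hgF ⊢
    exact ⟨hA hxA, fun y hy => (hgF.2 y hy).trans (hmax g hgA)⟩

end Join

end TubularSuspension

end

/-! ### Cones and bridges stay inside `O`. -/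

section

open Set Metric Topology

namespace TubularSuspension

variable {n : ℕ} {S : Set (Set (EuclideanSpace ℝ (Fin n)))} {G : EuclideanGraph n}
  {O : Set (EuclideanSpace ℝ (Fin n))} {h : G.T → G.T → ℝ}
  {p : Set (EuclideanSpace ℝ (Fin n)) → G.T}

/-- The conditions on a cut complex under which its suspension is a complex that fills the open set:
besides the occlusion conditions, no point of a closed cell lies on two of its walls, points of the
walls belong to the cells on both sides, and the boundary in a closed cell is covered by the
polyhedra of that cell. -/
structure Suspendable (S : Set (Set (EuclideanSpace ℝ (Fin n)))) (G : EuclideanGraph n)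
    (O : Set (EuclideanSpace ℝ (Fin n))) (h : G.T → G.T → ℝ)
    (p : Set (EuclideanSpace ℝ (Fin n)) → G.T) : Prop where
  isComplex : IsComplex (n - 1) S
  mem : ∀ x : G.T, (x : EuclideanSpace ℝ (Fin n)) ∈ O
  bound : ∀ x y : G.T, G.graph.Adj x y → |h x y| < dist (x : EuclideanSpace ℝ (Fin n)) y / 2
  anti : Anticommutative h
  occlusion : ComplexSimpleOcclusion S G p
  separating : SeparatingFamily S G p (cell G O h)
  total : TotalOcclusion S G p O (cell G O h)
  corner : ∀ (x y z : G.T) (t : EuclideanSpace ℝ (Fin n)), G.graph.Adj x y → G.graph.Adj x z →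
    y ≠ z → t ∈ closure (cell G O h x) → side (x : EuclideanSpace ℝ (Fin n)) y (h x y) t = 0 →
    side (x : EuclideanSpace ℝ (Fin n)) z (h x z) t = 0 → False
  mem_closure : ∀ (x y : G.T) (t : EuclideanSpace ℝ (Fin n)), G.graph.Adj x y →
    t ∈ closure (cell G O h x) → side (x : EuclideanSpace ℝ (Fin n)) y (h x y) t = 0 →
    t ∈ closure (cell G O h y)
  cover : ∀ (x : G.T) (t : EuclideanSpace ℝ (Fin n)), t ∈ frontier O →
    t ∈ closure (cell G O h x) → t ∈ fiberUnion S G p x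

namespace Suspendable

variable {x y z : G.T} {t u w : EuclideanSpace ℝ (Fin n)} {a b c : ℝ}

theorem isOpen (H : Suspendable S G O h p) : IsOpen O := H.total.2.1

theorem notMem_frontier (H : Suspendable S G O h p) (ht : t ∈ O) : t ∉ frontier O := fun h2 =>
  disjoint_left.1 (disjoint_frontier_iff_isOpen.2 H.isOpen) h2 ht

theorem mem_of_closure (_ : Suspendable S G O h p) (ht : t ∈ closure O) (h2 : t ∉ frontier O) :
    t ∈ O := by
  by_contra h3
  exact h2 ⟨ht, fun h4 => h3 (interior_subset h4)⟩

theorem self_mem_cell (H : Suspendable S G O h p) (x : G.T) :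
    (x : EuclideanSpace ℝ (Fin n)) ∈ cell G O h x :=
  TubularSuspension.self_mem_cell (H.mem x) fun y hy => H.bound x y hy

theorem disjoint_closure (H : Suspendable S G O h p) (hxy : x ≠ y) :
    Disjoint (cell G O h x) (closure (cell G O h y)) :=
  (H.separating.2.1 x y hxy).closure_right (H.separating.1 x)

theorem fiber_mem_frontier (H : Suspendable S G O h p) (hu : u ∈ fiberUnion S G p x) :
    u ∈ frontier O := by
  rw [← H.total.2.2.2.1]
  obtain ⟨δ, hδ, huδ⟩ := hu
  exact ⟨δ, hδ.1, huδ⟩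

theorem fiber_mem_closure (H : Suspendable S G O h p) (hu : u ∈ fiberUnion S G p x) :
    u ∈ closure (cell G O h x) := H.separating.2.2.2.1 x hu

theorem exists_fiber (H : Suspendable S G O h p) (hu : u ∈ frontier O) :
    ∃ z, u ∈ fiberUnion S G p z := by
  rw [← H.total.2.2.2.1] at hu
  obtain ⟨δ, hδ, huδ⟩ := hu
  exact ⟨p δ, δ, ⟨hδ, rfl⟩, huδ⟩

theorem exists_closure (H : Suspendable S G O h p) (hu : u ∈ closure O) :
    ∃ z, u ∈ closure (cell G O h z) := by
  rw [H.total.2.2.2.2.1] at hu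
  exact mem_iUnion.1 hu

theorem adj_of_closure (H : Suspendable S G O h p) (hx : u ∈ closure (cell G O h x))
    (hy : u ∈ closure (cell G O h y)) (hxy : x ≠ y) : G.graph.Adj x y := by
  by_contra hadj
  rcases H.total.2.2.2.2.2 x y hadj with h1 | h1
  · exact hxy h1
  · exact disjoint_left.1 h1 hx hy

theorem side_swap (H : Suspendable S G O h p) (x y : G.T) (t : EuclideanSpace ℝ (Fin n)) :
    side (y : EuclideanSpace ℝ (Fin n)) x (h y x) t
      = -side (x : EuclideanSpace ℝ (Fin n)) y (h x y) t := by
  rw [H.anti y x, TubularSuspension.side_swap]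

theorem side_nonpos (_ : Suspendable S G O h p) (hxy : G.graph.Adj x y)
    (hx : u ∈ closure (cell G O h x)) :
    side (x : EuclideanSpace ℝ (Fin n)) y (h x y) u ≤ 0 :=
  closure_cell_subset_closedSector hx y hxy

theorem side_nonneg (H : Suspendable S G O h p) (hxy : G.graph.Adj x y)
    (hy : u ∈ closure (cell G O h y)) :
    0 ≤ side (x : EuclideanSpace ℝ (Fin n)) y (h x y) u := by
  have := H.side_nonpos hxy.symm hy
  rw [H.side_swap x y] at this
  linarith

theorem side_eq_zero (H : Suspendable S G O h p) (hxy : G.graph.Adj x y)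
    (hx : u ∈ closure (cell G O h x)) (hy : u ∈ closure (cell G O h y)) :
    side (x : EuclideanSpace ℝ (Fin n)) y (h x y) u = 0 :=
  le_antisymm (H.side_nonpos hxy hx) (H.side_nonneg hxy hy)

theorem side_self_neg (H : Suspendable S G O h p) (hxy : G.graph.Adj x y) :
    side (x : EuclideanSpace ℝ (Fin n)) y (h x y) x < 0 :=
  self_mem_sector (fun y hy => H.bound x y hy) y hxy

theorem side_self_pos (H : Suspendable S G O h p) (hxy : G.graph.Adj x y) :
    0 < side (x : EuclideanSpace ℝ (Fin n)) y (h x y) y := by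
  have := H.side_self_neg hxy.symm
  rw [H.side_swap x y] at this
  linarith

/-- The cone from `x` over the polyhedra of `x`, minus its base, is contained in the cell of `x`. -/
theorem combo_mem_cell (H : Suspendable S G O h p) (ha : 0 ≤ a) (hb : 0 < b) (hab : a + b = 1)
    (hu : 0 < a → u ∈ fiberUnion S G p x) :
    a • u + b • (x : EuclideanSpace ℝ (Fin n)) ∈ cell G O h x := by
  rcases ha.eq_or_lt with rfl | ha
  · rw [zero_add] at hab; subst hab
    simpa using H.self_mem_cell x
  have hux := hu ha
  have hstar := starConvex_closure (H.separating.2.2.1 x)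
  have hcl : a • u + b • (x : EuclideanSpace ℝ (Fin n)) ∈ closure (cell G O h x) := by
    rw [add_comm]
    exact hstar (H.fiber_mem_closure hux) hb.le ha.le (by linarith)
  have hsec : a • u + b • (x : EuclideanSpace ℝ (Fin n)) ∈ sector G h x := by
    rw [add_comm]
    exact combo_mem_sector (self_mem_sector fun y hy => H.bound x y hy)
      (closure_cell_subset_closedSector (H.fiber_mem_closure hux)) hb ha.le (by linarith)
  -- A frontier point belongs to some `U_z`. If `z = x`, occlusion from `x` forbids it; if not, `z`
  -- is a neighbour of `x` and the point would be beyond the wall between the two cells.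
  have hO : a • u + b • (x : EuclideanSpace ℝ (Fin n)) ∈ O := by
    refine H.mem_of_closure (closure_cell_subset_closure hcl) fun hfr => ?_
    obtain ⟨z, hz⟩ := H.exists_fiber hfr
    rcases eq_or_ne z x with rfl | hzx
    · have h1 := H.occlusion.2.1 z u hux z rfl
      have h2 : a • u + b • (z : EuclideanSpace ℝ (Fin n)) ∈ segment ℝ u z ∩ fiberUnion S G p z :=
        ⟨⟨a, b, ha.le, hb.le, hab, rfl⟩, hz⟩
      rw [h1] at h2
      have h3 : a • u + b • (z : EuclideanSpace ℝ (Fin n)) = u := h2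
      have h4 : b • ((z : EuclideanSpace ℝ (Fin n)) - u) = 0 := by
        rw [show a = 1 - b by linarith] at h3
        have : b • ((z : EuclideanSpace ℝ (Fin n)) - u)
          = ((1 - b) • u + b • (z : EuclideanSpace ℝ (Fin n))) - u := by module
        rw [this, h3, sub_self]
      have h5 := sub_eq_zero.1 ((smul_eq_zero.1 h4).resolve_left hb.ne')
      exact H.notMem_frontier (H.mem z) (h5 ▸ H.fiber_mem_frontier hux)
    · have hadj := H.adj_of_closure hcl (H.fiber_mem_closure hz) hzx.symm
      have h1 := H.side_nonneg hadj (H.fiber_mem_closure hz)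
      exact absurd (hsec z hadj) (not_lt.2 h1)
  exact mem_cell_of_mem_closure H.isOpen ⟨hO, hsec⟩ hcl

/-- A point of the open triangle `x y u`, or of the open edge `x y` if `a = 0`. -/
structure IsBridge (S : Set (Set (EuclideanSpace ℝ (Fin n)))) (G : EuclideanGraph n)
    (p : Set (EuclideanSpace ℝ (Fin n)) → G.T) (x y : G.T) (u : EuclideanSpace ℝ (Fin n))
    (a b c : ℝ) : Prop where
  adj : G.graph.Adj x y
  ha : 0 ≤ a
  hb : 0 < b
  hc : 0 < c
  sum : a + b + c = 1
  hu : 0 < a → u ∈ fiberUnion S G p x ∩ fiberUnion S G p y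

theorem IsBridge.symm (B : IsBridge S G p x y u a b c) : IsBridge S G p y x u a c b :=
  ⟨B.adj.symm, B.ha, B.hc, B.hb, by linarith [B.sum], fun h => (B.hu h).symm⟩

theorem bridge_comm (u v w : EuclideanSpace ℝ (Fin n)) : u + v + w = u + w + v := by abel

/-- The point divides a segment between two cone points over the same `u`, with the same weight `a`:
one with apex `x`, one with apex `y`. -/
theorem bridge_mem_convexJoin (H : Suspendable S G O h p) (B : IsBridge S G p x y u a b c) :
    a • u + b • (x : EuclideanSpace ℝ (Fin n)) + c • (y : EuclideanSpace ℝ (Fin n))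
      ∈ convexJoin ℝ (cell G O h x) (cell G O h y) := by
  have hb := B.hb; have hc := B.hc; have hs := B.sum
  have hbc : 0 < b + c := by linarith
  refine mem_convexJoin.2 ⟨_, H.combo_mem_cell (u := u) (x := x) (a := a) (b := b + c) B.ha hbc
    (by linarith) fun h => (B.hu h).1, _, H.combo_mem_cell (u := u) (x := y) (a := a) (b := b + c)
    B.ha hbc (by linarith) fun h => (B.hu h).2, b / (b + c), c / (b + c), by positivity,
    by positivity, by field_simp, ?_⟩
  have h1 : b / (b + c) + c / (b + c) = 1 := by field_simp
  have h2 : b / (b + c) * (b + c) = b := by field_simp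
  have h3 : c / (b + c) * (b + c) = c := by field_simp
  simp only [smul_add, smul_smul, h2, h3]
  have h4 : a = b / (b + c) * a + c / (b + c) * a := by rw [← add_mul, h1, one_mul]
  conv_rhs => rw [h4]
  rw [add_smul]
  abel

/-- The join of two open sets is open, so its disjointness from a cell extends to the closure of the
cell. -/
theorem disjoint_closure_convexJoin (H : Suspendable S G O h p) (hxy : G.graph.Adj x y)
    (hzx : z ≠ x) (hzy : z ≠ y) :
    Disjoint (closure (cell G O h z)) (convexJoin ℝ (cell G O h x) (cell G O h y)) := by
  refine (H.separating.2.2.2.2.1 x y z hxy hzx hzy).closure_left ?_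
  rw [isOpen_iff_mem_nhds]
  intro q hq
  obtain ⟨u, hu, v, hv, α, β, hα, hβ, hαβ, rfl⟩ := mem_convexJoin.1 hq
  obtain ⟨r, hr, hru⟩ := Metric.isOpen_iff.1 (H.separating.1 x) u hu
  obtain ⟨r', hr', hrv⟩ := Metric.isOpen_iff.1 (H.separating.1 y) v hv
  refine Metric.mem_nhds_iff.2 ⟨min r r', lt_min hr hr', fun q hq => ?_⟩
  rw [mem_ball_iff_norm] at hq
  refine mem_convexJoin.2 ⟨u + (q - (α • u + β • v)), hru ?_, v + (q - (α • u + β • v)), hrv ?_,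
    α, β, hα, hβ, hαβ, ?_⟩
  · rw [mem_ball_iff_norm, add_sub_cancel_left]; exact hq.trans_le (min_le_left _ _)
  · rw [mem_ball_iff_norm, add_sub_cancel_left]; exact hq.trans_le (min_le_right _ _)
  · rw [show β = 1 - α by linarith]; module

theorem bridge_side (H : Suspendable S G O h p) (B : IsBridge S G p x y u a b c) :
    side (x : EuclideanSpace ℝ (Fin n)) y (h x y)
        (a • u + b • (x : EuclideanSpace ℝ (Fin n)) + c • (y : EuclideanSpace ℝ (Fin n)))
      = b * side (x : EuclideanSpace ℝ (Fin n)) y (h x y) x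
        + c * side (x : EuclideanSpace ℝ (Fin n)) y (h x y) y := by
  rw [side_combo₃ _ _ _ B.sum]
  rcases B.ha.eq_or_lt with h0 | h0
  · rw [← h0]; ring
  · rw [H.side_eq_zero B.adj (H.fiber_mem_closure (B.hu h0).1) (H.fiber_mem_closure (B.hu h0).2)]
    ring

/-- The ray from `x` through the bridge meets `[u, y]` in a point `w₂` that is visible from `x` by
the last occlusion condition. A bridge in `U_x` would equal `w₂`, which forces `x = w₂`; but these
two points are on opposite sides of the wall. -/
theorem bridge_notMem_fiber (H : Suspendable S G O h p) (B : IsBridge S G p x y u a b c)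
    (ha : 0 < a) :
    a • u + b • (x : EuclideanSpace ℝ (Fin n)) + c • (y : EuclideanSpace ℝ (Fin n))
      ∉ fiberUnion S G p x := by
  intro hw
  have hb := B.hb; have hc := B.hc; have hs := B.sum
  have hac : 0 < a + c := by linarith
  set w₂ : EuclideanSpace ℝ (Fin n) := (a / (a + c)) • u + (c / (a + c)) • (y : EuclideanSpace ℝ (Fin n))
    with hw₂
  have hac1 : a / (a + c) + c / (a + c) = 1 := by field_simp
  have hw₂mem : w₂ ∈ convexJoin ℝ (fiberUnion S G p x ∩ fiberUnion S G p y)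
      {(y : EuclideanSpace ℝ (Fin n))} :=
    mem_convexJoin.2 ⟨u, B.hu ha, y, rfl, a / (a + c), c / (a + c), by positivity, by positivity,
      hac1, rfl⟩
  have hocc := (H.occlusion.2.2 x y B.adj).2 w₂ (Or.inr hw₂mem) x rfl
  have hdec : a • u + b • (x : EuclideanSpace ℝ (Fin n)) + c • (y : EuclideanSpace ℝ (Fin n))
      = (a + c) • w₂ + b • (x : EuclideanSpace ℝ (Fin n)) := by
    rw [hw₂, smul_add, smul_smul, smul_smul, mul_div_cancel₀ _ hac.ne', mul_div_cancel₀ _ hac.ne']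
    abel
  have hmem : a • u + b • (x : EuclideanSpace ℝ (Fin n)) + c • (y : EuclideanSpace ℝ (Fin n))
      ∈ ({w₂} : Set (EuclideanSpace ℝ (Fin n))) := by
    rw [← hocc]
    exact ⟨⟨a + c, b, hac.le, hb.le, by linarith, hdec.symm⟩, Or.inl hw⟩
  have heq : a • u + b • (x : EuclideanSpace ℝ (Fin n)) + c • (y : EuclideanSpace ℝ (Fin n)) = w₂ :=
    hmem
  have h4 : b • ((x : EuclideanSpace ℝ (Fin n)) - w₂) = 0 := by
    have : b • ((x : EuclideanSpace ℝ (Fin n)) - w₂)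
        = ((a + c) • w₂ + b • (x : EuclideanSpace ℝ (Fin n))) - w₂ := by
      rw [show a + c = 1 - b by linarith]; module
    rw [this, ← hdec, heq, sub_self]
  have h5 := sub_eq_zero.1 ((smul_eq_zero.1 h4).resolve_left hb.ne')
  have h6 : side (x : EuclideanSpace ℝ (Fin n)) y (h x y) w₂
      = c / (a + c) * side (x : EuclideanSpace ℝ (Fin n)) y (h x y) y := by
    rw [hw₂, side_combo _ _ _ hac1, H.side_eq_zero B.adj (H.fiber_mem_closure (B.hu ha).1)
      (H.fiber_mem_closure (B.hu ha).2), mul_zero, zero_add]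
  have h7 := H.side_self_neg B.adj
  have h8 : side (x : EuclideanSpace ℝ (Fin n)) y (h x y) w₂ < 0 := by rw [← h5]; exact h7
  rw [h6] at h8
  have := H.side_self_pos B.adj
  have : 0 < c / (a + c) * side (x : EuclideanSpace ℝ (Fin n)) y (h x y) y := by positivity
  linarith

theorem bridge_notMem_frontier (H : Suspendable S G O h p) (B : IsBridge S G p x y u a b c) :
    a • u + b • (x : EuclideanSpace ℝ (Fin n)) + c • (y : EuclideanSpace ℝ (Fin n))
      ∉ frontier O := by
  intro hfr
  obtain ⟨z, hz⟩ := H.exists_fiber hfr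
  rcases B.ha.eq_or_lt with h0 | h0
  · obtain ⟨δ, hδ, hwδ⟩ := hz
    refine disjoint_left.1 (H.occlusion.1 δ hδ.1 x y B.adj) hwδ ⟨b, c, B.hb.le, B.hc.le, ?_, ?_⟩
    · have := B.sum; linarith
    · rw [← h0, zero_smul, zero_add]
  · rcases eq_or_ne z x with rfl | hzx
    · exact H.bridge_notMem_fiber B h0 hz
    rcases eq_or_ne z y with rfl | hzy
    · rw [bridge_comm] at hz
      exact H.bridge_notMem_fiber B.symm h0 hz
    · exact disjoint_left.1 (H.disjoint_closure_convexJoin B.adj hzx hzy) (H.fiber_mem_closure hz)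
        (H.bridge_mem_convexJoin B)

/-- Moving weight from `x` to `y` joins a cone point, known to be in `O`, to the bridge through
other bridges, which avoid the frontier. -/
theorem bridge_mem (H : Suspendable S G O h p) (B : IsBridge S G p x y u a b c) :
    a • u + b • (x : EuclideanSpace ℝ (Fin n)) + c • (y : EuclideanSpace ℝ (Fin n)) ∈ O := by
  by_contra hO
  have ha := B.ha; have hb := B.hb; have hc := B.hc; have hs := B.sum
  have hpre : IsPreconnected (segment ℝ
      (a • u + (b + c) • (x : EuclideanSpace ℝ (Fin n)))
      (a • u + b • (x : EuclideanSpace ℝ (Fin n)) + c • (y : EuclideanSpace ℝ (Fin n)))) :=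
    (convex_segment _ _).isPreconnected
  have hstart : a • u + (b + c) • (x : EuclideanSpace ℝ (Fin n)) ∈ O :=
    (cell_subset (H.combo_mem_cell B.ha (by linarith) (by linarith) fun h => (B.hu h).1)).1
  obtain ⟨q, hq, hqf⟩ := exists_mem_frontier_of_isPreconnected hpre
    ⟨_, left_mem_segment ℝ _ _, hstart⟩ ⟨_, right_mem_segment ℝ _ _, hO⟩
  obtain ⟨α, β, hα, hβ, hαβ, rfl⟩ := hq
  rcases hβ.eq_or_lt with rfl | hβ
  · rw [add_zero] at hαβ; subst hαβ
    rw [zero_smul, add_zero, one_smul] at hqf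
    exact H.notMem_frontier hstart hqf
  · have B' : IsBridge S G p x y u a (b + α * c) (β * c) :=
      ⟨B.adj, ha, by positivity, by positivity, by rw [show α = 1 - β by linarith]; linarith, B.hu⟩
    refine H.bridge_notMem_frontier B' ?_
    convert hqf using 1
    rw [show α = 1 - β by linarith]; module

theorem bridge_mem_closure (H : Suspendable S G O h p) (B : IsBridge S G p x y u a b c) :
    a • u + b • (x : EuclideanSpace ℝ (Fin n)) + c • (y : EuclideanSpace ℝ (Fin n))
      ∈ closure (cell G O h x) ∪ closure (cell G O h y) := by
  obtain ⟨z, hz⟩ := H.exists_closure (subset_closure (H.bridge_mem B))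
  rcases eq_or_ne z x with rfl | hzx
  · exact Or.inl hz
  rcases eq_or_ne z y with rfl | hzy
  · exact Or.inr hz
  · exact absurd (H.bridge_mem_convexJoin B)
      (disjoint_left.1 (H.disjoint_closure_convexJoin B.adj hzx hzy) hz)

end Suspendable

end TubularSuspension

end

/-! ### A point determines the face of the suspension that carries it. -/

section

open Set Metric Topology

namespace TubularSuspension

variable {n : ℕ} {S : Set (Set (EuclideanSpace ℝ (Fin n)))} {G : EuclideanGraph n}
  {O : Set (EuclideanSpace ℝ (Fin n))} {h : G.T → G.T → ℝ}
  {p : Set (EuclideanSpace ℝ (Fin n)) → G.T}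

namespace Suspendable

variable {x y z : G.T} {t u w : EuclideanSpace ℝ (Fin n)} {a b c : ℝ}
  {F F' : Set (EuclideanSpace ℝ (Fin n))}

/-- The points of the relative interior of the vertex `x`, or of a cone with apex `x`. -/
def InCone (S : Set (Set (EuclideanSpace ℝ (Fin n)))) (G : EuclideanGraph n)
    (p : Set (EuclideanSpace ℝ (Fin n)) → G.T) (x : G.T) (F : Set (EuclideanSpace ℝ (Fin n)))
    (w : EuclideanSpace ℝ (Fin n)) : Prop :=
  ∃ (u : EuclideanSpace ℝ (Fin n)) (a b : ℝ), 0 ≤ a ∧ 0 < b ∧ a + b = 1 ∧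
    w = a • u + b • (x : EuclideanSpace ℝ (Fin n)) ∧ (0 < a → u ∈ fiberUnion S G p x) ∧
    ((a = 0 ∧ F = {(x : EuclideanSpace ℝ (Fin n))}) ∨
      (0 < a ∧ ∃ φ ∈ allSubfaces S, u ∈ intrinsicInterior ℝ φ ∧
        F = convexHull ℝ (φ ∪ {(x : EuclideanSpace ℝ (Fin n))})))

/-- The points of the relative interior of the edge `[x, y]`, or of a join with this edge. -/
def InJoin (S : Set (Set (EuclideanSpace ℝ (Fin n)))) (G : EuclideanGraph n)
    (p : Set (EuclideanSpace ℝ (Fin n)) → G.T) (x y : G.T) (F : Set (EuclideanSpace ℝ (Fin n)))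
    (w : EuclideanSpace ℝ (Fin n)) : Prop :=
  ∃ (u : EuclideanSpace ℝ (Fin n)) (a b c : ℝ), IsBridge S G p x y u a b c ∧
    w = a • u + b • (x : EuclideanSpace ℝ (Fin n)) + c • (y : EuclideanSpace ℝ (Fin n)) ∧
    ((a = 0 ∧ F = convexHull ℝ {(x : EuclideanSpace ℝ (Fin n)), (y : EuclideanSpace ℝ (Fin n))}) ∨
      (0 < a ∧ ∃ φ ∈ allSubfaces S, u ∈ intrinsicInterior ℝ φ ∧
        F = convexHull ℝ
          (φ ∪ {(x : EuclideanSpace ℝ (Fin n)), (y : EuclideanSpace ℝ (Fin n))})))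

theorem InJoin.symm (J : InJoin S G p x y F w) : InJoin S G p y x F w := by
  obtain ⟨u, a, b, c, B, rfl, hF⟩ := J
  refine ⟨u, a, c, b, B.symm, by abel, ?_⟩
  rwa [pair_comm]

theorem InCone.mem_cell (H : Suspendable S G O h p) (C : InCone S G p x F w) :
    w ∈ cell G O h x := by
  obtain ⟨u, a, b, ha, hb, hab, rfl, hu, -⟩ := C
  exact H.combo_mem_cell ha hb hab hu

theorem frontier_of_mem_allSubfaces (H : Suspendable S G O h p) (hF : F ∈ allSubfaces S)
    (hw : w ∈ F) : w ∈ frontier O := by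
  rw [← H.total.2.2.2.1]
  obtain ⟨δ, hδ, hFδ⟩ := mem_iUnion₂.1 hF
  exact ⟨δ, hδ, hFδ.2.subset hw⟩

/-- The base point with the larger weight is the closer to `x` on the common ray: `u'` lies on `[u,
x]`, and occlusion applies. -/
theorem eq_of_inCone_of_le (H : Suspendable S G O h p) {u u' : EuclideanSpace ℝ (Fin n)}
    {a b a' b' : ℝ} (ha : 0 < a) (hab : a + b = 1) (hab' : a' + b' = 1) (hle : a ≤ a')
    (hu : u ∈ fiberUnion S G p x) (hu' : u' ∈ fiberUnion S G p x)
    (heq : a • u + b • (x : EuclideanSpace ℝ (Fin n)) = a' • u' + b' • (x : EuclideanSpace ℝ (Fin n))) :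
    u = u' := by
  have ha' : 0 < a' := ha.trans_le hle
  have hdec : (a / a') • u + (1 - a / a') • (x : EuclideanSpace ℝ (Fin n)) = u' := by
    have h1 : a' • u' = a • u + (a' - a) • (x : EuclideanSpace ℝ (Fin n)) := by
      rw [show a' - a = b - b' by linarith, sub_smul, ← add_sub_assoc, heq, add_sub_cancel_right]
    have h2 : u' = (1 / a') • (a' • u') := by
      rw [smul_smul, one_div_mul_cancel ha'.ne', one_smul]
    rw [h2, h1, smul_add, smul_smul, smul_smul]
    congr 2
    · ring
    · field_simp
  have h1 := H.occlusion.2.1 x u hu x rfl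
  have h2 : u' ∈ segment ℝ u x ∩ fiberUnion S G p x :=
    ⟨⟨a / a', 1 - a / a', by positivity, sub_nonneg.2 ((div_le_one ha').2 hle), by ring, hdec⟩, hu'⟩
  rw [h1] at h2
  exact h2.symm

theorem eq_of_inCone (H : Suspendable S G O h p) (C : InCone S G p x F w)
    (C' : InCone S G p x F' w) : F = F' := by
  obtain ⟨u, a, b, ha, hb, hab, rfl, hu, hF⟩ := C
  obtain ⟨u', a', b', ha', hb', hab', heq, hu', hF'⟩ := C'
  have habs : ∀ {v : EuclideanSpace ℝ (Fin n)} {α β : ℝ}, 0 < α → α + β = 1 →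
      v ∈ fiberUnion S G p x →
      (x : EuclideanSpace ℝ (Fin n)) = α • v + β • (x : EuclideanSpace ℝ (Fin n)) → False := by
    intro v α β hα hαβ hv he
    have h1 : α • (v - (x : EuclideanSpace ℝ (Fin n))) = 0 := by
      have : α • (v - (x : EuclideanSpace ℝ (Fin n)))
          = (α • v + β • (x : EuclideanSpace ℝ (Fin n))) - (x : EuclideanSpace ℝ (Fin n)) := by
        rw [show β = 1 - α by linarith]; module
      rw [this, ← he, sub_self]
    have h2 := sub_eq_zero.1 ((smul_eq_zero.1 h1).resolve_left hα.ne')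
    exact H.notMem_frontier (H.mem x) (h2 ▸ H.fiber_mem_frontier hv)
  rcases hF with ⟨rfl, rfl⟩ | ⟨ha, φ, hφ, huφ, rfl⟩
  · rcases hF' with ⟨-, rfl⟩ | ⟨ha', -⟩
    · rfl
    · rw [zero_add] at hab; subst hab
      rw [zero_smul, zero_add, one_smul] at heq
      exact (habs ha' hab' (hu' ha') heq).elim
  · rcases hF' with ⟨rfl, rfl⟩ | ⟨ha', φ', hφ', huφ', rfl⟩
    · rw [zero_add] at hab'; subst hab'
      rw [zero_smul, zero_add, one_smul] at heq
      exact (habs ha hab (hu ha) heq.symm).elim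
    · have huu : u = u' := by
        rcases le_total a a' with hle | hle
        · exact H.eq_of_inCone_of_le ha hab hab' hle (hu ha) (hu' ha') heq
        · exact (H.eq_of_inCone_of_le ha' hab' hab hle (hu' ha') (hu ha) heq.symm).symm
      subst huu
      rw [H.isComplex.eq_of_mem hφ hφ' huφ huφ']

/-- The point considered is where the ray from `x` through the bridge meets `[u, y]`; it is a cone
point of `y`, because `u` belongs to both fibres and lies on the wall. -/
theorem bridge_far_side (H : Suspendable S G O h p) (B : IsBridge S G p x y u a b c) :
    (a / (a + c)) • u + (c / (a + c)) • (y : EuclideanSpace ℝ (Fin n)) ∈ cell G O h y ∧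
      0 < side (x : EuclideanSpace ℝ (Fin n)) y (h x y)
        ((a / (a + c)) • u + (c / (a + c)) • (y : EuclideanSpace ℝ (Fin n))) := by
  have ha := B.ha; have hc := B.hc
  have hac : 0 < a + c := by linarith
  have hac1 : a / (a + c) + c / (a + c) = 1 := by field_simp
  have hu : 0 < a / (a + c) → 0 < a := fun h' => by
    by_contra h0
    have : a = 0 := le_antisymm (not_lt.1 h0) ha
    simp [this] at h'
  refine ⟨H.combo_mem_cell (by positivity) (by positivity) hac1 fun h' => (B.hu (hu h')).2, ?_⟩
  rw [side_combo _ _ _ hac1]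
  have h1 := H.side_self_pos B.adj
  rcases ha.eq_or_lt with rfl | ha
  · simp only [zero_div, zero_mul, zero_add]; positivity
  · rw [H.side_eq_zero B.adj (H.fiber_mem_closure (B.hu ha).1) (H.fiber_mem_closure (B.hu ha).2)]
    rw [mul_zero, zero_add]; positivity

theorem bridge_eq (B : IsBridge S G p x y u a b c) :
    a • u + b • (x : EuclideanSpace ℝ (Fin n)) + c • (y : EuclideanSpace ℝ (Fin n))
      = (a + c) • ((a / (a + c)) • u + (c / (a + c)) • (y : EuclideanSpace ℝ (Fin n)))
        + b • (x : EuclideanSpace ℝ (Fin n)) := by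
  have hac : a + c ≠ 0 := by have := B.ha; have := B.hc; linarith
  rw [smul_add, smul_smul, smul_smul, mul_div_cancel₀ _ hac, mul_div_cancel₀ _ hac]
  abel

/-- Points of the far part of a ray from `x` through a bridge. -/
theorem isBridge_ray (B : IsBridge S G p x y u a b c) {k : ℝ} (hk0 : 0 < k) (hk1 : k < 1) :
    IsBridge S G p x y u (k * (a / (a + c))) (1 - k) (k * (c / (a + c))) := by
  have ha := B.ha; have hc := B.hc
  have hac : 0 < a + c := by linarith
  refine ⟨B.adj, by positivity, by linarith, by positivity, by field_simp; ring, fun h' => B.hu ?_⟩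
  by_contra h0
  have : a = 0 := le_antisymm (not_lt.1 h0) ha
  simp [this] at h'

theorem ray_eq (x u y : EuclideanSpace ℝ (Fin n)) (k a c : ℝ) :
    (k * a) • u + (1 - k) • x + (k * c) • y = x + k • ((a • u + c • y) - x) := by
  simp only [mul_smul]; module

/-- The base point `u` of the cone and the point `w₂` of `bridge_far_side` are on one ray from `x`.
As `u` does not pass the wall and `w₂` is strictly beyond it, `u` comes before `w₂` and is itself a
bridge; but bridges avoid the frontier. -/
theorem not_inCone_inJoin (H : Suspendable S G O h p) (C : InCone S G p x F w)
    (J : InJoin S G p x y F' w) : False := by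
  obtain ⟨u, a, b, ha, hb, hab, rfl, hu, -⟩ := C
  obtain ⟨v, α, β, γ, B, heq, -⟩ := J
  obtain ⟨-, hpos⟩ := H.bridge_far_side B
  rw [bridge_eq B] at heq
  have hα := B.ha; have hγ := B.hc; have hs := B.sum
  have hαγ : 0 < α + γ := by linarith
  set w₂ := (α / (α + γ)) • v + (γ / (α + γ)) • (y : EuclideanSpace ℝ (Fin n)) with hw₂
  have hrel : a • (u - (x : EuclideanSpace ℝ (Fin n))) = (α + γ) • (w₂ - (x : EuclideanSpace ℝ (Fin n))) := by
    have e1 : a • (u - (x : EuclideanSpace ℝ (Fin n)))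
        = (a • u + b • (x : EuclideanSpace ℝ (Fin n))) - (x : EuclideanSpace ℝ (Fin n)) := by
      rw [show b = 1 - a by linarith]; module
    rw [e1, heq, show β = 1 - (α + γ) by linarith]; module
  have hneg := H.side_self_neg B.adj
  rcases ha.eq_or_lt with rfl | ha
  · rw [zero_smul] at hrel
    have := sub_eq_zero.1 ((smul_eq_zero.1 hrel.symm).resolve_left hαγ.ne')
    rw [this] at hpos
    exact lt_asymm hneg hpos
  · set k := (α + γ) / a with hk
    have hk0 : 0 < k := by positivity
    have hu' : u = (x : EuclideanSpace ℝ (Fin n)) + k • (w₂ - x) := by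
      have : u - (x : EuclideanSpace ℝ (Fin n)) = k • (w₂ - x) := by
        rw [hk, div_eq_inv_mul, mul_smul, ← hrel, smul_smul, inv_mul_cancel₀ ha.ne', one_smul]
      rw [← this]; abel
    have hside := H.side_nonpos B.adj (H.fiber_mem_closure (hu ha))
    have hcomb : u = (1 - k) • (x : EuclideanSpace ℝ (Fin n)) + k • w₂ := by rw [hu']; module
    rw [hcomb, side_combo _ _ _ (by ring)] at hside
    have hk1 : k < 1 := by
      by_contra hcon
      push Not at hcon
      nlinarith [mul_pos hk0 hpos]
    refine H.bridge_notMem_frontier (isBridge_ray B hk0 hk1) ?_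
    rw [ray_eq, ← hw₂, ← hu']
    exact H.fiber_mem_frontier (hu ha)

/-- Since `u` and `u'` are on the wall, comparing the values of `side` shows that `b - b'` and `c -
c'` have the same sign, here nonnegative. So `u'` lies on a segment from `u` to a point `m` of `[x,
y]`, and occlusion with respect to the edge gives `u = u'`. If `a = 0`, then `u'` would be a point
of the edge, which no polyhedron meets. -/
theorem eq_of_inJoin_of_le (H : Suspendable S G O h p) {u u' : EuclideanSpace ℝ (Fin n)}
    {a b c a' b' c' : ℝ} (B : IsBridge S G p x y u a b c) (B' : IsBridge S G p x y u' a' b' c')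
    (hle : a ≤ a') (ha' : 0 < a')
    (heq : a • u + b • (x : EuclideanSpace ℝ (Fin n)) + c • (y : EuclideanSpace ℝ (Fin n))
      = a' • u' + b' • (x : EuclideanSpace ℝ (Fin n)) + c' • (y : EuclideanSpace ℝ (Fin n))) :
    0 < a ∧ u = u' := by
  have hsx := H.side_self_neg B.adj
  have hsy := H.side_self_pos B.adj
  have hside := H.bridge_side B
  rw [heq, H.bridge_side B'] at hside
  set σx := side (x : EuclideanSpace ℝ (Fin n)) y (h x y) x
  set σy := side (x : EuclideanSpace ℝ (Fin n)) y (h x y) y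
  have hs := B.sum; have hs' := B'.sum
  have hrel : (b - b') * (-σx) = (c - c') * σy := by linarith
  have hbb : 0 ≤ b - b' := by
    by_contra hcon
    push Not at hcon
    have h1 : 0 < c - c' := by linarith
    nlinarith [mul_pos h1 hsy]
  have hcc : 0 ≤ c - c' := by
    by_contra hcon
    push Not at hcon
    nlinarith [mul_nonneg hbb (neg_pos.2 hsx).le]
  have hu' : a' • u' = a • u + ((b - b') • (x : EuclideanSpace ℝ (Fin n))
      + (c - c') • (y : EuclideanSpace ℝ (Fin n))) := by
    have : a' • u' = (a' • u' + b' • (x : EuclideanSpace ℝ (Fin n)) + c' • (y : EuclideanSpace ℝ (Fin n)))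
        - b' • (x : EuclideanSpace ℝ (Fin n)) - c' • (y : EuclideanSpace ℝ (Fin n)) := by abel
    rw [this, ← heq]; module
  rcases hle.eq_or_lt with rfl | hlt
  · have h1 : b - b' = 0 := by linarith
    have h2 : c - c' = 0 := by linarith
    rw [h1, h2, zero_smul, zero_smul, add_zero, add_zero] at hu'
    exact ⟨ha', (smul_right_injective _ ha'.ne' hu').symm⟩
  · have hd : 0 < a' - a := by linarith
    set m : EuclideanSpace ℝ (Fin n) := ((b - b') / (a' - a)) • (x : EuclideanSpace ℝ (Fin n))
      + ((c - c') / (a' - a)) • (y : EuclideanSpace ℝ (Fin n)) with hm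
    have hm1 : (b - b') / (a' - a) + (c - c') / (a' - a) = 1 := by
      rw [← add_div, div_eq_one_iff_eq hd.ne']; linarith
    have hmseg : m ∈ segment ℝ (x : EuclideanSpace ℝ (Fin n)) y :=
      ⟨_, _, by positivity, by positivity, hm1, rfl⟩
    have hdm : (b - b') • (x : EuclideanSpace ℝ (Fin n)) + (c - c') • (y : EuclideanSpace ℝ (Fin n))
        = (a' - a) • m := by
      rw [hm, smul_add, smul_smul, smul_smul, mul_div_cancel₀ _ hd.ne', mul_div_cancel₀ _ hd.ne']
    rw [hdm] at hu'
    have hu'' : (a / a') • u + ((a' - a) / a') • m = u' := by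
      refine smul_right_injective _ ha'.ne' ?_
      change a' • _ = a' • u'
      rw [hu', smul_add, smul_smul, smul_smul, mul_div_cancel₀ _ ha'.ne',
        mul_div_cancel₀ _ ha'.ne']
    have hm0 : a / a' + (a' - a) / a' = 1 := by field_simp; ring
    rcases B.ha.eq_or_lt with h0 | h0
    · exfalso
      rw [← h0, zero_div, zero_smul, zero_add, sub_zero, div_self ha'.ne', one_smul] at hu''
      obtain ⟨δ, hδ, hwδ⟩ := (B'.hu ha').1
      exact disjoint_left.1 (H.occlusion.1 δ hδ.1 x y B.adj) hwδ (hu'' ▸ hmseg)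
    · refine ⟨h0, ?_⟩
      have hocc := (H.occlusion.2.2 x y B.adj).1 u (B.hu h0) m hmseg
      have hmem : u' ∈ ({u} : Set (EuclideanSpace ℝ (Fin n))) := by
        rw [← hocc]
        exact ⟨⟨_, _, by positivity, by positivity, hm0, hu''⟩, B'.hu ha'⟩
      exact hmem.symm

theorem eq_of_inJoin (H : Suspendable S G O h p) (J : InJoin S G p x y F w)
    (J' : InJoin S G p x y F' w) : F = F' := by
  obtain ⟨u, a, b, c, B, rfl, hF⟩ := J
  obtain ⟨u', a', b', c', B', heq, hF'⟩ := J'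
  rcases hF with ⟨ha, rfl⟩ | ⟨ha, φ, hφ, huφ, rfl⟩
  · rcases hF' with ⟨-, rfl⟩ | ⟨ha', -⟩
    · rfl
    · exact absurd (H.eq_of_inJoin_of_le B B' (by rw [ha]; exact B'.ha) ha' heq).1 (by simp [ha])
  · rcases hF' with ⟨ha', rfl⟩ | ⟨ha', φ', hφ', huφ', rfl⟩
    · exact absurd (H.eq_of_inJoin_of_le B' B (by rw [ha']; exact B.ha) ha heq.symm).1 (by simp [ha'])
    · have huu : u = u' := by
        rcases le_total a a' with hle | hle
        · exact (H.eq_of_inJoin_of_le B B' hle ha' heq).2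
        · exact (H.eq_of_inJoin_of_le B' B hle ha heq.symm).2.symm
      subst huu
      rw [H.isComplex.eq_of_mem hφ hφ' huφ huφ']

/-- On the common ray from `x`, the far point `w₂'` in the cell of `z` comes no later than the far
point `w₂` in the cell of `y`. If they coincide, two cells meet; if not, `w₂'` is a bridge over `[x,
y]`, hence in the closed cell of `x` or `y`, which the cell of `z` avoids. -/
theorem not_bridge_ray_le (H : Suspendable S G O h p) {u u' : EuclideanSpace ℝ (Fin n)}
    {a b c a' b' c' : ℝ} (B : IsBridge S G p x y u a b c) (B' : IsBridge S G p x z u' a' b' c')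
    (hyz : y ≠ z) (hle : a + c ≤ a' + c')
    (heq : a • u + b • (x : EuclideanSpace ℝ (Fin n)) + c • (y : EuclideanSpace ℝ (Fin n))
      = a' • u' + b' • (x : EuclideanSpace ℝ (Fin n)) + c' • (z : EuclideanSpace ℝ (Fin n))) :
    False := by
  have hy := (H.bridge_far_side B).1
  have hz := (H.bridge_far_side B').1
  rw [bridge_eq B, bridge_eq B'] at heq
  set w₂ := (a / (a + c)) • u + (c / (a + c)) • (y : EuclideanSpace ℝ (Fin n)) with hw₂
  set w₂' := (a' / (a' + c')) • u' + (c' / (a' + c')) • (z : EuclideanSpace ℝ (Fin n)) with hw₂'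
  have hac : 0 < a + c := by have := B.ha; have := B.hc; linarith
  have hac' : 0 < a' + c' := hac.trans_le hle
  have hs := B.sum; have hs' := B'.sum
  have hrel : w₂' = (x : EuclideanSpace ℝ (Fin n)) + ((a + c) / (a' + c')) • (w₂ - x) := by
    have h1 : (a' + c') • (w₂' - (x : EuclideanSpace ℝ (Fin n)))
        = (a + c) • (w₂ - (x : EuclideanSpace ℝ (Fin n))) := by
      have e1 : (a' + c') • (w₂' - (x : EuclideanSpace ℝ (Fin n)))
        = ((a' + c') • w₂' + b' • (x : EuclideanSpace ℝ (Fin n))) - x := by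
        rw [show b' = 1 - (a' + c') by linarith]; module
      rw [e1, ← heq, show b = 1 - (a + c) by linarith]; module
    have h2 : w₂' - (x : EuclideanSpace ℝ (Fin n)) = ((a + c) / (a' + c')) • (w₂ - x) := by
      rw [div_eq_inv_mul, mul_smul, ← h1, smul_smul, inv_mul_cancel₀ hac'.ne', one_smul]
    rw [← h2]; abel
  set k := (a + c) / (a' + c') with hk
  have hk0 : 0 < k := by positivity
  have hk1 : k ≤ 1 := (div_le_one hac').2 hle
  rcases hk1.eq_or_lt with h1 | h1
  · rw [h1, one_smul, add_sub_cancel] at hrel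
    rw [hrel] at hz
    exact disjoint_left.1 (H.separating.2.1 y z hyz) hy hz
  · have hB := H.bridge_mem_closure (isBridge_ray B hk0 h1)
    rw [ray_eq, ← hw₂, ← hrel] at hB
    rcases hB with hB | hB
    · exact disjoint_left.1 (H.disjoint_closure B'.adj.ne') hz hB
    · exact disjoint_left.1 (H.disjoint_closure hyz.symm) hz hB

theorem not_inJoin_inJoin (H : Suspendable S G O h p) (hyz : y ≠ z) (J : InJoin S G p x y F w)
    (J' : InJoin S G p x z F' w) : False := by
  obtain ⟨u, a, b, c, B, rfl, -⟩ := J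
  obtain ⟨u', a', b', c', B', heq, -⟩ := J'
  rcases le_total (a + c) (a' + c') with hle | hle
  · exact H.not_bridge_ray_le B B' hyz hle heq
  · exact H.not_bridge_ray_le B' B hyz.symm hle heq.symm

theorem InJoin.mem_convexJoin (H : Suspendable S G O h p) (J : InJoin S G p x y F w) :
    w ∈ convexJoin ℝ (cell G O h x) (cell G O h y) := by
  obtain ⟨u, a, b, c, B, rfl, -⟩ := J
  exact H.bridge_mem_convexJoin B

theorem InJoin.mem (H : Suspendable S G O h p) (J : InJoin S G p x y F w) : w ∈ O := by
  obtain ⟨u, a, b, c, B, rfl, -⟩ := J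
  exact H.bridge_mem B

theorem InJoin.adj (J : InJoin S G p x y F w) : G.graph.Adj x y := by
  obtain ⟨u, a, b, c, B, rfl, -⟩ := J
  exact B.adj

/-- The position of a point in the relative interior of a face of the suspension. -/
def Position (S : Set (Set (EuclideanSpace ℝ (Fin n)))) (G : EuclideanGraph n)
    (p : Set (EuclideanSpace ℝ (Fin n)) → G.T) (F : Set (EuclideanSpace ℝ (Fin n)))
    (w : EuclideanSpace ℝ (Fin n)) : Prop :=
  (F ∈ allSubfaces S ∧ w ∈ intrinsicInterior ℝ F) ∨ (∃ x, InCone S G p x F w) ∨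
    ∃ x y, InJoin S G p x y F w

theorem eq_of_position (H : Suspendable S G O h p) (P : Position S G p F w)
    (P' : Position S G p F' w) : F = F' := by
  have base_cone : ∀ {F F'}, F ∈ allSubfaces S → w ∈ intrinsicInterior ℝ F →
      (∃ x, InCone S G p x F' w) → False := by
    rintro F F' hF hw ⟨x, C⟩
    exact H.notMem_frontier (cell_subset (C.mem_cell H)).1
      (H.frontier_of_mem_allSubfaces hF (intrinsicInterior_subset hw))
  have base_join : ∀ {F F'}, F ∈ allSubfaces S → w ∈ intrinsicInterior ℝ F →
      (∃ x y, InJoin S G p x y F' w) → False := by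
    rintro F F' hF hw ⟨x, y, J⟩
    exact H.notMem_frontier (J.mem H)
      (H.frontier_of_mem_allSubfaces hF (intrinsicInterior_subset hw))
  have cone_join : ∀ {F F'}, (∃ x, InCone S G p x F w) → (∃ x y, InJoin S G p x y F' w) → False := by
    rintro F F' ⟨z, C⟩ ⟨x, y, J⟩
    rcases eq_or_ne z x with rfl | hzx
    · exact H.not_inCone_inJoin C J
    rcases eq_or_ne z y with rfl | hzy
    · exact H.not_inCone_inJoin C J.symm
    · exact disjoint_left.1 (H.disjoint_closure_convexJoin J.adj hzx hzy)
        (subset_closure (C.mem_cell H)) (J.mem_convexJoin H)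
  have join_left : ∀ {F F'} {x y z}, InJoin S G p x y F w → InJoin S G p x z F' w → F = F' := by
    intro F F' x y z J J'
    rcases eq_or_ne y z with rfl | hyz
    · exact H.eq_of_inJoin J J'
    · exact (H.not_inJoin_inJoin hyz J J').elim
  rcases P with ⟨hF, hw⟩ | P | P
  · rcases P' with ⟨hF', hw'⟩ | P' | P'
    · exact H.isComplex.eq_of_mem hF hF' hw hw'
    · exact (base_cone hF hw P').elim
    · exact (base_join hF hw P').elim
  · rcases P' with ⟨hF', hw'⟩ | P' | P'
    · exact (base_cone hF' hw' P).elim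
    · obtain ⟨x, C⟩ := P
      obtain ⟨y, C'⟩ := P'
      rcases eq_or_ne x y with rfl | hxy
      · exact H.eq_of_inCone C C'
      · exact (disjoint_left.1 (H.separating.2.1 x y hxy) (C.mem_cell H) (C'.mem_cell H)).elim
    · exact (cone_join P P').elim
  · rcases P' with ⟨hF', hw'⟩ | P' | P'
    · exact (base_join hF' hw' P).elim
    · exact (cone_join P' P).elim
    · obtain ⟨a, b, J⟩ := P
      obtain ⟨c, d, J'⟩ := P'
      by_cases hac : a = c
      · subst hac; exact join_left J J'
      by_cases had : a = d
      · subst had; exact join_left J J'.symm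
      by_cases hbc : b = c
      · subst hbc; exact join_left J.symm J'
      by_cases hbd : b = d
      · subst hbd; exact join_left J.symm J'.symm
      exact (disjoint_left.1 (H.separating.2.2.2.2.2 a b c d J.adj J'.adj hac had hbc hbd)
        (J.mem_convexJoin H) (J'.mem_convexJoin H)).elim

/-- The possible faces of a suspension. -/
inductive Face (S : Set (Set (EuclideanSpace ℝ (Fin n)))) (G : EuclideanGraph n)
    (p : Set (EuclideanSpace ℝ (Fin n)) → G.T) : Set (EuclideanSpace ℝ (Fin n)) → Prop
  | base (φ) (hφ : φ ∈ allSubfaces S) : Face S G p φ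
  | apex (x : G.T) : Face S G p {(x : EuclideanSpace ℝ (Fin n))}
  | cone (x : G.T) (φ δ) (hδ : δ ∈ S) (hx : p δ = x) (hφ : φ ∈ subfaces δ) :
      Face S G p (convexHull ℝ (φ ∪ {(x : EuclideanSpace ℝ (Fin n))}))
  | edge (x y : G.T) (hxy : G.graph.Adj x y) :
      Face S G p (convexHull ℝ {(x : EuclideanSpace ℝ (Fin n)), (y : EuclideanSpace ℝ (Fin n))})
  | join (x y : G.T) (hxy : G.graph.Adj x y) (φ α β) (hα : α ∈ S) (hx : p α = x) (hβ : β ∈ S)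
      (hy : p β = y) (hφα : φ ∈ subfaces α) (hφβ : φ ⊆ β) :
      Face S G p
        (convexHull ℝ (φ ∪ {(x : EuclideanSpace ℝ (Fin n)), (y : EuclideanSpace ℝ (Fin n))}))

/-- A face is the hull of the generators it contains, and it meets the base polyhedron in one of its
faces. The cases are given by the apexes it contains and by whether it meets the base. -/
theorem face_of_mem_subfaces (H : Suspendable S G O h p) {Δ : Set (EuclideanSpace ℝ (Fin n))}
    (hΔ : Δ ∈ suspension (n - 1) S G p) (hF : F ∈ subfaces Δ) : Face S G p F := by
  have conv : ∀ {δ φ : Set (EuclideanSpace ℝ (Fin n))}, δ ∈ S → φ ∈ subfaces δ → Convex ℝ φ :=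
    fun hδ hφ => (H.isComplex.isPolyhedron hδ).convex_of_subface hφ
  obtain ⟨-, ⟨δ, hδ, rfl⟩ | ⟨α, hα, β, hβ, hadj, rfl⟩⟩ := hΔ
  · have hFe := subface_convexHull hF.2 hF.1
    have hface : (δ ∩ F).Nonempty → δ ∩ F ∈ subfaces δ := fun hne =>
      ⟨hne, isExposed_inter_of_subset hF.2
        (subset_union_left.trans (subset_convexHull ℝ _))⟩
    rw [union_inter_distrib_right] at hFe
    rcases eq_empty_or_nonempty (δ ∩ F) with he | hne
    · rw [he, empty_union] at hFe
      by_cases hx : (p δ : EuclideanSpace ℝ (Fin n)) ∈ F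
      · rw [singleton_inter_of_mem hx, convexHull_singleton] at hFe
        rw [hFe]; exact Face.apex _
      · rw [singleton_inter_eq_empty.2 hx, convexHull_empty] at hFe
        exact absurd hFe hF.1.ne_empty
    · by_cases hx : (p δ : EuclideanSpace ℝ (Fin n)) ∈ F
      · rw [singleton_inter_of_mem hx] at hFe
        rw [hFe]; exact Face.cone _ _ δ hδ rfl (hface hne)
      · rw [singleton_inter_eq_empty.2 hx, union_empty,
          (conv hδ (hface hne)).convexHull_eq] at hFe
        rw [hFe]; exact Face.base _ (mem_allSubfaces hδ (hface hne))
  · have hFe := subface_convexHull hF.2 hF.1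
    have hface : (α ∩ β ∩ F).Nonempty → α ∩ β ∩ F ∈ subfaces α := fun hne =>
      (H.isComplex.isPolyhedron hα).subfaces_trans
        (H.isComplex.inter_mem_subfaces hα hβ (hne.mono inter_subset_left))
        ⟨hne, isExposed_inter_of_subset hF.2 (subset_union_left.trans (subset_convexHull ℝ _))⟩
    rw [union_inter_distrib_right, insert_eq, union_inter_distrib_right] at hFe
    have hpair : ∀ q r : EuclideanSpace ℝ (Fin n), ({q} : Set (EuclideanSpace ℝ (Fin n))) ∪ {r} = {q, r} :=
      fun q r => rfl
    by_cases hx : (p α : EuclideanSpace ℝ (Fin n)) ∈ F <;>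
      by_cases hy : (p β : EuclideanSpace ℝ (Fin n)) ∈ F
    · rw [singleton_inter_of_mem hx, singleton_inter_of_mem hy, hpair] at hFe
      rcases eq_empty_or_nonempty (α ∩ β ∩ F) with he | hne
      · rw [he, empty_union] at hFe
        rw [hFe]; exact Face.edge _ _ hadj
      · rw [hFe]
        exact Face.join _ _ hadj _ α β hα rfl hβ rfl (hface hne) fun q hq => hq.1.2
    · rw [singleton_inter_of_mem hx, singleton_inter_eq_empty.2 hy, union_empty] at hFe
      rcases eq_empty_or_nonempty (α ∩ β ∩ F) with he | hne
      · rw [he, empty_union, convexHull_singleton] at hFe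
        rw [hFe]; exact Face.apex _
      · rw [hFe]; exact Face.cone _ _ α hα rfl (hface hne)
    · rw [singleton_inter_eq_empty.2 hx, singleton_inter_of_mem hy, empty_union] at hFe
      rcases eq_empty_or_nonempty (α ∩ β ∩ F) with he | hne
      · rw [he, empty_union, convexHull_singleton] at hFe
        rw [hFe]; exact Face.apex _
      · rw [hFe]
        refine Face.cone _ _ β hβ rfl ?_
        exact (H.isComplex.isPolyhedron hβ).mem_subfaces hne (conv hα (hface hne)) (by
          have h1 : β ∩ α ∈ subfaces β := H.isComplex.inter_mem_subfaces hβ hα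
            (by rw [inter_comm]; exact hne.mono inter_subset_left)
          rw [inter_comm] at h1
          exact (subfaces_isExtreme h1).trans (isExposed_inter_of_subset hF.2
            (subset_union_left.trans (subset_convexHull ℝ _))).isExtreme)
    · rw [singleton_inter_eq_empty.2 hx, singleton_inter_eq_empty.2 hy, union_empty,
        union_empty] at hFe
      rcases eq_empty_or_nonempty (α ∩ β ∩ F) with he | hne
      · rw [he, convexHull_empty] at hFe
        exact absurd hFe hF.1.ne_empty
      · rw [(conv hα (hface hne)).convexHull_eq] at hFe
        rw [hFe]; exact Face.base _ (mem_allSubfaces hα (hface hne))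

theorem mem_fiberUnion {δ : Set (EuclideanSpace ℝ (Fin n))} (hδ : δ ∈ S) (hx : p δ = x) :
    δ ⊆ fiberUnion S G p x := fun _ hu => ⟨δ, ⟨hδ, hx⟩, hu⟩

theorem position_of_face (H : Suspendable S G O h p) (hF : Face S G p F)
    (hw : w ∈ intrinsicInterior ℝ F) : Position S G p F w := by
  have conv : ∀ {δ φ : Set (EuclideanSpace ℝ (Fin n))}, δ ∈ S → φ ∈ subfaces δ → Convex ℝ φ :=
    fun hδ hφ => (H.isComplex.isPolyhedron hδ).convex_of_subface hφ
  have edge_pt : ∀ {x y z : EuclideanSpace ℝ (Fin n)},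
      z ∈ intrinsicInterior ℝ (convexHull ℝ ({x, y} : Set (EuclideanSpace ℝ (Fin n)))) →
      ∃ b c : ℝ, 0 < b ∧ 0 < c ∧ b + c = 1 ∧ z = b • x + c • y := by
    intro x y z hz
    rw [show ({x, y} : Set (EuclideanSpace ℝ (Fin n))) = {x} ∪ {y} from rfl] at hz
    obtain ⟨u, hu, v, hv, b, c, hb, hc, hbc, rfl⟩ := exists_openCombo_of_mem_intrinsicInterior
      (convex_singleton x) (convex_singleton y) (singleton_nonempty x) (singleton_nonempty y) hz
    have hu : u = x := mem_singleton_iff.1 (intrinsicInterior_subset hu)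
    have hv : v = y := mem_singleton_iff.1 (intrinsicInterior_subset hv)
    subst hu; subst hv
    exact ⟨b, c, hb, hc, hbc, rfl⟩
  cases hF with
  | base φ hφ => exact Or.inl ⟨hφ, hw⟩
  | apex x =>
    have hw : w = x := mem_singleton_iff.1 (intrinsicInterior_subset hw)
    exact Or.inr (Or.inl ⟨x, x, 0, 1, le_rfl, one_pos, by norm_num, by simp [hw],
      fun h => absurd h (lt_irrefl _), Or.inl ⟨rfl, rfl⟩⟩)
  | cone x φ δ hδ hx hφ =>
    obtain ⟨u, hu, v, hv, a, b, ha, hb, hab, rfl⟩ := exists_openCombo_of_mem_intrinsicInterior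
      (conv hδ hφ) (convex_singleton (x : EuclideanSpace ℝ (Fin n))) hφ.1 (singleton_nonempty _) hw
    have hv : v = x := mem_singleton_iff.1 (intrinsicInterior_subset hv)
    subst hv
    exact Or.inr (Or.inl ⟨x, u, a, b, ha.le, hb, hab, rfl, fun _ => mem_fiberUnion hδ hx
      (hφ.2.subset (intrinsicInterior_subset hu)), Or.inr ⟨ha, φ, mem_allSubfaces hδ hφ, hu, rfl⟩⟩)
  | edge x y hxy =>
    obtain ⟨b, c, hb, hc, hbc, rfl⟩ := edge_pt hw
    exact Or.inr (Or.inr ⟨x, y, x, 0, b, c, ⟨hxy, le_rfl, hb, hc, by linarith,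
      fun h => absurd h (lt_irrefl _)⟩, by simp, Or.inl ⟨rfl, rfl⟩⟩)
  | join x y hxy φ α β hα hx hβ hy hφα hφβ =>
    have hhull : convexHull ℝ (φ ∪ {(x : EuclideanSpace ℝ (Fin n)), (y : EuclideanSpace ℝ (Fin n))})
        = convexHull ℝ (φ ∪ convexHull ℝ
          {(x : EuclideanSpace ℝ (Fin n)), (y : EuclideanSpace ℝ (Fin n))}) :=
      Subset.antisymm (convexHull_mono (union_subset_union_right _ (subset_convexHull ℝ _)))
        (convexHull_min (union_subset (subset_union_left.trans (subset_convexHull ℝ _))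
          (convexHull_mono subset_union_right)) (convex_convexHull ℝ _))
    have hw' := hw
    rw [hhull] at hw'
    obtain ⟨u, hu, v, hv, a, b, ha, hb, hab, rfl⟩ := exists_openCombo_of_mem_intrinsicInterior
      (conv hα hφα) (convex_convexHull ℝ _) hφα.1 ((insert_nonempty _ _).convexHull) hw'
    obtain ⟨β', γ', hβ', hγ', hβγ, rfl⟩ := edge_pt hv
    have huφ := intrinsicInterior_subset hu
    refine Or.inr (Or.inr ⟨x, y, u, a, b * β', b * γ', ⟨hxy, ha.le, by positivity, by positivity,
      by rw [add_assoc, ← mul_add, hβγ, mul_one, hab], fun _ =>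
        ⟨mem_fiberUnion hα hx (hφα.2.subset huφ), mem_fiberUnion hβ hy (hφβ huφ)⟩⟩, ?_,
      Or.inr ⟨ha, φ, mem_allSubfaces hα hφα, hu, rfl⟩⟩)
    rw [smul_add, smul_smul, smul_smul, add_assoc]

end Suspendable

end TubularSuspension

end

/-! ### The suspension is a complex and fills the closure of `O`. -/

section

open Set Metric Topology

namespace TubularSuspension

theorem affineSpan_eq_top_of_dimension_eq {n : ℕ} {A : Set (EuclideanSpace ℝ (Fin n))}
    (hne : A.Nonempty) (hA : dimension A = n) : affineSpan ℝ A = ⊤ := by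
  obtain ⟨q, hq⟩ := hne
  have h1 : (affineSpan ℝ A).direction = ⊤ := by
    apply Submodule.eq_top_of_finrank_eq
    rw [finrank_euclideanSpace_fin]
    exact hA
  exact (AffineSubspace.direction_eq_top_iff_of_nonempty ⟨q, mem_affineSpan ℝ hq⟩).1 h1

theorem exists_last_point {E : Type*} [NormedAddCommGroup E] [NormedSpace ℝ E] {D : Set E}
    (hD : IsClosed D) (hb : Bornology.IsBounded D) {q v : E} (hv : v ≠ 0) {s₀ : ℝ}
    (h0 : q + s₀ • v ∈ D) : ∃ s₁ ≥ s₀, q + s₁ • v ∈ D ∧ ∀ s > s₁, q + s • v ∉ D := by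
  obtain ⟨R, hR⟩ := hb.subset_closedBall q
  have hcont : Continuous fun s : ℝ => q + s • v := by fun_prop
  have hsub : (fun s : ℝ => q + s • v) ⁻¹' D ⊆ Icc (-(R / ‖v‖)) (R / ‖v‖) := by
    intro s hs
    have h1 := hR hs
    rw [mem_closedBall, dist_eq_norm, add_sub_cancel_left, norm_smul, Real.norm_eq_abs] at h1
    exact abs_le.1 ((le_div_iff₀ (norm_pos_iff.2 hv)).2 h1)
  have hcomp : IsCompact ((fun s : ℝ => q + s • v) ⁻¹' D) :=
    isCompact_Icc.of_isClosed_subset (hD.preimage hcont) hsub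
  obtain ⟨s₁, hs₁, hmax⟩ := hcomp.exists_isGreatest ⟨s₀, h0⟩
  exact ⟨s₁, hmax h0, hs₁, fun s hs hsD => absurd (hmax hsD) (not_le.2 hs)⟩

variable {n : ℕ} {S : Set (Set (EuclideanSpace ℝ (Fin n)))} {G : EuclideanGraph n}
  {O : Set (EuclideanSpace ℝ (Fin n))} {h : G.T → G.T → ℝ}
  {p : Set (EuclideanSpace ℝ (Fin n)) → G.T}

/-- All the hulls taking part in the suspension, whatever their dimension. -/
def hulls (S : Set (Set (EuclideanSpace ℝ (Fin n)))) (G : EuclideanGraph n)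
    (p : Set (EuclideanSpace ℝ (Fin n)) → G.T) : Set (Set (EuclideanSpace ℝ (Fin n))) :=
  {δ' | (∃ δ ∈ S, δ' = convexHull ℝ (δ ∪ {(p δ : EuclideanSpace ℝ (Fin n))})) ∨
     (∃ α ∈ S, ∃ β ∈ S, G.graph.Adj (p α) (p β) ∧
        δ' = convexHull ℝ ((α ∩ β) ∪ {(p α : EuclideanSpace ℝ (Fin n)), (p β : EuclideanSpace ℝ (Fin n))}))}

theorem suspension_subset_hulls {k : ℕ} : suspension k S G p ⊆ hulls S G p := fun _ hΔ => hΔ.2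

theorem finite_hulls (hS : S.Finite) : (hulls S G p).Finite := by
  refine ((hS.image fun δ => convexHull ℝ (δ ∪ {(p δ : EuclideanSpace ℝ (Fin n))})).union
    ((hS.prod hS).image fun q => convexHull ℝ ((q.1 ∩ q.2) ∪
      {(p q.1 : EuclideanSpace ℝ (Fin n)), (p q.2 : EuclideanSpace ℝ (Fin n))}))).subset ?_
  rintro Δ (⟨δ, hδ, rfl⟩ | ⟨α, hα, β, hβ, -, rfl⟩)
  · exact Or.inl ⟨δ, hδ, rfl⟩
  · exact Or.inr ⟨(α, β), ⟨hα, hβ⟩, rfl⟩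

theorem convexHull_convexHull_union {E : Type*} [AddCommGroup E] [Module ℝ E] (V W : Set E) :
    convexHull ℝ (convexHull ℝ V ∪ W) = convexHull ℝ (V ∪ W) := by
  have h0 := subset_convexHull ℝ (V ∪ W)
  have h1 : W ⊆ convexHull ℝ (V ∪ W) := subset_union_right.trans h0
  have h2 : convexHull ℝ V ⊆ convexHull ℝ (V ∪ W) := convexHull_mono subset_union_left
  exact Subset.antisymm (convexHull_min (union_subset h2 h1) (convex_convexHull ℝ _))
    (convexHull_mono (union_subset_union_left _ (subset_convexHull ℝ _)))

namespace Suspendable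

variable {x y z : G.T} {t u w : EuclideanSpace ℝ (Fin n)} {a b c : ℝ}

theorem exists_finite_convexHull_eq (H : Suspendable S G O h p)
    {Δ : Set (EuclideanSpace ℝ (Fin n))} (hΔ : Δ ∈ hulls S G p) :
    ∃ V : Set (EuclideanSpace ℝ (Fin n)), V.Finite ∧ V.Nonempty ∧ Δ = convexHull ℝ V := by
  have key : ∀ {P : Set (EuclideanSpace ℝ (Fin n))}, IsPolyhedron P →
      ∃ V : Set (EuclideanSpace ℝ (Fin n)), V.Finite ∧ P = convexHull ℝ V := fun {P} hP =>
    ⟨P.extremePoints ℝ, hP.extremePoints_finite,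
      (convexHull_extremePoints_eq hP.2.1 hP.convex hP.extremePoints_finite).symm⟩
  rcases hΔ with ⟨δ, hδ, rfl⟩ | ⟨α, hα, β, hβ, -, rfl⟩
  · obtain ⟨V, hV, hPV⟩ := key (H.isComplex.isPolyhedron hδ)
    refine ⟨V ∪ {(p δ : EuclideanSpace ℝ (Fin n))}, hV.union (finite_singleton _),
      (singleton_nonempty _).inr, ?_⟩
    rw [← convexHull_convexHull_union V, ← hPV]
  · have hfin : ({(p α : EuclideanSpace ℝ (Fin n)), (p β : EuclideanSpace ℝ (Fin n))} :
        Set (EuclideanSpace ℝ (Fin n))).Finite := by simp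
    rcases eq_empty_or_nonempty (α ∩ β) with he | hne
    · exact ⟨_, hfin, insert_nonempty _ _, by rw [he, empty_union]⟩
    · obtain ⟨V, hV, hPV⟩ := key ((H.isComplex.isPolyhedron hα).subface
        (H.isComplex.inter_mem_subfaces hα hβ hne))
      refine ⟨V ∪ _, hV.union hfin, (insert_nonempty _ _).inr, ?_⟩
      rw [← convexHull_convexHull_union V, ← hPV]

theorem isComplex_suspension (H : Suspendable S G O h p) (hn : 1 ≤ n) :
    IsComplex n (suspension (n - 1) S G p) := by
  refine ⟨(finite_hulls H.isComplex.1).subset suspension_subset_hulls, fun Δ hΔ => ?_,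
    fun F hF F' hF' hne => ?_⟩
  · have hdim : dimension Δ = n := by rw [hΔ.1]; omega
    refine ⟨?_, hdim⟩
    obtain ⟨V, hV, hVne, rfl⟩ := H.exists_finite_convexHull_eq (suspension_subset_hulls hΔ)
    refine isPolyhedron_convexHull_of_finite hV ?_
    rw [interior_convexHull_nonempty_iff_affineSpan_eq_top, ← affineSpan_convexHull]
    exact affineSpan_eq_top_of_dimension_eq hVne.convexHull hdim
  · refine disjoint_left.2 fun w hw hw' => hne ?_
    obtain ⟨Δ, hΔ, hFΔ⟩ := mem_iUnion₂.1 hF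
    obtain ⟨Δ', hΔ', hFΔ'⟩ := mem_iUnion₂.1 hF'
    exact H.eq_of_position (H.position_of_face (H.face_of_mem_subfaces hΔ hFΔ) hw)
      (H.position_of_face (H.face_of_mem_subfaces hΔ' hFΔ') hw')

theorem closure_starConvex (H : Suspendable S G O h p) (x : G.T) :
    StarConvex ℝ (x : EuclideanSpace ℝ (Fin n)) (closure (cell G O h x)) :=
  starConvex_closure (H.separating.2.2.1 x)

theorem combo_mem_closure (H : Suspendable S G O h p) (ha : 0 ≤ a) (hb : 0 ≤ b) (hab : a + b = 1)
    (hu : 0 < a → u ∈ fiberUnion S G p x) :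
    a • u + b • (x : EuclideanSpace ℝ (Fin n)) ∈ closure O := by
  refine closure_cell_subset_closure (h := h) (x := x) ?_
  rcases ha.eq_or_lt with rfl | ha'
  · rw [zero_add] at hab; subst hab
    rw [zero_smul, zero_add, one_smul]
    exact subset_closure (H.self_mem_cell x)
  · rw [add_comm]
    exact H.closure_starConvex x (H.fiber_mem_closure (hu ha')) hb ha (by rw [add_comm, hab])

theorem sUnion_hulls_subset (H : Suspendable S G O h p) : ⋃₀ hulls S G p ⊆ closure O := by
  rintro w ⟨Δ, ⟨δ, hδ, rfl⟩ | ⟨α, hα, β, hβ, hadj, rfl⟩, hw⟩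
  · obtain ⟨u, hu, v, rfl, a, b, ha, hb, hab, rfl⟩ := exists_combo_of_mem_convexHull_union
      (H.isComplex.isPolyhedron hδ).convex (convex_singleton _)
      (H.isComplex.isPolyhedron hδ).1 (singleton_nonempty _) hw
    exact H.combo_mem_closure ha hb hab fun _ => mem_fiberUnion hδ rfl hu
  · have hdec : ∃ (u : EuclideanSpace ℝ (Fin n)) (a b c : ℝ), 0 ≤ a ∧ 0 ≤ b ∧ 0 ≤ c ∧
        a + b + c = 1 ∧ (0 < a → u ∈ α ∩ β) ∧
        w = a • u + b • (p α : EuclideanSpace ℝ (Fin n)) + c • (p β : EuclideanSpace ℝ (Fin n)) := by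
      rcases eq_empty_or_nonempty (α ∩ β) with he | hne
      · rw [he, empty_union, convexHull_pair] at hw
        obtain ⟨b, c, hb, hc, hbc, rfl⟩ := hw
        exact ⟨0, 0, b, c, le_rfl, hb, hc, by linarith, fun h0 => absurd h0 (lt_irrefl _), by simp⟩
      · rw [union_comm, ← convexHull_convexHull_union, convexHull_pair, union_comm] at hw
        obtain ⟨u, hu, v, ⟨b, c, hb, hc, hbc, rfl⟩, a, e, ha, he, hae, rfl⟩ :=
          exists_combo_of_mem_convexHull_union
          ((H.isComplex.isPolyhedron hα).convex.inter (H.isComplex.isPolyhedron hβ).convex)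
          (convex_segment _ _) hne ⟨_, left_mem_segment ℝ _ _⟩ hw
        refine ⟨u, a, e * b, e * c, ha, by positivity, by positivity,
          by rw [add_assoc, ← mul_add, hbc, mul_one, hae], fun _ => hu, ?_⟩
        rw [smul_add, smul_smul, smul_smul, add_assoc]
    obtain ⟨u, a, b, c, ha, hb, hc, hsum, hu, rfl⟩ := hdec
    -- If one apex has weight zero, the point belongs to a cone; if not, it is a bridge.
    rcases hb.eq_or_lt with rfl | hb
    · rw [zero_smul, add_zero]
      exact H.combo_mem_closure ha hc (by linarith) fun h0 => mem_fiberUnion hβ rfl (hu h0).2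
    rcases hc.eq_or_lt with rfl | hc
    · rw [zero_smul, add_zero]
      exact H.combo_mem_closure ha hb.le (by linarith) fun h0 => mem_fiberUnion hα rfl (hu h0).1
    · exact subset_closure (H.bridge_mem ⟨hadj, ha, hb, hc, hsum, fun h0 =>
        ⟨mem_fiberUnion hα rfl (hu h0).1, mem_fiberUnion hβ rfl (hu h0).2⟩⟩)

/-- As `u` is on no other wall, the half of a small ball on the side of `x` meets only the
constraint of `y`, so it lies in the cell. Points of the wall are limits of this half-ball. -/
theorem exists_ball_side_subset (H : Suspendable S G O h p) (hxy : G.graph.Adj x y) (hu : u ∈ O)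
    (hux : u ∈ closure (cell G O h x))
    (h0 : side (x : EuclideanSpace ℝ (Fin n)) y (h x y) u = 0) :
    ∃ r > 0, ∀ q ∈ ball u r, side (x : EuclideanSpace ℝ (Fin n)) y (h x y) q = 0 →
      q ∈ closure (cell G O h x) := by
  have hV : IsOpen (O ∩ {q | ∀ z : G.T, G.graph.Adj x z → z ≠ y →
      side (x : EuclideanSpace ℝ (Fin n)) z (h x z) q < 0}) := by
    refine H.isOpen.inter ?_
    simp only [ofPred_forall]
    refine isOpen_iInter_of_finite fun z => isOpen_iInter_of_finite fun _ =>
      isOpen_iInter_of_finite fun _ => isOpen_lt (continuous_side _ _ _) continuous_const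
  obtain ⟨r, hr, hrV⟩ := Metric.isOpen_iff.1 hV u ⟨hu, fun z hxz hzy =>
    lt_of_le_of_ne (H.side_nonpos hxz hux) fun hz => H.corner x y z u hxy hxz hzy.symm hux h0 hz⟩
  have hhalf : ball u r ∩ {q | side (x : EuclideanSpace ℝ (Fin n)) y (h x y) q < 0}
      ⊆ cell G O h x := by
    refine subset_cell_of_isPreconnected
      ((convex_ball u r).inter (convex_side_lt _ _ _)).isPreconnected ?_ ?_
    · rintro q ⟨hq, hq'⟩
      refine ⟨(hrV hq).1, fun z hz => ?_⟩
      rcases eq_or_ne z y with rfl | hzy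
      · exact hq'
      · exact (hrV hq).2 z hz hzy
    · obtain ⟨q, hq, hqc⟩ := mem_closure_iff.1 hux _ isOpen_ball (mem_ball_self hr)
      exact ⟨q, ⟨hq, (cell_subset hqc).2 y hxy⟩, hqc⟩
  refine ⟨r, hr, fun q hq hq0 => ?_⟩
  have htend : Filter.Tendsto (fun s : ℝ => (1 - s) • q + s • (x : EuclideanSpace ℝ (Fin n)))
      (𝓝[>] 0) (𝓝 q) := by
    have h1 : Continuous fun s : ℝ => (1 - s) • q + s • (x : EuclideanSpace ℝ (Fin n)) := by
      fun_prop
    have h2 := h1.tendsto 0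
    simp only [sub_zero, one_smul, zero_smul, add_zero] at h2
    exact h2.mono_left nhdsWithin_le_nhds
  refine mem_closure_of_tendsto htend ?_
  filter_upwards [htend.eventually (isOpen_ball.mem_nhds hq), self_mem_nhdsWithin] with s hs hs0
  refine hhalf ⟨hs, ?_⟩
  change side _ _ _ _ < 0
  rw [side_combo _ _ _ (by ring), hq0, mul_zero, zero_add]
  exact mul_neg_of_pos_of_neg hs0 (H.side_self_neg hxy)

theorem exists_segment_side_eq_zero (H : Suspendable S G O h p) (hxy : G.graph.Adj x y) :
    ∃ m ∈ segment ℝ (x : EuclideanSpace ℝ (Fin n)) y,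
      side (x : EuclideanSpace ℝ (Fin n)) y (h x y) m = 0 := by
  have h1 := H.side_self_neg hxy
  have h2 := H.side_self_pos hxy
  set σ := side (x : EuclideanSpace ℝ (Fin n)) y (h x y) x
  set τ := side (x : EuclideanSpace ℝ (Fin n)) y (h x y) y
  have h3 : 0 < τ - σ := by linarith
  refine ⟨(τ / (τ - σ)) • (x : EuclideanSpace ℝ (Fin n)) + (-σ / (τ - σ)) • (y : EuclideanSpace ℝ (Fin n)),
    ⟨_, _, by positivity, div_nonneg (by linarith) h3.le, by field_simp; ring, rfl⟩, ?_⟩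
  rw [side_combo _ _ _ (by field_simp; ring)]
  change τ / (τ - σ) * σ + -σ / (τ - σ) * τ = 0
  field_simp
  ring

theorem mem_convexHull_of_ray {E : Type*} [AddCommGroup E] [Module ℝ E] {C : Set E}
    (hC : Convex ℝ C) {q v : E} {s₀ s₁ : ℝ} (h0 : 0 ≤ s₀) (hle : s₀ ≤ s₁) (hq : q ∈ C)
    (hv : q + s₁ • v ∈ C) : q + s₀ • v ∈ C := by
  rcases (h0.trans hle).eq_or_lt with h1 | h1
  · have : s₀ = 0 := le_antisymm (h1 ▸ hle) h0
    rw [this, zero_smul, add_zero]; exact hq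
  · have := hC hq hv (a := 1 - s₀ / s₁) (b := s₀ / s₁)
      (sub_nonneg.2 ((div_le_one h1).2 hle)) (by positivity) (by ring)
    convert this using 1
    rw [smul_add, smul_smul, div_mul_cancel₀ _ h1.ne']
    module

/-- Two successive exit points: the ray from `x` through `w` leaves the closed cell of `x` at `e`;
if `e` is on a wall but not on the frontier, the ray in the wall from the point `m` of `[x, y]`
through `e` leaves the two closed cells on the frontier, at a point of the base of a join. -/
theorem cell_subset_sUnion_hulls (H : Suspendable S G O h p) (x : G.T) :
    cell G O h x ⊆ ⋃₀ hulls S G p := by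
  intro w hw
  have hbdd : ∀ x, Bornology.IsBounded (closure (cell G O h x)) := fun x =>
    (H.total.2.2.1.subset (cell_subset.trans inter_subset_left)).closure
  rcases eq_or_ne w x with rfl | hwx
  · obtain ⟨δ, hδ, hx⟩ := H.total.1 x
    exact ⟨_, Or.inl ⟨δ, hδ, rfl⟩, subset_convexHull ℝ _ (Or.inr (by rw [hx]; rfl))⟩
  obtain ⟨s₁, hs₁, hmem, hlast⟩ := exists_last_point isClosed_closure (hbdd x)
    (sub_ne_zero.2 hwx) (q := x) (s₀ := 1) (by
      rw [one_smul, add_sub_cancel]; exact subset_closure hw)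
  have hwray : ∀ {C : Set (EuclideanSpace ℝ (Fin n))}, Convex ℝ C →
      (x : EuclideanSpace ℝ (Fin n)) ∈ C → (x : EuclideanSpace ℝ (Fin n)) + s₁ • (w - x) ∈ C →
      w ∈ C := fun {C} hC hx he => by
    have := mem_convexHull_of_ray hC zero_le_one hs₁ hx he
    rwa [one_smul, add_sub_cancel] at this
  have hstep : ∀ {q : EuclideanSpace ℝ (Fin n)} {v : EuclideanSpace ℝ (Fin n)} {s : ℝ} {r : ℝ},
      0 < r → ∃ s' > s, q + s' • v ∈ ball (q + s • v) r := by
    intro q v s r hr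
    have hcont : Continuous fun s : ℝ => q + s • v := by fun_prop
    have h1 : ∀ᶠ s' in 𝓝[>] s, q + s' • v ∈ ball (q + s • v) r :=
      (hcont.tendsto s).mono_left nhdsWithin_le_nhds (isOpen_ball.mem_nhds (mem_ball_self hr))
    obtain ⟨s', hs', hs''⟩ := (h1.and self_mem_nhdsWithin).exists
    exact ⟨s', hs'', hs'⟩
  set e := (x : EuclideanSpace ℝ (Fin n)) + s₁ • (w - x) with he
  by_cases hef : e ∈ frontier O
  · obtain ⟨δ, ⟨hδ, hx⟩, heδ⟩ := H.cover x e hef hmem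
    refine ⟨_, Or.inl ⟨δ, hδ, rfl⟩, hwray (convex_convexHull ℝ _)
      (subset_convexHull ℝ _ (Or.inr (by rw [hx]; rfl))) (subset_convexHull ℝ _ (Or.inl heδ))⟩
  have heO := H.mem_of_closure (closure_cell_subset_closure hmem) hef
  -- Otherwise `e` would be in the open cell and the ray could go further.
  have hex : ∃ y, G.graph.Adj x y ∧ side (x : EuclideanSpace ℝ (Fin n)) y (h x y) e = 0 := by
    by_contra hcon
    push Not at hcon
    have hec := mem_cell_of_mem_closure H.isOpen (x := x) (h := h) ⟨heO, fun y hy =>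
      lt_of_le_of_ne (H.side_nonpos hy hmem) (hcon y hy)⟩ hmem
    obtain ⟨r, hr, hrc⟩ := Metric.isOpen_iff.1 (H.separating.1 x) e hec
    obtain ⟨s', hs', hs''⟩ := hstep (q := x) (v := w - x) (s := s₁) hr
    exact hlast s' hs' (subset_closure (hrc hs''))
  obtain ⟨y, hxy, hey⟩ := hex
  have hecy := H.mem_closure x y e hxy hmem hey
  obtain ⟨m, hm, hm0⟩ := H.exists_segment_side_eq_zero hxy
  obtain ⟨α₀, hα₀, hx₀⟩ := H.total.1 x
  obtain ⟨β₀, hβ₀, hy₀⟩ := H.total.1 y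
  have join_mem : ∀ {α β : Set (EuclideanSpace ℝ (Fin n))}, α ∈ S → β ∈ S → p α = x → p β = y →
      e ∈ convexHull ℝ ((α ∩ β) ∪ {(x : EuclideanSpace ℝ (Fin n)), (y : EuclideanSpace ℝ (Fin n))}) →
      w ∈ ⋃₀ hulls S G p := by
    intro α β hα hβ hx hy hw'
    refine ⟨_, Or.inr ⟨α, hα, β, hβ, by rw [hx, hy]; exact hxy, rfl⟩, ?_⟩
    rw [hx, hy]
    exact hwray (convex_convexHull ℝ _) (subset_convexHull ℝ _ (Or.inr (Or.inl rfl))) hw'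
  have hseg : ∀ A : Set (EuclideanSpace ℝ (Fin n)), m ∈ convexHull ℝ (A ∪
      {(x : EuclideanSpace ℝ (Fin n)), (y : EuclideanSpace ℝ (Fin n))}) := fun A =>
    segment_subset_convexHull (x := (x : EuclideanSpace ℝ (Fin n))) (y := y)
      (Or.inr (Or.inl rfl)) (Or.inr (Or.inr rfl)) hm
  rcases eq_or_ne e m with hem | hem
  · exact join_mem hα₀ hβ₀ hx₀ hy₀ (by rw [hem]; exact hseg _)
  -- The ray from `m` through `e` stays in the wall, where `side` vanishes.
  obtain ⟨s₂, hs₂, ⟨hux, huy⟩, hlast₂⟩ := exists_last_point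
    (isClosed_closure.inter isClosed_closure) ((hbdd x).subset inter_subset_left)
    (sub_ne_zero.2 hem) (D := closure (cell G O h x) ∩ closure (cell G O h y))
    (q := m) (s₀ := 1) (by rw [one_smul, add_sub_cancel]; exact ⟨hmem, hecy⟩)
  have hside : ∀ s : ℝ, side (x : EuclideanSpace ℝ (Fin n)) y (h x y) (m + s • (e - m)) = 0 := by
    intro s
    rw [show m + s • (e - m) = (1 - s) • m + s • e by module, side_combo _ _ _ (by ring), hm0, hey]
    ring
  by_cases huf : m + s₂ • (e - m) ∈ frontier O
  · obtain ⟨α, ⟨hα, hx⟩, huα⟩ := H.cover x _ huf hux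
    obtain ⟨β, ⟨hβ, hy⟩, huβ⟩ := H.cover y _ huf huy
    refine join_mem hα hβ hx hy ?_
    have := mem_convexHull_of_ray (convex_convexHull ℝ ((α ∩ β) ∪
      {(x : EuclideanSpace ℝ (Fin n)), (y : EuclideanSpace ℝ (Fin n))})) zero_le_one hs₂
      (hseg _) (subset_convexHull ℝ _ (Or.inl ⟨huα, huβ⟩))
    rwa [one_smul, add_sub_cancel] at this
  -- Inside `O`, the wall around the exit point is still in both closed cells, so it was not the
  -- last point.
  · exfalso
    have huO := H.mem_of_closure (closure_cell_subset_closure hux) huf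
    obtain ⟨r, hr, hrc⟩ := H.exists_ball_side_subset hxy huO hux (hside s₂)
    obtain ⟨s', hs', hs''⟩ := hstep (q := m) (v := e - m) (s := s₂) hr
    have h1 := hrc _ hs'' (hside s')
    exact hlast₂ s' hs' ⟨h1, H.mem_closure x y _ hxy h1 (hside s')⟩

theorem isClosed_of_mem_hulls (H : Suspendable S G O h p) {Δ : Set (EuclideanSpace ℝ (Fin n))}
    (hΔ : Δ ∈ hulls S G p) : IsClosed Δ := by
  obtain ⟨V, hV, -, rfl⟩ := H.exists_finite_convexHull_eq hΔ
  exact hV.isClosed_convexHull ℝ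

theorem sUnion_suspension (H : Suspendable S G O h p) (hn : 1 ≤ n) :
    ⋃₀ suspension (n - 1) S G p = closure O := by
  refine Subset.antisymm ((sUnion_mono suspension_subset_hulls).trans H.sUnion_hulls_subset) ?_
  have hfin : (hulls S G p).Finite := finite_hulls H.isComplex.1
  have hclosed : IsClosed (⋃₀ hulls S G p) := by
    rw [sUnion_eq_biUnion]
    exact hfin.isClosed_biUnion fun Δ => H.isClosed_of_mem_hulls
  have hsub : closure O ⊆ ⋃₀ hulls S G p := by
    rw [H.total.2.2.2.2.1]
    exact iUnion_subset fun x => closure_minimal (H.cell_subset_sUnion_hulls x) hclosed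
  have hclosed' : IsClosed (⋃₀ suspension (n - 1) S G p) :=
    by
    rw [sUnion_eq_biUnion]
    exact (hfin.subset suspension_subset_hulls).isClosed_biUnion fun Δ hΔ =>
      H.isClosed_of_mem_hulls (suspension_subset_hulls hΔ)
  refine closure_minimal ?_ hclosed'
  -- The degenerate hulls lie in finitely many proper affine subspaces, a null set with dense
  -- complement. The full-dimensional hulls form a closed set that covers this complement in `O`,
  -- hence all of `O`.
  set N : Set (EuclideanSpace ℝ (Fin n)) :=
    ⋃ Δ ∈ hulls S G p \ suspension (n - 1) S G p, (affineSpan ℝ Δ : Set (EuclideanSpace ℝ (Fin n)))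
    with hN
  have hnull : MeasureTheory.volume N = 0 := by
    rw [hN, MeasureTheory.measure_biUnion_null_iff (hfin.sdiff).countable]
    rintro Δ ⟨hΔ, hΔ'⟩
    refine MeasureTheory.Measure.addHaar_affineSubspace _ _ fun htop => hΔ' ⟨?_, hΔ⟩
    rw [dimension, htop, AffineSubspace.direction_top, finrank_top, finrank_euclideanSpace_fin]
    omega
  have hdense : Dense Nᶜ := MeasureTheory.Measure.dense_of_ae (μ := MeasureTheory.volume)
    (MeasureTheory.measure_eq_zero_iff_ae_notMem.1 hnull)
  intro w hw
  rw [← hclosed'.closure_eq]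
  refine closure_mono ?_ (hdense.open_subset_closure_inter H.isOpen hw)
  rintro q ⟨hqO, hqN⟩
  obtain ⟨Δ, hΔ, hqΔ⟩ := hsub (subset_closure hqO)
  by_cases hmem : Δ ∈ suspension (n - 1) S G p
  · exact ⟨Δ, hmem, hqΔ⟩
  · exact absurd (mem_iUnion₂.2 ⟨Δ, ⟨hΔ, hmem⟩, subset_affineSpan ℝ _ hqΔ⟩) hqN

end Suspendable

end TubularSuspension

end

/-! ### Inner and outer radii, and the radii of the faces of the suspension. -/

section

open Set Metric Topology

namespace TubularSuspension

section Radii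

variable {n k : ℕ} {A : Set (EuclideanSpace ℝ (Fin n))} {S : Set (Set (EuclideanSpace ℝ (Fin n)))}
  {r R : ℝ} {c q : EuclideanSpace ℝ (Fin n)}

theorem exists_relBall_of_lt_innerRadius (hr : 0 < r) (h : r < innerRadius A) :
    ∃ c, RelBall c r A := by
  unfold innerRadius at h
  -- The set of radii is nonempty: the supremum of the empty set is `0` by convention, against `0 <
  -- r < innerRadius A`.
  obtain ⟨r', ⟨-, c, hc, hsub⟩, hlt⟩ := exists_lt_of_lt_csSup (by
    by_contra hne
    rw [not_nonempty_iff_eq_empty] at hne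
    rw [hne, Real.sSup_empty] at h
    linarith) h
  exact ⟨c, RelBall.mono ⟨hc, hsub⟩ hlt.le⟩

/-- Two opposite points of the relative ball are at distance `2 * r`; they exist because the
dimension is positive. -/
theorem RelBall.radius_le (h : RelBall c r A) (hr : 0 < r) (hdim : dimension A ≠ 0)
    (hA : A ⊆ closedBall q R) : r ≤ R := by
  have hne : (affineSpan ℝ A).direction ≠ ⊥ := fun h0 => hdim (by
    rw [dimension, h0, finrank_bot])
  obtain ⟨v, hv, hv0⟩ := Submodule.exists_mem_ne_zero_of_ne_bot hne
  have hmem : ∀ s : ℝ, |s| * ‖v‖ ≤ r → c + s • v ∈ A := fun s hs => by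
    refine h.2 ⟨?_, ?_⟩
    · rw [mem_closedBall, dist_eq_norm, add_sub_cancel_left, norm_smul]
      exact hs
    · rw [add_comm]
      exact AffineSubspace.vadd_mem_of_mem_direction (Submodule.smul_mem _ s hv) h.1
  have hv1 := norm_pos_iff.2 hv0
  have h1 := hA (hmem (r / ‖v‖) (by
    rw [abs_of_pos (by positivity), div_mul_cancel₀ _ hv1.ne']))
  have h2 := hA (hmem (-(r / ‖v‖)) (by
    rw [abs_neg, abs_of_pos (by positivity), div_mul_cancel₀ _ hv1.ne']))
  rw [mem_closedBall] at h1 h2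
  have h3 := dist_triangle_right (c + (r / ‖v‖) • v) (c + -(r / ‖v‖) • v) q
  have h4 : dist (c + (r / ‖v‖) • v) (c + -(r / ‖v‖) • v) = 2 * r := by
    rw [dist_eq_norm, show c + (r / ‖v‖) • v - (c + -(r / ‖v‖) • v) = (2 * (r / ‖v‖)) • v by module,
      norm_smul, Real.norm_eq_abs, abs_of_pos (by positivity), mul_assoc,
      div_mul_cancel₀ _ hv1.ne']
  linarith

/-- Positive dimension makes the set of radii bounded above; for a point, every radius would be
allowed and the supremum would be the default value `0`. -/
theorem RelBall.le_innerRadius (h : RelBall c r A) (hr : 0 < r) (hdim : dimension A ≠ 0)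
    (hA : Bornology.IsBounded A) : r ≤ innerRadius A := by
  obtain ⟨R, hR⟩ := hA.subset_closedBall 0
  unfold innerRadius
  refine le_csSup ⟨R, ?_⟩ ⟨hr, c, h.1, h.2⟩
  rintro r' ⟨hr', c', hc', hsub⟩
  exact RelBall.radius_le (c := c') ⟨hc', hsub⟩ hr' hdim hR

theorem innerRadius_nonneg (A : Set (EuclideanSpace ℝ (Fin n))) : 0 ≤ innerRadius A :=
  Real.sSup_nonneg fun _ hr => hr.1.le

theorem outerRadius_nonneg (A : Set (EuclideanSpace ℝ (Fin n))) : 0 ≤ outerRadius A :=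
  Real.sInf_nonneg fun _ hr => hr.1.le

theorem outerRadius_le (hR : 0 < R) (hA : A ⊆ closedBall q R) : outerRadius A ≤ R :=
  csInf_le (s := {r | 0 < r ∧ ∃ x, A ⊆ closedBall x r}) ⟨0, fun _ hr => hr.1.le⟩ ⟨hR, q, hA⟩

theorem exists_subset_closedBall_of_outerRadius_lt (hA : Bornology.IsBounded A)
    (h : outerRadius A < R) : ∃ q, A ⊆ closedBall q R := by
  obtain ⟨R', hR'⟩ := hA.subset_closedBall 0
  obtain ⟨r, ⟨-, q, hq⟩, hlt⟩ := exists_lt_of_csInf_lt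
    (s := {r | 0 < r ∧ ∃ x, A ⊆ closedBall x r}) ⟨max R' 1, by positivity, 0, hR'.trans (closedBall_subset_closedBall (le_max_left _ _))⟩ h
  exact ⟨q, hq.trans (closedBall_subset_closedBall hlt.le)⟩

theorem innerRadius_le_outerRadius (hA : Bornology.IsBounded A) (hdim : dimension A ≠ 0) :
    innerRadius A ≤ outerRadius A := by
  by_contra hcon
  push Not at hcon
  obtain ⟨r, h1, h2⟩ := exists_between hcon
  have hr := (outerRadius_nonneg A).trans_lt h1
  obtain ⟨r', h3, h4⟩ := exists_between h2
  obtain ⟨q, hq⟩ := exists_subset_closedBall_of_outerRadius_lt hA h1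
  obtain ⟨c, hc⟩ := exists_relBall_of_lt_innerRadius (hr.trans h3) h4
  exact absurd (hc.radius_le (hr.trans h3) hdim hq) (not_le.2 h3)

theorem IsComplex.isBounded_of_mem (hS : IsComplex k S) (hA : A ∈ allSubfaces S) :
    Bornology.IsBounded A := by
  obtain ⟨δ, hδ, hAδ⟩ := mem_iUnion₂.1 hA
  exact (hS.isPolyhedron hδ).2.1.isBounded.subset hAδ.2.subset

theorem IsComplex.outerRadius_le (hS : IsComplex k S) (hA : A ∈ allSubfaces S) :
    outerRadius A ≤ complexOuterRadius S := by
  refine le_csSup ?_ ⟨A, hA, rfl⟩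
  have hb : Bornology.IsBounded (⋃₀ S) := by
    rw [sUnion_eq_biUnion]
    exact (Bornology.isBounded_biUnion hS.1).2 fun δ hδ => (hS.isPolyhedron hδ).2.1.isBounded
  obtain ⟨R, hR⟩ := hb.subset_closedBall 0
  refine ⟨max R 1, ?_⟩
  rintro _ ⟨F, hF, rfl⟩
  obtain ⟨δ, hδ, hFδ⟩ := mem_iUnion₂.1 hF
  exact TubularSuspension.outerRadius_le (by positivity) ((hFδ.2.subset.trans
    (subset_sUnion_of_mem hδ)).trans (hR.trans (closedBall_subset_closedBall (le_max_left _ _))))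

theorem IsComplex.exists_subset_closedBall (hS : IsComplex k S) (h : complexOuterRadius S < R)
    (hA : A ∈ allSubfaces S) : ∃ q, A ⊆ closedBall q R :=
  exists_subset_closedBall_of_outerRadius_lt (hS.isBounded_of_mem hA)
    ((hS.outerRadius_le hA).trans_lt h)

theorem complexInnerRadius_le (hA : A ∈ allSubfaces S) (hdim : dimension A ≠ 0) :
    complexInnerRadius S ≤ innerRadius A :=
  csInf_le ⟨0, by rintro _ ⟨F, -, rfl⟩; exact innerRadius_nonneg F⟩ ⟨A, ⟨hA, hdim⟩, rfl⟩

theorem exists_relBall_of_lt_complexInnerRadius (hr : 0 < r) (h : r < complexInnerRadius S)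
    (hA : A ∈ allSubfaces S) (hdim : dimension A ≠ 0) : ∃ c, RelBall c r A :=
  exists_relBall_of_lt_innerRadius hr (h.trans_le (complexInnerRadius_le hA hdim))

theorem IsComplex.complexInnerRadius_le_complexOuterRadius (hS : IsComplex k S) (hk : k ≠ 0)
    (hne : S.Nonempty) : complexInnerRadius S ≤ complexOuterRadius S := by
  obtain ⟨δ, hδ⟩ := hne
  have hmem : δ ∈ allSubfaces S := mem_allSubfaces hδ (hS.isPolyhedron hδ).self_mem_subfaces
  have hdim : dimension δ ≠ 0 := by rw [(hS.2.1 δ hδ).2]; exact hk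
  exact (complexInnerRadius_le hmem hdim).trans
    ((innerRadius_le_outerRadius (hS.isBounded_of_mem hmem) hdim).trans (hS.outerRadius_le hmem))

theorem complexOuterRadius_le (hR : 0 < R)
    (h : ∀ F ∈ allSubfaces S, ∃ q, F ⊆ closedBall q R) : complexOuterRadius S ≤ R := by
  refine Real.sSup_le ?_ hR.le
  rintro _ ⟨F, hF, rfl⟩
  obtain ⟨q, hq⟩ := h F hF
  exact outerRadius_le hR hq

theorem IsComplex.le_complexInnerRadius (hS : IsComplex k S) (hk : k ≠ 0) (hne : S.Nonempty)
    (hr : 0 < r) (h : ∀ F ∈ allSubfaces S, dimension F ≠ 0 → ∃ c, RelBall c r F) :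
    r ≤ complexInnerRadius S := by
  refine le_csInf ?_ ?_
  · obtain ⟨δ, hδ⟩ := hne
    exact ⟨_, δ, ⟨mem_allSubfaces hδ (hS.isPolyhedron hδ).self_mem_subfaces, by
      rw [(hS.2.1 δ hδ).2]; exact hk⟩, rfl⟩
  · rintro _ ⟨F, ⟨hF, hdim⟩, rfl⟩
    obtain ⟨c, hc⟩ := h F hF hdim
    exact hc.le_innerRadius hr hdim (hS.isBounded_of_mem hF)

end Radii

namespace Suspendable

variable {n : ℕ} {S : Set (Set (EuclideanSpace ℝ (Fin n)))} {G : EuclideanGraph n}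
  {O : Set (EuclideanSpace ℝ (Fin n))} {h : G.T → G.T → ℝ}
  {p : Set (EuclideanSpace ℝ (Fin n)) → G.T} {x y : G.T}
  {F φ : Set (EuclideanSpace ℝ (Fin n))} {r a R : ℝ}

theorem subset_closedBall_of_face (hdiam : ∀ δ ∈ S, ∀ u ∈ δ, ‖(p δ : EuclideanSpace ℝ (Fin n)) - u‖ ≤ R)
    (hR : 0 ≤ R) (hedge : ∀ x y : G.T, G.graph.Adj x y → dist (x : EuclideanSpace ℝ (Fin n)) y ≤ R)
    (hF : Face S G p F) : ∃ q, F ⊆ closedBall q R := by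
  have hball : ∀ δ ∈ S, δ ⊆ closedBall (p δ : EuclideanSpace ℝ (Fin n)) R := fun δ hδ u hu => by
    rw [mem_closedBall, dist_comm, dist_eq_norm]; exact hdiam δ hδ u hu
  cases hF with
  | base φ hφ =>
    obtain ⟨δ, hδ, hφδ⟩ := mem_iUnion₂.1 hφ
    exact ⟨p δ, hφδ.2.subset.trans (hball δ hδ)⟩
  | apex x => exact ⟨x, singleton_subset_iff.2 (mem_closedBall_self hR)⟩
  | cone x φ δ hδ hx hφ =>
    subst hx
    exact ⟨p δ, convexHull_min (union_subset (hφ.2.subset.trans (hball δ hδ))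
      (singleton_subset_iff.2 (mem_closedBall_self hR))) (convex_closedBall _ _)⟩
  | edge x y hxy =>
    exact ⟨x, convexHull_min (insert_subset (mem_closedBall_self hR) (singleton_subset_iff.2
      (by rw [mem_closedBall, dist_comm]; exact hedge x y hxy))) (convex_closedBall _ _)⟩
  | join x y hxy φ α β hα hx hβ hy hφα hφβ =>
    subst hx
    exact ⟨p α, convexHull_min (union_subset (hφα.2.subset.trans (hball α hα))
      (insert_subset (mem_closedBall_self hR) (singleton_subset_iff.2
      (by rw [mem_closedBall, dist_comm]; exact hedge _ y hxy)))) (convex_closedBall _ _)⟩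

/-- The distance of the second apex of a join to the affine hull of the first cone. -/
theorem le_norm_sub_of_mem_affineSpan_insert (H : Suspendable S G O h p) (hxy : G.graph.Adj x y)
    (hφ : φ.Nonempty) (hφx : φ ⊆ fiberUnion S G p x) (hφy : φ ⊆ fiberUnion S G p y)
    (hlevel : ∀ x y : G.T, G.graph.Adj x y → a ≤ dist (x : EuclideanSpace ℝ (Fin n)) y / 2 - h x y)
    (hseg : ∀ z ∈ segment ℝ (x : EuclideanSpace ℝ (Fin n)) y, ∀ u ∈ affineSpan ℝ φ, a ≤ ‖z - u‖)
    {q : EuclideanSpace ℝ (Fin n)}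
    (hq : q ∈ affineSpan ℝ (insert (x : EuclideanSpace ℝ (Fin n)) φ)) :
    a ≤ ‖(y : EuclideanSpace ℝ (Fin n)) - q‖ := by
  obtain ⟨v, hv⟩ := hφ
  rw [← affineSpan_insert_affineSpan,
    AffineSubspace.mem_affineSpan_insert_iff (mem_affineSpan ℝ hv)] at hq
  obtain ⟨t, u, hu, rfl⟩ := hq
  simp only [vsub_eq_sub, vadd_eq_add]
  -- For `t < 0`, the vector from `q` to `y` is `1 - t ≥ 1` times a vector between the edge and the
  -- affine hull of `φ`. For `t ≥ 0`, the point `q` does not pass the wall, so its distance to `y`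
  -- is at least that of `y` to the wall.
  rcases lt_or_ge t 0 with ht | ht
  · have ht1 : 0 < 1 - t := by linarith
    set b := 1 / (1 - t) with hb
    have hb0 : 0 ≤ b := by positivity
    have hb1 : (1 - t) * b = 1 := by rw [hb]; field_simp
    have hb2 : b ≤ 1 := (div_le_one ht1).2 (by linarith)
    have hw := AffineMap.lineMap_mem b (mem_affineSpan ℝ hv) hu
    have h1 := hseg ((1 - b) • (x : EuclideanSpace ℝ (Fin n)) + b • (y : EuclideanSpace ℝ (Fin n)))
      ⟨_, _, sub_nonneg.2 hb2, hb0, by ring, rfl⟩ _ hw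
    rw [AffineMap.lineMap_apply_module] at h1
    have h2 : (y : EuclideanSpace ℝ (Fin n)) - (t • ((x : EuclideanSpace ℝ (Fin n)) - v) + u)
        = (1 - t) • ((1 - b) • (x : EuclideanSpace ℝ (Fin n)) + b • (y : EuclideanSpace ℝ (Fin n))
          - ((1 - b) • v + b • u)) := by
      match_scalars <;> first | linear_combination hb1 | linear_combination -hb1
    rw [h2, norm_smul, Real.norm_eq_abs, abs_of_pos ht1]
    nlinarith [norm_nonneg ((1 - b) • (x : EuclideanSpace ℝ (Fin n))
      + b • (y : EuclideanSpace ℝ (Fin n)) - ((1 - b) • v + b • u))]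
  · have hside : ∀ w ∈ affineSpan ℝ φ, side (x : EuclideanSpace ℝ (Fin n)) y (h x y) w = 0 := by
      intro w hw
      have := inner_eq_of_mem_affineSpan (a := (y : EuclideanSpace ℝ (Fin n)) - (x : EuclideanSpace ℝ (Fin n)))
        (b := inner ℝ ((y : EuclideanSpace ℝ (Fin n)) - (x : EuclideanSpace ℝ (Fin n))) (x : EuclideanSpace ℝ (Fin n))
          + (h x y + dist (x : EuclideanSpace ℝ (Fin n)) y / 2) * dist (x : EuclideanSpace ℝ (Fin n)) y)
        (fun w hw => by
          have := H.side_eq_zero hxy (H.fiber_mem_closure (hφx hw)) (H.fiber_mem_closure (hφy hw))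
          rw [side, real_inner_comm, inner_sub_right] at this
          linarith) hw
      rw [side, real_inner_comm, inner_sub_right, this]; ring
    have h1 := hside u hu
    have h2 := hside v (mem_affineSpan ℝ hv)
    have h3 := side_self_right (x : EuclideanSpace ℝ (Fin n)) y (h x y)
    have h4 := H.side_self_neg hxy
    have h5 := real_inner_le_norm ((y : EuclideanSpace ℝ (Fin n)) - (t • ((x : EuclideanSpace ℝ (Fin n)) - v) + u))
      ((y : EuclideanSpace ℝ (Fin n)) - x)
    have h6 : inner ℝ ((y : EuclideanSpace ℝ (Fin n)) - (t • ((x : EuclideanSpace ℝ (Fin n)) - v) + u))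
        ((y : EuclideanSpace ℝ (Fin n)) - x)
        = side (x : EuclideanSpace ℝ (Fin n)) y (h x y) y
          - t * (side (x : EuclideanSpace ℝ (Fin n)) y (h x y) x - side (x : EuclideanSpace ℝ (Fin n)) y (h x y) v)
          - side (x : EuclideanSpace ℝ (Fin n)) y (h x y) u := by
      simp only [side, inner_sub_left, inner_add_left, real_inner_smul_left]; ring
    rw [h6, h1, h2, h3] at h5
    have hd : dist (x : EuclideanSpace ℝ (Fin n)) y = ‖(y : EuclideanSpace ℝ (Fin n)) - x‖ := by
      rw [dist_comm, dist_eq_norm]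
    have hd0 : 0 < dist (x : EuclideanSpace ℝ (Fin n)) y :=
      dist_pos.2 fun he => hxy.ne (Subtype.ext he)
    rw [← hd] at h5
    refine (hlevel x y hxy).trans (le_of_mul_le_mul_right ?_ hd0)
    nlinarith

/-- One cone construction suffices for cones and edges, two for joins; hence the iterated
`coneRadius`, which is also smaller than the other radii. -/
theorem exists_relBall_of_face (H : Suspendable S G O h p) (hr : 0 < r) (ha : 0 < a)
    (hball : ∀ φ ∈ allSubfaces S, dimension φ ≠ 0 → ∃ c, RelBall c r φ)
    (hapex : ∀ δ ∈ S, ∀ u ∈ affineSpan ℝ δ, a ≤ ‖(p δ : EuclideanSpace ℝ (Fin n)) - u‖)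
    (hseg : ∀ δ ∈ S, ∀ y, G.graph.Adj (p δ) y → ∀ z ∈ segment ℝ (p δ : EuclideanSpace ℝ (Fin n)) y,
      ∀ u ∈ affineSpan ℝ δ, a ≤ ‖z - u‖)
    (hdiam : ∀ δ ∈ S, ∀ u ∈ δ, ‖(p δ : EuclideanSpace ℝ (Fin n)) - u‖ ≤ R)
    (hR : 0 ≤ R) (hedge : ∀ x y : G.T, G.graph.Adj x y → dist (x : EuclideanSpace ℝ (Fin n)) y ≤ R)
    (hlevel : ∀ x y : G.T, G.graph.Adj x y → a ≤ dist (x : EuclideanSpace ℝ (Fin n)) y / 2 - h x y)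
    (hF : Face S G p F) (hdim : dimension F ≠ 0) :
    ∃ c, RelBall c (coneRadius (coneRadius r a R) a R) F := by
  have hr1 := coneRadius_pos hr ha hR
  have hle1 := coneRadius_le hr.le ha hR
  have hle2 := coneRadius_le hr1.le ha hR
  have hball' : ∀ φ ∈ allSubfaces S, ∃ c, RelBall c r φ := by
    intro F hF
    by_cases h0 : dimension F = 0
    · obtain ⟨δ, hδ, hFδ⟩ := mem_iUnion₂.1 hF
      obtain ⟨x, hx⟩ := hFδ.1
      exact ⟨x, relBall_of_dimension_eq_zero h0 hx r⟩
    · exact hball F hF h0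
  have hcone : ∀ δ ∈ S, ∀ φ ∈ subfaces δ, ∀ c, RelBall c r φ →
      RelBall (midpoint ℝ c (p δ : EuclideanSpace ℝ (Fin n))) (coneRadius r a R)
        (convexHull ℝ (insert (p δ : EuclideanSpace ℝ (Fin n)) φ)) := fun δ hδ φ hφ c hc =>
    hc.cone hr ha (fun u hu => hapex δ hδ u (affineSpan_mono ℝ hφ.2.subset hu))
      (hdiam δ hδ c (hφ.2.subset (hc.mem hr.le)))
  cases hF with
  | base φ hφ =>
    obtain ⟨c, hc⟩ := hball F hφ hdim
    exact ⟨c, hc.mono (hle2.trans hle1)⟩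
  | apex x =>
    refine absurd ?_ hdim
    rw [dimension, direction_affineSpan, vectorSpan_singleton]
    exact finrank_bot ℝ _
  | cone x φ δ hδ hx hφ =>
    subst hx
    obtain ⟨c, hc⟩ := hball' φ (mem_allSubfaces hδ hφ)
    rw [union_singleton]
    exact ⟨_, (hcone δ hδ φ hφ c hc).mono hle2⟩
  | edge x y hxy =>
    have hx : RelBall (x : EuclideanSpace ℝ (Fin n)) r {(x : EuclideanSpace ℝ (Fin n))} := by
      refine ⟨mem_affineSpan ℝ rfl, fun q hq => ?_⟩
      have := hq.2
      rwa [SetLike.mem_coe, AffineSubspace.mem_affineSpan_singleton] at this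
    -- Added to its mirror image, where `h` cancels by anticommutativity, this gives an edge length
    -- of at least `2 * a`.
    have h1 := hlevel x y hxy
    have h2 := hlevel y x hxy.symm
    rw [H.anti y x, dist_comm] at h2
    have := hx.cone (x := (y : EuclideanSpace ℝ (Fin n))) hr ha (R := R) (fun u hu => by
      rw [AffineSubspace.mem_affineSpan_singleton] at hu
      rw [hu, ← dist_eq_norm, dist_comm]; linarith) (by
      rw [← dist_eq_norm, dist_comm]; exact hedge x y hxy)
    rw [pair_comm] at this
    exact ⟨_, this.mono hle2⟩
  | join x y hxy φ α β hα hx hβ hy hφα hφβ =>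
    subst hx hy
    obtain ⟨c, hc⟩ := hball' φ (mem_allSubfaces hα hφα)
    have h1 := hcone α hα φ hφα c hc
    have hcφ := hc.mem hr.le
    -- The join is the cone of apex `p β` over the cone of apex `p α`.
    have h2 := h1.cone (x := (p β : EuclideanSpace ℝ (Fin n))) hr1 ha (R := R) (fun q hq => by
      rw [affineSpan_convexHull] at hq
      exact H.le_norm_sub_of_mem_affineSpan_insert hxy hφα.1
        (hφα.2.subset.trans (mem_fiberUnion hα rfl)) (hφβ.trans (mem_fiberUnion hβ rfl)) hlevel
        (fun z hz u hu => hseg α hα _ hxy z hz u (affineSpan_mono ℝ hφα.2.subset hu)) hq) (by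
      have e1 := hdiam β hβ c (hφβ hcφ)
      have e2 := hedge _ _ hxy
      rw [dist_comm, dist_eq_norm] at e2
      have e3 : (p β : EuclideanSpace ℝ (Fin n)) - midpoint ℝ c (p α : EuclideanSpace ℝ (Fin n))
          = (1 / 2 : ℝ) • ((p β : EuclideanSpace ℝ (Fin n)) - c)
            + (1 / 2 : ℝ) • ((p β : EuclideanSpace ℝ (Fin n)) - p α) := by
        rw [midpoint_eq_smul_add, invOf_eq_inv]; module
      rw [e3]
      refine (norm_add_le _ _).trans ?_
      rw [norm_smul, norm_smul, Real.norm_eq_abs, abs_of_pos (by norm_num : (0:ℝ) < 1 / 2)]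
      linarith)
    have e : convexHull ℝ (φ ∪ {(p α : EuclideanSpace ℝ (Fin n)), (p β : EuclideanSpace ℝ (Fin n))})
        = convexHull ℝ (insert (p β : EuclideanSpace ℝ (Fin n))
          (convexHull ℝ (insert (p α : EuclideanSpace ℝ (Fin n)) φ))) := by
      rw [insert_eq (p β : EuclideanSpace ℝ (Fin n)) (convexHull ℝ _), union_comm _ (convexHull ℝ _),
        convexHull_convexHull_union]
      congr 1
      ext q
      simp only [mem_union, mem_insert_iff, mem_singleton_iff]
      tauto
    rw [e]
    exact ⟨_, h2⟩

end Suspendable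

end TubularSuspension

end

/-! ### Normals, and the distance from the edges to the hyperplanes of the polyhedra. -/

section

open Set Metric Topology

namespace TubularSuspension

variable {n k : ℕ} {S : Set (Set (EuclideanSpace ℝ (Fin n)))} {O : Set (EuclideanSpace ℝ (Fin n))}
  {A δ : Set (EuclideanSpace ℝ (Fin n))} {w z ν : EuclideanSpace ℝ (Fin n)} {c : ℝ}

theorem exists_normal (hn : 1 ≤ n) (hne : A.Nonempty) (hA : dimension A = n - 1) :
    ∃ (ν : EuclideanSpace ℝ (Fin n)) (c : ℝ), ‖ν‖ = 1 ∧
      ∀ v, v ∈ affineSpan ℝ A ↔ inner ℝ ν v = c := by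
  obtain ⟨q, hq⟩ := hne
  set D := (affineSpan ℝ A).direction with hD
  have hfin : Module.finrank ℝ D = n - 1 := hA
  have hsum := D.finrank_add_finrank_orthogonal
  rw [finrank_euclideanSpace_fin] at hsum
  have hbot : Dᗮ ≠ ⊥ := fun h0 => by
    rw [h0, finrank_bot] at hsum; omega
  obtain ⟨μ, hμ, hμ0⟩ := Submodule.exists_mem_ne_zero_of_ne_bot hbot
  set ν := (‖μ‖⁻¹ : ℝ) • μ with hν
  have hν1 : ‖ν‖ = 1 := norm_smul_inv_norm hμ0
  have hνD : ν ∈ Dᗮ := Submodule.smul_mem _ _ hμ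
  have hle : D ≤ (Submodule.span ℝ {ν})ᗮ := fun v hv =>
    Submodule.mem_orthogonal_singleton_iff_inner_right.2
      ((Submodule.mem_orthogonal' D ν).1 hνD v hv)
  have hν0 : ν ≠ 0 := fun h0 => by rw [h0, norm_zero] at hν1; exact zero_ne_one hν1
  have hsum' := (Submodule.span ℝ {ν}).finrank_add_finrank_orthogonal
  rw [finrank_span_singleton hν0, finrank_euclideanSpace_fin] at hsum'
  have heq : D = (Submodule.span ℝ {ν})ᗮ := Submodule.eq_of_le_of_finrank_eq hle (by omega)
  refine ⟨ν, inner ℝ ν q, hν1, fun v => ?_⟩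
  rw [← AffineSubspace.vsub_right_mem_direction_iff_mem (mem_affineSpan ℝ hq), ← hD, heq,
    Submodule.mem_orthogonal_singleton_iff_inner_right, vsub_eq_sub, inner_sub_right, sub_eq_zero]

/-- Near a relative interior point of `δ` the union of the complex is `δ`, which fills its affine
hull there. -/
theorem IsComplex.exists_ball_subset (hS : IsComplex k S) (hδ : δ ∈ S)
    (hw : w ∈ intrinsicInterior ℝ δ) :
    ∃ r > 0, ball w r ∩ ⋃₀ S ⊆ δ ∧ ball w r ∩ affineSpan ℝ δ ⊆ δ := by
  have hclosed : IsClosed (⋃₀ (S \ {δ})) := by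
    rw [sUnion_eq_biUnion]
    exact (hS.1.subset sdiff_subset).isClosed_biUnion fun α hα =>
      (hS.isPolyhedron hα.1).2.1.isClosed
  have hnot : w ∉ ⋃₀ (S \ {δ}) := fun ⟨α, hα, hwα⟩ =>
    hα.2 (hS.eq_of_mem_intrinsicInterior hα.1 hδ hwα hw)
  obtain ⟨r₁, hr₁, h1⟩ := Metric.isOpen_iff.1 hclosed.isOpen_compl w hnot
  obtain ⟨-, r₂, hr₂, h2⟩ := mem_intrinsicInterior_iff_closedBall.1 hw
  refine ⟨min r₁ r₂, lt_min hr₁ hr₂, ?_, ?_⟩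
  · rintro q ⟨hq, α, hα, hqα⟩
    by_contra hqδ
    exact h1 (ball_subset_ball (min_le_left _ _) hq) ⟨α, ⟨hα, fun he => hqδ (he ▸ hqα)⟩, hqα⟩
  · exact fun q hq => h2 ⟨ball_subset_closedBall (ball_subset_ball (min_le_right _ _) hq.1), hq.2⟩

theorem isUnitNormal_of_mem_intrinsicInterior (hS : IsComplex k S) (hO : frontier O = ⋃₀ S)
    (hδ : δ ∈ S) (hw : w ∈ intrinsicInterior ℝ δ) (hν : ‖ν‖ = 1)
    (haff : ∀ v, v ∈ affineSpan ℝ δ ↔ inner ℝ ν v = c) : IsUnitNormal O w ν := by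
  have hwδ := intrinsicInterior_subset hw
  obtain ⟨r, hr, hr1, hr2⟩ := hS.exists_ball_subset hδ hw
  have hwc := (haff w).1 (subset_affineSpan ℝ _ hwδ)
  refine ⟨by rw [hO]; exact ⟨δ, hδ, hwδ⟩, hν, Subset.antisymm (fun v hv => ?_) fun v hv => ?_⟩
  · have hconst : ∀ᶠ q in 𝓝[frontier O] w, innerSL ℝ ν q = innerSL ℝ ν w := by
      filter_upwards [self_mem_nhdsWithin, mem_nhdsWithin_of_mem_nhds (ball_mem_nhds w hr)]
        with q hq hqr
      rw [hO] at hq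
      rw [innerSL_apply_apply, innerSL_apply_apply, hwc]
      exact (haff q).1 (subset_affineSpan ℝ _ (hr1 ⟨hqr, hq⟩))
    have hmax : IsLocalMaxOn (innerSL ℝ ν) (frontier O) w := hconst.mono fun q hq => hq.le
    have hmin : IsLocalMinOn (innerSL ℝ ν) (frontier O) w := hconst.mono fun q hq => hq.ge
    exact le_antisymm
      (hmax.hasFDerivWithinAt_nonpos (innerSL ℝ ν).hasFDerivWithinAt hv)
      (hmin.hasFDerivWithinAt_nonneg (innerSL ℝ ν).hasFDerivWithinAt hv)
  · refine mem_posTangentConeAt_of_frequently_mem (Filter.Eventually.frequently ?_)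
    have hcont : Continuous fun t : ℝ => w + t • v := by fun_prop
    have h0 : Filter.Tendsto (fun t : ℝ => w + t • v) (𝓝[>] 0) (𝓝 w) := by
      have := hcont.tendsto 0
      rw [zero_smul, add_zero] at this
      exact this.mono_left nhdsWithin_le_nhds
    filter_upwards [h0.eventually (ball_mem_nhds w hr)] with t ht
    rw [hO]
    refine ⟨δ, hδ, hr2 ⟨ht, (haff _).2 ?_⟩⟩
    have hv' : inner ℝ ν v = 0 := hv
    rw [inner_add_right, real_inner_smul_right, hv', mul_zero, add_zero, hwc]

/-- The distance from `z` to the hyperplane of `δ` is `|⟨ν, w - z⟩|`, which is at least `η * ‖w -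
z‖`. -/
theorem le_norm_sub_of_normal (hS : IsComplex (n - 1) S) (hn : 1 ≤ n) (hO : frontier O = ⋃₀ S)
    (hδ : δ ∈ S) (hw : w ∈ intrinsicInterior ℝ δ) {η β : ℝ} (hβ : 0 < β) (hη : 0 ≤ η)
    (hwz : β ≤ ‖w - z‖)
    (hnormal : ∀ ν, IsUnitNormal O w ν → η ≤ |inner ℝ ν (w - z)| / ‖w - z‖)
    {u : EuclideanSpace ℝ (Fin n)} (hu : u ∈ affineSpan ℝ δ) : η * β ≤ ‖z - u‖ := by
  obtain ⟨ν, c, hν, haff⟩ := exists_normal hn (hS.isPolyhedron hδ).1 (hS.2.1 δ hδ).2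
  have h1 := hnormal ν (isUnitNormal_of_mem_intrinsicInterior hS hO hδ hw hν haff)
  rw [le_div_iff₀ (hβ.trans_le hwz)] at h1
  have h2 : inner ℝ ν (w - z) = inner ℝ ν (u - z) := by
    rw [inner_sub_right, inner_sub_right,
      (haff w).1 (subset_affineSpan ℝ _ (intrinsicInterior_subset hw)), (haff u).1 hu]
  have h3 := abs_real_inner_le_norm ν (u - z)
  rw [hν, one_mul, ← h2, norm_sub_rev] at h3
  exact (mul_le_mul_of_nonneg_left hwz hη).trans (h1.trans h3)

variable {G : EuclideanGraph n} {f g h : G.T → G.T → ℝ} {x y : G.T}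

theorem eta_le_of_card (hcard : G.T.card ≠ 1) (hh : h ∈ cuts f g) (hxy : G.graph.Adj x y)
    (hz : z ∈ segment ℝ (x : EuclideanSpace ℝ (Fin n)) y) (hw : w ∈ wall G O h x y)
    (hν : IsUnitNormal O w ν) : eta G O f g ≤ |inner ℝ ν (w - z)| / ‖w - z‖ := by
  rw [eta, if_neg hcard]
  refine csInf_le ?_ ?_
  rotate_left
  · exact ⟨h, hh, x, y, hxy, z, hz, w, hw, ν, hν, rfl⟩
  refine ⟨0, ?_⟩
  rintro _ ⟨h, -, x, y, -, z, -, t, -, ν, -, rfl⟩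
  positivity

theorem eta_le_of_card_eq (hcard : G.T.card = 1) (hν : IsUnitNormal O w ν) :
    eta G O f g ≤ |inner ℝ ν (w - x)| / ‖w - x‖ := by
  rw [eta, if_pos hcard]
  refine csInf_le ?_ ?_
  rotate_left
  · exact ⟨x, w, ν, hν, rfl⟩
  refine ⟨0, ?_⟩
  rintro _ ⟨x, t, ν, -, rfl⟩
  positivity

theorem betaMinus_le_of_card (hcard : G.T.card ≠ 1) (hh : h ∈ cuts f g) (hxy : G.graph.Adj x y)
    (hz : z ∈ segment ℝ (x : EuclideanSpace ℝ (Fin n)) y) (hw : w ∈ wall G O h x y) :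
    betaMinus G O f g ≤ ‖w - z‖ := by
  rw [betaMinus, if_neg hcard, ← dist_eq_norm, dist_comm]
  refine le_trans (csInf_le ?_ ?_) (infDist_le_dist_of_mem hw)
  rotate_left
  · exact ⟨h, hh, x, y, hxy, z, hz, rfl⟩
  refine ⟨0, ?_⟩
  rintro _ ⟨h, -, x, y, -, z, -, rfl⟩
  exact infDist_nonneg

theorem betaMinus_le_of_card_eq (hcard : G.T.card = 1) (hw : w ∈ frontier O) :
    betaMinus G O f g ≤ ‖w - x‖ := by
  rw [betaMinus, if_pos hcard, ← dist_eq_norm, dist_comm]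
  refine le_trans (csInf_le ?_ ?_) (infDist_le_dist_of_mem hw)
  rotate_left
  · exact ⟨x, rfl⟩
  refine ⟨0, ?_⟩
  rintro _ ⟨x, rfl⟩
  exact infDist_nonneg

theorem isBounded_graph : Bornology.IsBounded (convexHull ℝ (G.T : Set (EuclideanSpace ℝ (Fin n)))) :=
  G.T.finite_toSet.isCompact_convexHull ℝ |>.isBounded

theorem le_betaPlus_of_card (hcard : G.T.card ≠ 1) (hO : Bornology.IsBounded O) (hh : h ∈ cuts f g)
    (hxy : G.graph.Adj x y) (hw : w ∈ wall G O h x y) :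
    ‖(x : EuclideanSpace ℝ (Fin n)) - w‖ ≤ betaPlus G O f g := by
  rw [betaPlus, if_neg hcard, ← dist_eq_norm]
  obtain ⟨R, hR⟩ := (isBounded_graph (G := G)).subset_closedBall 0
  obtain ⟨R', hR'⟩ := hO.closure.subset_closedBall 0
  refine le_csSup ⟨R + R', ?_⟩ ⟨h, hh, x, y, hxy, x, left_mem_segment ℝ _ _, w, hw, rfl⟩
  rintro _ ⟨h, -, x, y, -, z, hz, t, ht, rfl⟩
  have h1 := hR (segment_subset_convexHull (s := (G.T : Set (EuclideanSpace ℝ (Fin n)))) x.2 y.2 hz)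
  have h2 := hR' (frontier_subset_closure ht.1)
  rw [mem_closedBall] at h1 h2
  exact (dist_triangle_right z t 0).trans (add_le_add h1 h2)

theorem le_betaPlus_of_card_eq (hcard : G.T.card = 1) (hO : Bornology.IsBounded O)
    (hw : w ∈ frontier O) : ‖(x : EuclideanSpace ℝ (Fin n)) - w‖ ≤ betaPlus G O f g := by
  rw [betaPlus, if_pos hcard, ← dist_eq_norm]
  obtain ⟨R, hR⟩ := (isBounded_graph (G := G)).subset_closedBall 0
  obtain ⟨R', hR'⟩ := hO.closure.subset_closedBall 0
  refine le_csSup ⟨R + R', ?_⟩ ⟨x, w, hw, rfl⟩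
  rintro _ ⟨x, t, ht, rfl⟩
  have h1 := hR (subset_convexHull ℝ _ x.2)
  have h2 := hR' (frontier_subset_closure ht)
  rw [mem_closedBall] at h1 h2
  exact (dist_triangle_right _ t 0).trans (add_le_add h1 h2)

theorem le_alphaPlus (hcard : G.T.card ≠ 1) (hxy : G.graph.Adj x y) :
    dist (x : EuclideanSpace ℝ (Fin n)) y ≤ alphaPlus G O f g := by
  rw [alphaPlus, if_neg hcard]
  obtain ⟨R, hR⟩ := (isBounded_graph (G := G)).subset_closedBall 0
  rw [← Subtype.dist_eq]
  refine le_csSup ?_ ?_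
  rotate_left
  · exact ⟨x, y, hxy, rfl⟩
  refine ⟨R + R, ?_⟩
  rintro _ ⟨x, y, -, rfl⟩
  rw [Subtype.dist_eq]
  have h1 := hR (subset_convexHull ℝ _ x.2)
  have h2 := hR (subset_convexHull ℝ _ y.2)
  rw [mem_closedBall] at h1 h2
  exact (dist_triangle_right _ _ 0).trans (add_le_add h1 h2)

end TubularSuspension

end

/-! ### Moving the cuts of a tubular complex. -/

section

open Set Metric Topology

namespace TubularSuspension

/-- A tubular complex on a graph with an edge; `a` bounds from below the distance of the edges to
the hyperplanes spanned by the polyhedra. -/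
structure TubularSystem {n : ℕ} (S : Set (Set (EuclideanSpace ℝ (Fin n)))) (G : EuclideanGraph n)
    (O : Set (EuclideanSpace ℝ (Fin n))) (f g : G.T → G.T → ℝ) (a : ℝ) : Prop where
  one_le : 1 ≤ n
  isComplex : IsComplex (n - 1) S
  frontier_eq : frontier O = ⋃₀ S
  cliqueFree : G.graph.CliqueFree 3
  mem : ∀ x : G.T, (x : EuclideanSpace ℝ (Fin n)) ∈ O
  anti_left : Anticommutative f
  anti_right : Anticommutative g
  bound : ∀ h ∈ cuts f g, ∀ x y : G.T, G.graph.Adj x y →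
    |h x y| < dist (x : EuclideanSpace ℝ (Fin n)) y / 2
  good : ∀ h ∈ cuts f g, IsComplex (n - 1) (cutComplex S G O h) ∧
      ∃ p, IsCellChoice S G O h p ∧
        ComplexSimpleOcclusion (cutComplex S G O h) G p ∧
        SeparatingFamily (cutComplex S G O h) G p (cell G O h) ∧
        TotalOcclusion (cutComplex S G O h) G p O (cell G O h)
  exists_adj : ∀ x : G.T, ∃ y, G.graph.Adj x y
  pos : 0 < a
  transversal : ∀ h ∈ cuts f g, ∀ x y : G.T, G.graph.Adj x y → ∀ δ ∈ S,
    ∀ t ∈ intrinsicInterior ℝ δ, t ∈ closure (cell G O h x) →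
    ∀ z ∈ segment ℝ (x : EuclideanSpace ℝ (Fin n)) y, ∀ u ∈ affineSpan ℝ δ, a ≤ ‖z - u‖

variable {n : ℕ} {S : Set (Set (EuclideanSpace ℝ (Fin n)))} {G : EuclideanGraph n}
  {O : Set (EuclideanSpace ℝ (Fin n))} {f g h : G.T → G.T → ℝ} {a s : ℝ} {x y z w : G.T}
  {q t u v : EuclideanSpace ℝ (Fin n)} {δ : Set (EuclideanSpace ℝ (Fin n))}

open Classical in
/-- The cut between `x` and `y` is moved towards `x` by `s`. -/
noncomputable def shift (h : G.T → G.T → ℝ) (x y : G.T) (s : ℝ) : G.T → G.T → ℝ := fun a b =>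
  if a = x ∧ b = y then h a b - s else if a = y ∧ b = x then h a b + s else h a b

theorem shift_left (h : G.T → G.T → ℝ) (x y : G.T) (s : ℝ) : shift h x y s x y = h x y - s :=
  if_pos ⟨rfl, rfl⟩

theorem shift_right (hxy : x ≠ y) : shift h x y s y x = h y x + s := by
  rw [shift, if_neg fun hc => hxy hc.2, if_pos ⟨rfl, rfl⟩]

theorem shift_of_ne (h1 : z ≠ x ∨ w ≠ y) (h2 : z ≠ y ∨ w ≠ x) : shift h x y s z w = h z w := by
  rw [shift, if_neg (by tauto), if_neg (by tauto)]

theorem shift_mem_cuts (hf : Anticommutative f) (hg : Anticommutative g) (hh : h ∈ cuts f g)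
    (hxy : x ≠ y) (h1 : min (f x y) (g x y) ≤ h x y - s) (h2 : h x y - s ≤ max (f x y) (g x y)) :
    shift h x y s ∈ cuts f g := by
  have hyx : h y x + s = -(h x y - s) := by rw [hh.1 y x]; ring
  refine ⟨fun b c => ?_, fun b c => ?_⟩
  · by_cases hb : b = x ∧ c = y
    · obtain ⟨rfl, rfl⟩ := hb
      rw [shift_left, shift_right hxy, hyx, neg_neg]
    by_cases hb' : b = y ∧ c = x
    · obtain ⟨rfl, rfl⟩ := hb'
      rw [shift_left, shift_right hxy, hyx]
    · rw [shift_of_ne (by tauto) (by tauto), shift_of_ne (by tauto) (by tauto), hh.1 b c]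
  · by_cases hb : b = x ∧ c = y
    · obtain ⟨rfl, rfl⟩ := hb
      rw [shift_left]; exact ⟨h1, h2⟩
    by_cases hb' : b = y ∧ c = x
    · obtain ⟨rfl, rfl⟩ := hb'
      rw [shift_right hxy, hyx, hf b c, hg b c, min_neg_neg, max_neg_neg]
      exact ⟨neg_le_neg h2, neg_le_neg h1⟩
    · rw [shift_of_ne (by tauto) (by tauto)]; exact hh.2 b c

theorem cell_shift_of_ne (hx : z ≠ x) (hy : z ≠ y) : cell G O (shift h x y s) z = cell G O h z :=
  cell_congr fun _ _ => shift_of_ne (Or.inl hx) (Or.inl hy)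

namespace TubularSystem

variable (T : TubularSystem S G O f g a) (hh : h ∈ cuts f g)
include T hh

theorem self_mem_cell (x : G.T) : (x : EuclideanSpace ℝ (Fin n)) ∈ cell G O h x :=
  TubularSuspension.self_mem_cell (T.mem x) (T.bound h hh x)

theorem isOpen : IsOpen O := (T.good h hh).2.choose_spec.2.2.2.2.1

theorem starConvex (x : G.T) : StarConvex ℝ (x : EuclideanSpace ℝ (Fin n)) (cell G O h x) :=
  (T.good h hh).2.choose_spec.2.2.1.2.2.1 x

theorem disjoint_cell (hxy : x ≠ y) : Disjoint (cell G O h x) (closure (cell G O h y)) :=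
  ((T.good h hh).2.choose_spec.2.2.1.2.1 x y hxy).closure_right (isOpen_cell (T.isOpen hh))

theorem exists_closure (hq : q ∈ closure O) : ∃ w, q ∈ closure (cell G O h w) := by
  rw [(T.good h hh).2.choose_spec.2.2.2.2.2.2.2.1] at hq
  exact mem_iUnion.1 hq

theorem adj_of_closure (hxy : x ≠ y) (hx : q ∈ closure (cell G O h x))
    (hy : q ∈ closure (cell G O h y)) : G.graph.Adj x y := by
  by_contra hcon
  rcases (T.good h hh).2.choose_spec.2.2.2.2.2.2.2.2 x y hcon with he | hd
  · exact hxy he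
  · exact disjoint_left.1 hd hx hy

theorem side_self_neg (hxy : G.graph.Adj x y) :
    side (x : EuclideanSpace ℝ (Fin n)) y (h x y) x < 0 := by
  rw [← mem_halfSpace_iff]
  exact mem_halfSpace_iff.2 ((cell_subset (T.self_mem_cell hh x)).2 y hxy)

omit T in
theorem side_comm (x y : G.T) (q : EuclideanSpace ℝ (Fin n)) :
    side (y : EuclideanSpace ℝ (Fin n)) x (h y x) q
      = -side (x : EuclideanSpace ℝ (Fin n)) y (h x y) q := by
  rw [hh.1 y x, TubularSuspension.side_swap]

/-- After the cut has passed `q`, this point must still be in some closed cell: not that of `x`, for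
it is on the wrong side, nor that of a third vertex, whose cell has not changed. -/
theorem mem_closure_cell_shift (hh' : shift h x z s ∈ cuts f g) (hxz : G.graph.Adj x z)
    (hq : q ∈ cell G O h x) (hside : 0 < side (x : EuclideanSpace ℝ (Fin n)) z (h x z - s) q) :
    q ∈ closure (cell G O (shift h x z s) z) := by
  obtain ⟨w, hw⟩ := T.exists_closure hh' (subset_closure (cell_subset hq).1)
  rcases eq_or_ne w x with rfl | hwx
  · have := closure_cell_subset_closedSector hw z hxz
    rw [shift_left] at this
    exact absurd this (not_le.2 hside)
  rcases eq_or_ne w z with rfl | hwz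
  · exact hw
  · rw [cell_shift_of_ne hwx hwz] at hw
    exact absurd hw (disjoint_left.1 (T.disjoint_cell hh hwx.symm) hq)

/-- A point of a closed cell cannot be close to two of the cutting hyperplanes. -/
theorem not_close_of_adj_adj (hxy : G.graph.Adj x y) (hxz : G.graph.Adj x z) (hyz : y ≠ z)
    (hs : 0 ≤ s) (hsy : min (f x y) (g x y) ≤ h x y - s) (hsz : min (f x z) (g x z) ≤ h x z - s)
    (ht : t ∈ closure (cell G O h x))
    (hty : 0 < side (x : EuclideanSpace ℝ (Fin n)) y (h x y - s) t)
    (htz : 0 < side (x : EuclideanSpace ℝ (Fin n)) z (h x z - s) t) : False := by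
  -- The conditions are open, so `t` may be replaced by a point of the cell itself.
  obtain ⟨q, ⟨hqy, hqz⟩, hq⟩ := mem_closure_iff.1 ht
    ({q | 0 < side (x : EuclideanSpace ℝ (Fin n)) y (h x y - s) q} ∩
      {q | 0 < side (x : EuclideanSpace ℝ (Fin n)) z (h x z - s) q})
    ((isOpen_lt continuous_const (continuous_side _ _ _)).inter
      (isOpen_lt continuous_const (continuous_side _ _ _))) ⟨hty, htz⟩
  have hcy := shift_mem_cuts T.anti_left T.anti_right hh hxy.ne hsy
    ((sub_le_self _ hs).trans (hh.2 x y).2)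
  have hcz := shift_mem_cuts T.anti_left T.anti_right hh hxz.ne hsz
    ((sub_le_self _ hs).trans (hh.2 x z).2)
  have hval : shift h x y s x z = h x z := shift_of_ne (Or.inr hyz.symm) (Or.inl hxy.ne)
  have hcyz : shift (shift h x y s) x z s ∈ cuts f g :=
    shift_mem_cuts T.anti_left T.anti_right hcy hxz.ne (by rwa [hval])
      (by rw [hval]; exact (sub_le_self _ hs).trans (hh.2 x z).2)
  have h1 := T.mem_closure_cell_shift hh hcy hxy hq hqy
  have h2 := T.mem_closure_cell_shift hh hcz hxz hq hqz
  -- The cell of `y` ignores the cut between `x` and `z`, and that of `z` the cut between `x` and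
  -- `y`: both memberships hold for the doubly shifted cut, which makes `y` and `z` neighbours.
  rw [← cell_shift_of_ne (x := x) (y := z) (s := s) hxy.ne' hyz] at h1
  have h3 : cell G O (shift h x z s) z = cell G O (shift (shift h x y s) x z s) z := by
    refine cell_congr fun b _ => ?_
    by_cases hb : b = x
    · subst hb
      rw [shift_right hxz.ne, shift_right hxz.ne,
        shift_of_ne (Or.inl hxz.ne') (Or.inl hyz.symm)]
    · rw [shift_of_ne (Or.inl hxz.ne') (Or.inr hb), shift_of_ne (Or.inl hxz.ne') (Or.inr hb),
        shift_of_ne (Or.inl hxz.ne') (Or.inl hyz.symm)]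
  rw [h3] at h2
  exact T.cliqueFree {x, y, z} (SimpleGraph.is3Clique_triple_iff.2
    ⟨hxy, hxz, T.adj_of_closure hcyz hyz h1 h2⟩)

/-- Moving the cut towards `x` puts `t` in the closure of an enlarged cell of `y`. Points slightly
closer to `y` are strictly on the side of `y` of the original cut, and the star-shapedness of the
enlarged cell joins their approximations to `y` inside `O`. -/
theorem mem_closure_of_side_eq_zero (hxy : G.graph.Adj x y) (hs : 0 < s)
    (hsy : min (f x y) (g x y) ≤ h x y - s) (ht : t ∈ closure (cell G O h x))
    (h0 : side (x : EuclideanSpace ℝ (Fin n)) y (h x y) t = 0) : t ∈ closure (cell G O h y) := by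
  have hcy := shift_mem_cuts T.anti_left T.anti_right hh hxy.ne hsy
    ((sub_le_self _ hs.le).trans (hh.2 x y).2)
  have hd0 : 0 < dist (x : EuclideanSpace ℝ (Fin n)) y :=
    dist_pos.2 fun he => hxy.ne (Subtype.ext he)
  have htc : t ∈ closure (cell G O (shift h x y s) y) := by
    have hV : IsOpen {q | 0 < side (x : EuclideanSpace ℝ (Fin n)) y (h x y - s) q} :=
      isOpen_lt continuous_const (continuous_side _ _ _)
    refine closure_minimal ?_ isClosed_closure
      (hV.inter_closure ⟨?_, ht⟩ : t ∈ closure (_ ∩ cell G O h x))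
    · rintro q ⟨hq1, hq2⟩
      exact T.mem_closure_cell_shift hh hcy hxy hq2 hq1
    · change 0 < side _ _ _ _
      rw [side_sub _ _ _ _ (h x y), h0, zero_add]
      have : 0 < h x y - (h x y - s) := by linarith
      positivity
  have hstep : ∀ τ : ℝ, 0 < τ → τ < 1 →
      (1 - τ) • t + τ • (y : EuclideanSpace ℝ (Fin n)) ∈ closure (cell G O h y) := by
    intro τ hτ hτ1
    -- The points whose contraction towards `y` is strictly on the side of `y` of the original cut.
    set V := {q | (1 - τ) * side (y : EuclideanSpace ℝ (Fin n)) x (h y x) q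
      + τ * side (y : EuclideanSpace ℝ (Fin n)) x (h y x) y < 0} with hVdef
    have hV : IsOpen V :=
      isOpen_lt (((continuous_side _ _ _).const_mul _).add continuous_const) continuous_const
    have htV : t ∈ V := by
      rw [hVdef, mem_ofPred_eq, side_comm hh x y t, h0, neg_zero, mul_zero, zero_add]
      exact mul_neg_of_pos_of_neg hτ (T.side_self_neg hh hxy.symm)
    have hmap : MapsTo (fun q => (1 - τ) • q + τ • (y : EuclideanSpace ℝ (Fin n)))
        (V ∩ cell G O (shift h x y s) y) (cell G O h y) := by
      rintro q ⟨hqV, hq⟩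
      have hseg : segment ℝ (y : EuclideanSpace ℝ (Fin n))
          ((1 - τ) • q + τ • (y : EuclideanSpace ℝ (Fin n))) ⊆ cell G O h y := by
        have hqq : (1 - τ) • q + τ • (y : EuclideanSpace ℝ (Fin n)) ∈ cell G O (shift h x y s) y := by
          rw [add_comm]
          exact T.starConvex hcy y hq hτ.le (by linarith) (by ring)
        have hsector : (1 - τ) • q + τ • (y : EuclideanSpace ℝ (Fin n)) ∈ sector G h y := by
          intro b hb
          by_cases hbx : b = x
          · subst hbx
            rw [side_combo _ _ _ (by ring)]; exact hqV
          · have := (cell_subset hqq).2 b hb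
            rwa [shift_of_ne (Or.inl hxy.ne') (Or.inr hbx)] at this
        refine subset_cell_of_isPreconnected (convex_segment _ _).isPreconnected
          (subset_inter (fun r hr => ?_) (convex_sector.segment_subset
            (cell_subset (T.self_mem_cell hh y)).2 hsector))
          ⟨y, left_mem_segment ℝ _ _, T.self_mem_cell hh y⟩
        exact (cell_subset ((T.starConvex hcy y).segment_subset hqq hr)).1
      exact hseg (right_mem_segment ℝ _ _)
    have hcl : t ∈ closure (V ∩ cell G O (shift h x y s) y) := hV.inter_closure ⟨htV, htc⟩
    exact map_mem_closure (f := fun q => (1 - τ) • q + τ • (y : EuclideanSpace ℝ (Fin n)))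
      (by fun_prop) hcl hmap
  have htend : Filter.Tendsto (fun τ : ℝ => (1 - τ) • t + τ • (y : EuclideanSpace ℝ (Fin n)))
      (𝓝[>] 0) (𝓝 t) := by
    have h1 : Continuous fun s : ℝ => (1 - s) • t + s • (y : EuclideanSpace ℝ (Fin n)) := by
      fun_prop
    have h2 := h1.tendsto 0
    simp only [sub_zero, one_smul, zero_smul, add_zero] at h2
    exact h2.mono_left nhdsWithin_le_nhds
  refine isClosed_closure.mem_of_tendsto htend ?_
  filter_upwards [Ioo_mem_nhdsGT (zero_lt_one' ℝ)] with τ hτ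
  exact hstep τ hτ.1 hτ.2

/-- Near a point of the relative interior of a polyhedron of the complex, in the closed cell and
strictly inside the half-spaces, the whole polyhedron lies in the closed cell. -/
theorem exists_ball_inter_affineSpan_subset (hδ : δ ∈ S) (hw : q ∈ intrinsicInterior ℝ δ)
    (hq : q ∈ closure (cell G O h x)) (hqs : q ∈ sector G h x) :
    ∃ r > 0, ball q r ∩ affineSpan ℝ δ ⊆ closure (cell G O h x) := by
  obtain ⟨ν, c, hν, haff⟩ := exists_normal T.one_le (T.isComplex.isPolyhedron hδ).1
    (T.isComplex.2.1 δ hδ).2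
  -- The point `x` is at distance at least `a > 0` from the hyperplane of `δ`, so `x` has a definite
  -- side.
  have hxaff : (x : EuclideanSpace ℝ (Fin n)) ∉ affineSpan ℝ δ := fun hx => by
    obtain ⟨y, hxy⟩ := T.exists_adj x
    have := T.transversal h hh x y hxy δ hδ q hw hq x (left_mem_segment ℝ _ _) x hx
    rw [sub_self, norm_zero] at this
    exact absurd T.pos (not_lt.2 this)
  set D : ℝ := inner ℝ ν (x : EuclideanSpace ℝ (Fin n)) - c with hD
  have hD0 : D ≠ 0 := fun h0 => hxaff ((haff _).2 (sub_eq_zero.1 h0))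
  obtain ⟨r₁, hr₁, h1, -⟩ := T.isComplex.exists_ball_subset hδ hw
  obtain ⟨r₂, hr₂, h2⟩ := Metric.isOpen_iff.1 isOpen_sector q hqs
  set r := min r₁ r₂ with hr
  have hr0 : 0 < r := lt_min hr₁ hr₂
  -- The half-ball on the side of `x`: it is convex, avoids the frontier, and contains points of the
  -- segments from `x`, so it lies in the cell.
  set B := ball q r ∩ {v | 0 < D * (inner ℝ ν v - c)} with hB
  have hconv : Convex ℝ B := by
    refine (convex_ball q r).inter ?_
    intro u hu v hv b e hb he hbe
    change 0 < D * (inner ℝ ν (b • u + e • v) - c)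
    have hu : 0 < D * (inner ℝ ν u - c) := hu
    have hv : 0 < D * (inner ℝ ν v - c) := hv
    have e1 : D * (inner ℝ ν (b • u + e • v) - c)
        = b * (D * (inner ℝ ν u - c)) + e * (D * (inner ℝ ν v - c)) := by
      rw [inner_add_right, real_inner_smul_right, real_inner_smul_right]
      linear_combination D * c * hbe
    rw [e1]
    rcases hb.eq_or_lt with rfl | hb
    · rw [zero_add] at hbe; subst hbe; linarith
    · have := mul_pos hb hu
      have := mul_nonneg he hv.le
      linarith
  have hBfr : ∀ v ∈ B, v ∉ frontier O := by
    rintro v ⟨hv, hv'⟩ hvf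
    rw [T.frontier_eq] at hvf
    have := (haff v).1 (subset_affineSpan ℝ _
      (h1 ⟨ball_subset_ball (min_le_left _ _) hv, hvf⟩))
    have hv'' : 0 < D * (inner ℝ ν v - c) := hv'
    rw [this, sub_self, mul_zero] at hv''
    exact lt_irrefl _ hv''
  have happroach : ∀ v ∈ ball q r ∩ affineSpan ℝ δ, ∀ᶠ τ : ℝ in 𝓝[>] 0,
      (1 - τ) • v + τ • (x : EuclideanSpace ℝ (Fin n)) ∈ B := by
    rintro v ⟨hv, hva⟩
    have hcont : Continuous fun τ : ℝ => (1 - τ) • v + τ • (x : EuclideanSpace ℝ (Fin n)) := by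
      fun_prop
    have htend := hcont.tendsto 0
    simp only [sub_zero, one_smul, zero_smul, add_zero] at htend
    filter_upwards [(htend.mono_left nhdsWithin_le_nhds).eventually (isOpen_ball.mem_nhds hv),
      self_mem_nhdsWithin] with τ hτ hτ0
    refine ⟨hτ, ?_⟩
    change 0 < D * (inner ℝ ν _ - c)
    rw [inner_add_right, real_inner_smul_right, real_inner_smul_right, (haff v).1 hva,
      show (1 - τ) * c + τ * inner ℝ ν (x : EuclideanSpace ℝ (Fin n)) - c = τ * D by rw [hD]; ring]
    have : 0 < D * D := mul_self_pos.2 hD0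
    have hτ0 : 0 < τ := hτ0
    nlinarith [mul_pos hτ0 this]
  have hqa : q ∈ ball q r ∩ affineSpan ℝ δ :=
    ⟨mem_ball_self hr0, subset_affineSpan ℝ _ (intrinsicInterior_subset hw)⟩
  have hBcell : B ⊆ cell G O h x := by
    obtain ⟨τ, hτB, hτ⟩ := ((happroach q hqa).and (Ioo_mem_nhdsGT (zero_lt_one' ℝ))).exists
    have hτc : (1 - τ) • q + τ • (x : EuclideanSpace ℝ (Fin n)) ∈ closure (cell G O h x) := by
      rw [add_comm]
      exact starConvex_closure (T.starConvex hh x) hq hτ.1.le (by linarith [hτ.2]) (by ring)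
    have hBsec : B ⊆ sector G h x := fun v hv => h2 (ball_subset_ball (min_le_right _ _) hv.1)
    have hτO : (1 - τ) • q + τ • (x : EuclideanSpace ℝ (Fin n)) ∈ O := by
      by_contra hnot
      exact hBfr _ hτB ⟨closure_cell_subset_closure hτc, fun hi => hnot (interior_subset hi)⟩
    have hBO : B ⊆ O := by
      intro v hv
      by_contra hvO
      obtain ⟨e, he, hef⟩ := exists_mem_frontier_of_isPreconnected hconv.isPreconnected
        ⟨_, hτB, hτO⟩ ⟨v, hv, hvO⟩
      exact hBfr e he hef
    exact subset_cell_of_isPreconnected hconv.isPreconnected (subset_inter hBO hBsec)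
      ⟨_, hτB, mem_cell_of_mem_closure (T.isOpen hh) ⟨hτO, hBsec hτB⟩ hτc⟩
  refine ⟨r, hr0, fun v hv => ?_⟩
  have hcont : Continuous fun τ : ℝ => (1 - τ) • v + τ • (x : EuclideanSpace ℝ (Fin n)) := by
    fun_prop
  have htend := hcont.tendsto 0
  simp only [sub_zero, one_smul, zero_smul, add_zero] at htend
  refine mem_closure_of_tendsto (htend.mono_left nhdsWithin_le_nhds)
    (b := 𝓝[>] (0 : ℝ)) ?_
  filter_upwards [happroach v hv] with τ hτ using hBcell hτ

/-- The part of the relative interior of `δ` in the open sector is convex, hence connected, and its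
intersection with the closed cell is relatively open by `exists_ball_inter_affineSpan_subset`. The
other points of `δ` in the closed sector are limits along segments from `q`. -/
theorem inter_closedSector_subset (hδ : δ ∈ S) (hw : q ∈ intrinsicInterior ℝ δ)
    (hq : q ∈ closure (cell G O h x)) (hqs : q ∈ sector G h x) :
    δ ∩ closedSector G h x ⊆ closure (cell G O h x) := by
  have hδc := (T.isComplex.isPolyhedron hδ).convex
  set Z := intrinsicInterior ℝ δ ∩ sector G h x with hZ
  have hZconv : Convex ℝ Z := by
    intro u hu v hv b e hb he hbe
    rcases hb.eq_or_lt with rfl | hb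
    · rw [zero_add] at hbe; subst hbe
      rw [zero_smul, zero_add, one_smul]; exact hv
    · exact ⟨combo_mem_intrinsicInterior hδc hu.1 (intrinsicInterior_subset hv.1) hb he hbe,
        convex_sector hu.2 hv.2 hb.le he hbe⟩
  have hZsub : Z ⊆ closure (cell G O h x) := by
    by_contra hcon
    obtain ⟨v, hvZ, hv⟩ := not_subset.1 hcon
    obtain ⟨e, heZ, heu, hev⟩ := hZconv.isPreconnected
      (interior (closure (cell G O h x) ∪ Zᶜ)) (closure (cell G O h x))ᶜ isOpen_interior
      isClosed_closure.isOpen_compl (fun e he => by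
        by_cases hec : e ∈ closure (cell G O h x)
        · left
          obtain ⟨r, hr, hsub⟩ := T.exists_ball_inter_affineSpan_subset hh hδ he.1 hec he.2
          refine mem_interior.2 ⟨ball e r, fun e' he' => ?_, isOpen_ball, mem_ball_self hr⟩
          by_cases heZ : e' ∈ Z
          · exact Or.inl (hsub ⟨he', subset_affineSpan ℝ _ (intrinsicInterior_subset heZ.1)⟩)
          · exact Or.inr heZ
        · exact Or.inr hec) ⟨q, ⟨hw, hqs⟩, by
          obtain ⟨r, hr, hsub⟩ := T.exists_ball_inter_affineSpan_subset hh hδ hw hq hqs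
          refine mem_interior.2 ⟨ball q r, fun e' he' => ?_, isOpen_ball, mem_ball_self hr⟩
          by_cases heZ : e' ∈ Z
          · exact Or.inl (hsub ⟨he', subset_affineSpan ℝ _ (intrinsicInterior_subset heZ.1)⟩)
          · exact Or.inr heZ⟩ ⟨v, hvZ, hv⟩
    rcases interior_subset heu with h1 | h1
    · exact hev h1
    · exact h1 heZ
  rintro v ⟨hvδ, hvs⟩
  have hcont : Continuous fun τ : ℝ => τ • q + (1 - τ) • v := by fun_prop
  have htend := hcont.tendsto 0
  simp only [sub_zero, one_smul, zero_smul, zero_add] at htend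
  refine isClosed_closure.mem_of_tendsto (htend.mono_left nhdsWithin_le_nhds)
    (b := 𝓝[>] (0 : ℝ)) ?_
  filter_upwards [Ioo_mem_nhdsGT (zero_lt_one' ℝ)] with τ hτ
  exact hZsub ⟨combo_mem_intrinsicInterior hδc hw hvδ hτ.1 (by linarith [hτ.2]) (by ring),
    combo_mem_sector hqs hvs hτ.1 (by linarith [hτ.2]) (by ring)⟩

end TubularSystem

end TubularSuspension

end

/-! ### The pieces of the polyhedra in the cells, and the covering of the frontier. -/

section

open Set Metric Topology

namespace TubularSuspension

variable {n : ℕ} {S : Set (Set (EuclideanSpace ℝ (Fin n)))} {G : EuclideanGraph n}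
  {O : Set (EuclideanSpace ℝ (Fin n))} {f g h h' : G.T → G.T → ℝ} {a s e : ℝ} {x y z w : G.T}
  {q t u v : EuclideanSpace ℝ (Fin n)} {δ : Set (EuclideanSpace ℝ (Fin n))}

/-- A nonzero functional constant on a hyperplane is a multiple of its normal, so its level set is
the hyperplane itself. -/
theorem mem_of_inner_eq {A : AffineSubspace ℝ (EuclideanSpace ℝ (Fin n))}
    {ν b m : EuclideanSpace ℝ (Fin n)} {c : ℝ} (hν : ‖ν‖ = 1) (haff : ∀ v, v ∈ A ↔ inner ℝ ν v = c)
    (hb : b ≠ 0) (hq : q ∈ A) (hconst : ∀ v ∈ A, inner ℝ b v = inner ℝ b q)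
    (hm : inner ℝ b m = inner ℝ b q) : m ∈ A := by
  have hqc := (haff q).1 hq
  have hνν : inner ℝ ν ν = (1 : ℝ) := by rw [real_inner_self_eq_norm_sq, hν, one_pow]
  have key : ∀ v, inner ℝ b v = inner ℝ ν v * inner ℝ b ν := by
    intro v
    have h1 : q + (v - inner ℝ ν v • ν) ∈ A := (haff _).2 (by
      rw [inner_add_right, inner_sub_right, real_inner_smul_right, hνν, hqc]; ring)
    have h2 := hconst _ h1
    rw [inner_add_right, inner_sub_right, real_inner_smul_right] at h2
    linarith
  have hbν : inner ℝ b ν ≠ 0 := fun h0 => hb (inner_self_eq_zero.1 (by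
    rw [key b, h0, mul_zero]))
  rw [haff, ← hqc]
  rw [key m, key q] at hm
  exact mul_right_cancel₀ hbν hm

theorem exists_segment_side_eq_zero {x y : EuclideanSpace ℝ (Fin n)} {r : ℝ}
    {σ : EuclideanSpace ℝ (Fin n) → ℝ} (hσ : σ = side x y r) {u v : EuclideanSpace ℝ (Fin n)}
    (h1 : σ u ≤ 0) (h2 : 0 < σ v) :
    ∃ α β : ℝ, 0 ≤ α ∧ 0 ≤ β ∧ α + β = 1 ∧ σ (α • u + β • v) = 0 := by
  have h3 : 0 < σ v - σ u := by linarith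
  refine ⟨σ v / (σ v - σ u), -σ u / (σ v - σ u), by positivity,
    div_nonneg (by linarith) h3.le, by field_simp; ring, ?_⟩
  have hab : σ v / (σ v - σ u) + -σ u / (σ v - σ u) = 1 := by field_simp; ring
  have h4 := side_combo x y r hab u v
  rw [← hσ] at h4
  rw [h4]
  field_simp
  ring

theorem affineSpan_inter_eq_of_mem_nhds {A U : Set (EuclideanSpace ℝ (Fin n))} (hA : Convex ℝ A)
    (hq : q ∈ A) (hU : U ∈ 𝓝 q) : affineSpan ℝ (A ∩ U) = affineSpan ℝ A := by
  refine le_antisymm (affineSpan_mono ℝ inter_subset_left) (affineSpan_le.2 fun v hv => ?_)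
  have hcont : Continuous fun τ : ℝ => q + τ • (v - q) := by fun_prop
  have htend := hcont.tendsto 0
  rw [zero_smul, add_zero] at htend
  obtain ⟨τ, hτU, hτ⟩ := (((htend.mono_left nhdsWithin_le_nhds).eventually hU).and
    (Ioo_mem_nhdsGT (zero_lt_one' ℝ))).exists
  have hmem : q + τ • (v - q) ∈ A ∩ U := ⟨hA.homothety_mem hq hv hτ.1.le hτ.2.le, hτU⟩
  have := AffineMap.lineMap_mem (τ⁻¹) (mem_affineSpan ℝ ⟨hq, mem_of_mem_nhds hU⟩ :
    q ∈ affineSpan ℝ (A ∩ U)) (mem_affineSpan ℝ hmem)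
  rw [AffineMap.lineMap_apply, vsub_eq_sub, vadd_eq_add, add_sub_cancel_left, smul_smul,
    inv_mul_cancel₀ hτ.1.ne', one_smul, sub_add_cancel] at this
  exact this

open Classical in
/-- The admissible cuts making the cell of `x` as large as possible. -/
noncomputable def widest (f g : G.T → G.T → ℝ) (x : G.T) : G.T → G.T → ℝ := fun b c =>
  if b = x then max (f b c) (g b c) else if c = x then min (f b c) (g b c) else f b c

theorem widest_self (f g : G.T → G.T → ℝ) (x y : G.T) :
    widest f g x x y = max (f x y) (g x y) := if_pos rfl

theorem widest_mem_cuts (hf : Anticommutative f) (hg : Anticommutative g) (x : G.T) :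
    widest f g x ∈ cuts f g := by
  refine ⟨fun b c => ?_, fun b c => ?_⟩
  · unfold widest
    by_cases hb : b = x <;> by_cases hc : c = x
    · subst hb hc
      have h1 := hf c c
      have h2 := hg c c
      have h3 : f c c = 0 := by linarith
      have h4 : g c c = 0 := by linarith
      simp [h3, h4]
    · rw [if_pos hb, if_neg hc, if_pos hb, hf c b, hg c b, min_neg_neg, neg_neg]
    · rw [if_neg hb, if_pos hc, if_pos hc, hf c b, hg c b, max_neg_neg, neg_neg]
    · rw [if_neg hb, if_neg hc, if_neg hc, if_neg hb]; exact hf b c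
  · unfold widest
    split_ifs
    · exact ⟨min_le_max, le_rfl⟩
    · exact ⟨le_rfl, min_le_max⟩
    · exact ⟨min_le_left _ _, le_max_left _ _⟩

/-- The polyhedra that may contribute to the cell of `x`. -/
def relevant (S : Set (Set (EuclideanSpace ℝ (Fin n)))) (G : EuclideanGraph n)
    (O : Set (EuclideanSpace ℝ (Fin n))) (f g : G.T → G.T → ℝ) (e : ℝ) (x : G.T) :
    Set (Set (EuclideanSpace ℝ (Fin n))) :=
  {δ ∈ S | ∃ q ∈ intrinsicInterior ℝ δ, q ∈ closure (cell G O (widest f g x) x) ∧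
    ∀ y : G.T, G.graph.Adj x y →
      side (x : EuclideanSpace ℝ (Fin n)) y (max (f x y) (g x y) - e) q ≤ 0}

theorem dist_pos_of_adj (hxy : G.graph.Adj x y) : 0 < dist (x : EuclideanSpace ℝ (Fin n)) y :=
  dist_pos.2 fun he => hxy.ne (Subtype.ext he)

theorem side_le_side (x y : EuclideanSpace ℝ (Fin n)) {r r' : ℝ} (hr : r ≤ r')
    (t : EuclideanSpace ℝ (Fin n)) : side x y r' t ≤ side x y r t := by
  rw [side_sub x y t r' r]
  have : 0 ≤ (r' - r) * dist x y := mul_nonneg (sub_nonneg.2 hr) dist_nonneg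
  linarith

namespace TubularSystem

variable (T : TubularSystem S G O f g a) (hh : h ∈ cuts f g)
include T hh

theorem isPolyhedron_piece (hδ : δ ∈ S) (hdim : dimension (δ ∩ closure (cell G O h x)) = n - 1) :
    IsPolyhedron (δ ∩ closure (cell G O h x)) :=
  (T.good h hh).1.isPolyhedron ⟨hdim, δ, hδ, x, rfl⟩

theorem affineSpan_piece (hδ : δ ∈ S) (hdim : dimension (δ ∩ closure (cell G O h x)) = n - 1) :
    affineSpan ℝ (δ ∩ closure (cell G O h x)) = affineSpan ℝ δ :=
  affineSpan_eq_of_dimension_le (T.isPolyhedron_piece hh hδ hdim).1 inter_subset_left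
    (by rw [hdim, (T.isComplex.2.1 δ hδ).2])

/-- A relative interior point of the piece works. If it were on a wall, the whole piece would be,
and the hyperplane of `δ` would be the cutting hyperplane, which meets `[x, y]` against
transversality. -/
theorem exists_mem_sector (hδ : δ ∈ S) (hdim : dimension (δ ∩ closure (cell G O h x)) = n - 1) :
    ∃ q ∈ intrinsicInterior ℝ δ, q ∈ closure (cell G O h x) ∧ q ∈ sector G h x := by
  have hP := T.isPolyhedron_piece hh hδ hdim
  have haff := T.affineSpan_piece hh hδ hdim
  obtain ⟨q, hq⟩ := hP.1.intrinsicInterior hP.convex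
  have hqP := intrinsicInterior_subset hq
  have hqδ := intrinsicInterior_mono_of_affineSpan_eq inter_subset_left haff.ge hq
  refine ⟨q, hqδ, hqP.2, fun y hxy => ?_⟩
  refine lt_of_le_of_ne (closure_cell_subset_closedSector hqP.2 y hxy) fun h0 => ?_
  have hzero : ∀ v ∈ δ ∩ closure (cell G O h x),
      side (x : EuclideanSpace ℝ (Fin n)) y (h x y) v = 0 := by
    intro v hv
    obtain ⟨r, hr, hmem⟩ := exists_prolongation hq hv
    have h1 := closure_cell_subset_closedSector hmem.2 y hxy
    have h2 := closure_cell_subset_closedSector hv.2 y hxy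
    rw [show q + r • (q - v) = (1 + r) • q + (-r) • v by module, side_combo _ _ _ (by ring), h0] at h1
    nlinarith
  have hinner : ∀ v, side (x : EuclideanSpace ℝ (Fin n)) y (h x y) v = 0 ↔
      inner ℝ ((y : EuclideanSpace ℝ (Fin n)) - (x : EuclideanSpace ℝ (Fin n))) v
        = inner ℝ ((y : EuclideanSpace ℝ (Fin n)) - (x : EuclideanSpace ℝ (Fin n))) q := by
    intro v
    have h1 : side (x : EuclideanSpace ℝ (Fin n)) y (h x y) v
        = side (x : EuclideanSpace ℝ (Fin n)) y (h x y) v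
          - side (x : EuclideanSpace ℝ (Fin n)) y (h x y) q := by rw [h0, sub_zero]
    rw [h1, side, side, real_inner_comm, real_inner_comm _ (q - _), inner_sub_right, inner_sub_right,
      sub_eq_zero]
    constructor <;> intro h2 <;> linarith
  obtain ⟨ν, c, hν, hνc⟩ := exists_normal T.one_le (T.isComplex.isPolyhedron hδ).1
    (T.isComplex.2.1 δ hδ).2
  obtain ⟨α, β, hα, hβ, hαβ, hm⟩ := exists_segment_side_eq_zero
    (σ := side (x : EuclideanSpace ℝ (Fin n)) y (h x y)) rfl (T.side_self_neg hh hxy).le (v := y) (by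
      have := T.side_self_neg hh hxy.symm
      rw [side_comm hh x y] at this
      linarith)
  have hmem := mem_of_inner_eq hν hνc (sub_ne_zero.2 fun he => hxy.ne' (Subtype.ext he))
    (subset_affineSpan ℝ _ (intrinsicInterior_subset hqδ))
    (fun v hv => inner_eq_of_mem_affineSpan (fun v hv => (hinner v).1 (hzero v hv))
      (haff ▸ hv)) ((hinner _).1 hm)
  have := T.transversal h hh x y hxy δ hδ q hqδ hqP.2 _ ⟨α, β, hα, hβ, hαβ, rfl⟩ _ hmem
  rw [sub_self, norm_zero] at this
  exact absurd T.pos (not_lt.2 this)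

/-- Replaces the connected component in the definition of a cell by linear inequalities, so that the
lemmas on polyhedra cut by half-spaces apply. -/
theorem piece_eq (hδ : δ ∈ S) (hdim : dimension (δ ∩ closure (cell G O h x)) = n - 1) :
    δ ∩ closure (cell G O h x) = δ ∩ closedSector G h x := by
  obtain ⟨q, hq, hqc, hqs⟩ := T.exists_mem_sector hh hδ hdim
  exact Subset.antisymm (inter_subset_inter_right _ closure_cell_subset_closedSector)
    (subset_inter inter_subset_left (T.inter_closedSector_subset hh hδ hq hqc hqs))

theorem piece_mem_cutComplex (hδ : δ ∈ S) (hq : q ∈ intrinsicInterior ℝ δ)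
    (hqc : q ∈ closure (cell G O h x)) (hqs : q ∈ sector G h x) :
    δ ∩ closure (cell G O h x) ∈ cutComplex S G O h := by
  refine ⟨?_, δ, hδ, x, rfl⟩
  have h1 : δ ∩ sector G h x ⊆ δ ∩ closure (cell G O h x) := subset_inter inter_subset_left
    ((inter_subset_inter_right _ sector_subset_closedSector).trans
      (T.inter_closedSector_subset hh hδ hq hqc hqs))
  have h2 := affineSpan_inter_eq_of_mem_nhds (T.isComplex.isPolyhedron hδ).convex
    (intrinsicInterior_subset hq) (isOpen_sector.mem_nhds hqs)
  have h3 : affineSpan ℝ (δ ∩ closure (cell G O h x)) = affineSpan ℝ δ :=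
    le_antisymm (affineSpan_mono ℝ inter_subset_left) (h2 ▸ affineSpan_mono ℝ h1)
  rw [dimension, h3]
  exact (T.isComplex.2.1 δ hδ).2

-- The relevant polyhedra do not depend on `h`: the vertices to avoid are known before the cut is
-- chosen.
omit T in
theorem mem_relevant (hδ : δ ∈ S) (hq : q ∈ intrinsicInterior ℝ δ)
    (hqc : q ∈ closure (cell G O h x)) (hroom : ∀ y, G.graph.Adj x y → h x y + e ≤ max (f x y) (g x y)) :
    δ ∈ relevant S G O f g e x := by
  refine ⟨hδ, q, hq, closure_mono (cell_mono fun y hy => ?_) hqc, fun y hy => ?_⟩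
  · rw [widest_self]; exact (hh.2 x y).2
  · exact (side_le_side _ _ (by linarith [hroom y hy]) q).trans
      (closure_cell_subset_closedSector hqc y hy)

/-- The cell for `h'` is star-shaped, so it supplies a segment from `x` inside `O`; the sector for
`h` is convex and contains that segment. -/
theorem mem_closure_cell_of_le (hh' : h' ∈ cuts f g) (hqc : q ∈ closure (cell G O h' x))
    (hqs : q ∈ sector G h x) : q ∈ closure (cell G O h x) := by
  refine closure_mono ?_ ((isOpen_sector (G := G) (h := h) (x := x)).inter_closure ⟨hqs, hqc⟩)
  rintro v ⟨hvs, hvc⟩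
  have hx := T.self_mem_cell hh x
  refine subset_cell_of_isPreconnected (convex_segment (x : EuclideanSpace ℝ (Fin n)) v).isPreconnected
    (subset_inter (fun r hr => (cell_subset ((T.starConvex hh' x).segment_subset hvc hr)).1)
      (convex_sector.segment_subset (cell_subset hx).2 hvs))
    ⟨x, left_mem_segment ℝ _ _, hx⟩ (right_mem_segment ℝ _ _)

/-- The frontier points of a closed cell are covered by the pieces of this cell. -/
theorem exists_piece (he : 0 < e)
    (hroom : ∀ x y, G.graph.Adj x y → min (f x y) (g x y) + 2 * e ≤ h x y ∧
      h x y + 2 * e ≤ max (f x y) (g x y))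
    (hvert : ∀ x y, G.graph.Adj x y → ∀ δ ∈ relevant S G O f g e x, ∀ v ∈ δ.extremePoints ℝ,
      side (x : EuclideanSpace ℝ (Fin n)) y (h x y) v ≠ 0)
    (hu : u ∈ frontier O) (huc : u ∈ closure (cell G O h x)) :
    ∃ δ ∈ S, δ ∩ closure (cell G O h x) ∈ cutComplex S G O h ∧ u ∈ δ := by
  -- The point `u` is on at most one wall of the cell.
  have hother : ∀ w, G.graph.Adj x w → side (x : EuclideanSpace ℝ (Fin n)) w (h x w) u = 0 →
      ∀ z, G.graph.Adj x z → z ≠ w → side (x : EuclideanSpace ℝ (Fin n)) z (h x z) u < 0 := by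
    intro w hxw hw z hxz hzw
    refine lt_of_le_of_ne (closure_cell_subset_closedSector huc z hxz) fun hz => ?_
    refine T.not_close_of_adj_adj hh hxw hxz hzw.symm he.le (by linarith [(hroom x w hxw).1])
      (by linarith [(hroom x z hxz).1]) huc ?_ ?_
    · rw [side_sub _ _ _ _ (h x w), hw, zero_add, sub_sub_cancel]
      exact mul_pos he (dist_pos_of_adj hxw)
    · rw [side_sub _ _ _ _ (h x z), hz, zero_add, sub_sub_cancel]
      exact mul_pos he (dist_pos_of_adj hxz)
  -- Widening the cell by `e` at the wall through `u`, if there is one, puts `u` in the open sector.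
  obtain ⟨k, hk, hle, hle', hus⟩ : ∃ k ∈ cuts f g, (∀ b, G.graph.Adj x b → h x b ≤ k x b) ∧
      (∀ b, G.graph.Adj x b → k x b ≤ h x b + e) ∧ u ∈ sector G k x := by
    by_cases hus : u ∈ sector G h x
    · exact ⟨h, hh, fun _ _ => le_rfl, fun _ _ => by linarith, hus⟩
    · simp only [sector, mem_ofPred_eq, not_forall] at hus
      obtain ⟨w, hxw, hw⟩ := hus
      have hw0 := le_antisymm (closure_cell_subset_closedSector huc w hxw) (not_lt.1 hw)
      have hne : ∀ b, b ≠ w → shift h x w (-e) x b = h x b := fun b hb =>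
        shift_of_ne (Or.inr hb) (Or.inl hxw.ne)
      refine ⟨shift h x w (-e), shift_mem_cuts T.anti_left T.anti_right hh hxw.ne
        (by linarith [(hroom x w hxw).1]) (by linarith [(hroom x w hxw).2]), fun b hb => ?_,
        fun b hb => ?_, fun b hb => ?_⟩
      · rcases eq_or_ne b w with rfl | hbw
        · rw [shift_left]; linarith
        · rw [hne b hbw]
      · rcases eq_or_ne b w with rfl | hbw
        · rw [shift_left]; linarith
        · rw [hne b hbw]; linarith
      · rcases eq_or_ne b w with rfl | hbw
        · rw [shift_left, side_sub _ _ _ _ (h x b), hw0, zero_add]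
          exact mul_neg_of_neg_of_pos (by linarith) (dist_pos_of_adj hb)
        · rw [hne b hbw]; exact hother w hxw hw0 b hb hbw
  have huk : u ∈ closure (cell G O k x) := closure_mono (cell_mono hle) huc
  have huS : u ∈ ⋃₀ cutComplex S G O k := by
    rw [(T.good k hk).2.choose_spec.2.2.2.2.2.2.1]; exact hu
  obtain ⟨_, ⟨hdim, δ, hδ, v, rfl⟩, huδ⟩ := huS
  -- The piece of `S(k)` through `u` belongs to `x`: another closed cell through `u` would be
  -- adjacent, and `u` would lie on the wall.
  have hvx : v = x := by
    by_contra hne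
    have hadj := T.adj_of_closure hk (Ne.symm hne) huk huδ.2
    have h1 := closure_cell_subset_closedSector huδ.2 x hadj.symm
    rw [side_comm hk x v] at h1
    linarith [hus v hadj]
  subst hvx
  obtain ⟨q, hq, hqc, hqs⟩ := T.exists_mem_sector hk hδ hdim
  have hrel : δ ∈ relevant S G O f g e v := mem_relevant hk hδ hq hqc fun y hy => by
    linarith [hle' y hy, (hroom v y hy).2]
  have hδc := (T.isComplex.isPolyhedron hδ).convex
  -- No vertex of `δ` is on the wall through `u`, so the vertex deepest on the side of `x` is
  -- strictly inside. A small move from `u` towards it enters the open sector of `h`.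
  obtain ⟨u', hu'δ, hu's⟩ : ∃ u' ∈ δ, u' ∈ sector G h v := by
    by_cases hus : u ∈ sector G h v
    · exact ⟨u, huδ.1, hus⟩
    · simp only [sector, mem_ofPred_eq, not_forall] at hus
      obtain ⟨w, hxw, hw⟩ := hus
      have hw0 := le_antisymm (closure_cell_subset_closedSector huc w hxw) (not_lt.1 hw)
      obtain ⟨t, ht, htmax⟩ := exists_extremePoint_inner_le (T.isComplex.isPolyhedron hδ).2.1 ⟨u, huδ.1⟩
        ((v : EuclideanSpace ℝ (Fin n)) - (w : EuclideanSpace ℝ (Fin n)))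
      have ht0 : side (v : EuclideanSpace ℝ (Fin n)) w (h v w) t < 0 := by
        refine lt_of_le_of_ne ?_ (hvert v w hxw δ hrel t ht)
        rw [← hw0]
        have h1 := htmax u huδ.1
        have h2 : side (v : EuclideanSpace ℝ (Fin n)) w (h v w) t
            - side (v : EuclideanSpace ℝ (Fin n)) w (h v w) u
            = inner ℝ ((v : EuclideanSpace ℝ (Fin n)) - (w : EuclideanSpace ℝ (Fin n))) u
              - inner ℝ ((v : EuclideanSpace ℝ (Fin n)) - (w : EuclideanSpace ℝ (Fin n))) t := by
          rw [side, side, ← inner_sub_right, real_inner_comm _ (t - _), real_inner_comm _ (u - _),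
            ← neg_sub (w : EuclideanSpace ℝ (Fin n)) (v : EuclideanSpace ℝ (Fin n)), inner_neg_left]
          simp only [inner_sub_right]
          ring
        linarith
      have hopen : ∀ᶠ τ : ℝ in 𝓝[>] 0, ∀ z : G.T, G.graph.Adj v z → z ≠ w →
          side (v : EuclideanSpace ℝ (Fin n)) z (h v z) ((1 - τ) • u + τ • t) < 0 := by
        simp only [Filter.eventually_all]
        intro z hxz hzw
        have hcont : Continuous fun τ : ℝ =>
            side (v : EuclideanSpace ℝ (Fin n)) z (h v z) ((1 - τ) • u + τ • t) :=
          (continuous_side _ _ _).comp (by fun_prop)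
        have htend := hcont.tendsto 0
        simp only [sub_zero, one_smul, zero_smul, add_zero] at htend
        exact (htend.mono_left nhdsWithin_le_nhds).eventually
          (gt_mem_nhds (hother w hxw hw0 z hxz hzw))
      obtain ⟨τ, hτz, hτ⟩ := (hopen.and (Ioo_mem_nhdsGT (zero_lt_one' ℝ))).exists
      refine ⟨(1 - τ) • u + τ • t, hδc huδ.1 ht.1 (by linarith [hτ.2]) hτ.1.le (by ring),
        fun z hxz => ?_⟩
      rcases eq_or_ne z w with rfl | hzw
      · rw [side_combo _ _ _ (by ring), hw0, mul_zero, zero_add]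
        exact mul_neg_of_pos_of_neg hτ.1 ht0
      · exact hτz z hxz hzw
  -- A little weight on `q` makes the point relatively interior to `δ`, still in the open sector of
  -- `h`. It is then in the closed cell for `k`, hence in that for `h`.
  have hcont : Continuous fun τ : ℝ => τ • q + (1 - τ) • u' := by fun_prop
  have htend := hcont.tendsto 0
  simp only [sub_zero, one_smul, zero_smul, zero_add] at htend
  obtain ⟨τ, hτs, hτ⟩ := (((htend.mono_left nhdsWithin_le_nhds).eventually
    (isOpen_sector.mem_nhds hu's)).and (Ioo_mem_nhdsGT (zero_lt_one' ℝ))).exists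
  have hrel' : τ • q + (1 - τ) • u' ∈ intrinsicInterior ℝ δ :=
    combo_mem_intrinsicInterior hδc hq hu'δ hτ.1 (by linarith [hτ.2]) (by ring)
  have hck := T.inter_closedSector_subset hk hδ hq hqc hqs
    ⟨intrinsicInterior_subset hrel', sector_subset_closedSector (sector_mono hle hτs)⟩
  exact ⟨δ, hδ, T.piece_mem_cutComplex hh hδ hrel' (T.mem_closure_cell_of_le hh hk hck hτs) hτs,
    huδ.1⟩

theorem suspendable (he : 0 < e)
    (hroom : ∀ x y, G.graph.Adj x y → min (f x y) (g x y) + 2 * e ≤ h x y ∧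
      h x y + 2 * e ≤ max (f x y) (g x y))
    (hvert : ∀ x y, G.graph.Adj x y → ∀ δ ∈ relevant S G O f g e x, ∀ v ∈ δ.extremePoints ℝ,
      side (x : EuclideanSpace ℝ (Fin n)) y (h x y) v ≠ 0) :
    ∃ p, IsCellChoice S G O h p ∧ Suspendable (cutComplex S G O h) G O h p := by
  obtain ⟨hcx, p, hp, hocc, hsep, htot⟩ := T.good h hh
  refine ⟨p, hp, hcx, T.mem, T.bound h hh, hh.1, hocc, hsep, htot, ?_, ?_, ?_⟩
  · intro x y z t hxy hxz hyz ht hy hz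
    refine T.not_close_of_adj_adj hh hxy hxz hyz he.le (by linarith [(hroom x y hxy).1])
      (by linarith [(hroom x z hxz).1]) ht ?_ ?_
    · rw [side_sub _ _ _ _ (h x y), hy, zero_add, sub_sub_cancel]
      exact mul_pos he (dist_pos_of_adj hxy)
    · rw [side_sub _ _ _ _ (h x z), hz, zero_add, sub_sub_cancel]
      exact mul_pos he (dist_pos_of_adj hxz)
  · exact fun x y t hxy ht h0 =>
      T.mem_closure_of_side_eq_zero hh hxy he (by linarith [(hroom x y hxy).1]) ht h0
  · intro x t ht htc
    obtain ⟨δ, hδ, hmem, htδ⟩ := T.exists_piece hh he hroom hvert ht htc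
    exact ⟨_, ⟨hmem, (hp _ hmem x).2 inter_subset_right⟩, htδ, htc⟩

end TubularSystem

end TubularSuspension

end

/-! ### Inner radii of the pieces, and the number of relevant polyhedra. -/

section

open Set Metric Topology

namespace TubularSuspension

variable {n : ℕ} {S : Set (Set (EuclideanSpace ℝ (Fin n)))} {G : EuclideanGraph n}
  {O : Set (EuclideanSpace ℝ (Fin n))} {f g h : G.T → G.T → ℝ} {a e μ r R : ℝ}

theorem exists_side_eq {x y : EuclideanSpace ℝ (Fin n)} (hxy : x ≠ y) (r : ℝ) :
    ∃ (b : EuclideanSpace ℝ (Fin n)) (c : ℝ), ‖b‖ = 1 ∧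
      ∀ t, side x y r t = dist x y * (inner ℝ b t - c) := by
  have hd := dist_pos.2 hxy
  have hd' : dist x y = ‖y - x‖ := by rw [dist_comm, dist_eq_norm]
  refine ⟨(dist x y)⁻¹ • (y - x), inner ℝ ((dist x y)⁻¹ • (y - x)) x + (r + dist x y / 2), ?_,
    fun t => ?_⟩
  · rw [norm_smul, Real.norm_eq_abs, abs_of_pos (inv_pos.2 hd), ← hd', inv_mul_cancel₀ hd.ne']
  · rw [side, real_inner_comm, inner_sub_right, real_inner_smul_left, real_inner_smul_left]
    field_simp
    ring

theorem setOf_side_nonpos {x y : EuclideanSpace ℝ (Fin n)} (hxy : x ≠ y)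
    {b : EuclideanSpace ℝ (Fin n)} {l c : ℝ}
    (hside : ∀ t, side x y l t = dist x y * (inner ℝ b t - c)) :
    {t | side x y l t ≤ 0} = {t | inner ℝ b t ≤ c} := by
  have hd := dist_pos.2 hxy
  ext t
  rw [mem_ofPred_eq, mem_ofPred_eq, hside]
  constructor
  · intro h1
    by_contra h2
    exact absurd h1 (not_le.2 (mul_pos hd (by linarith)))
  · intro h1
    exact mul_nonpos_of_nonneg_of_nonpos hd.le (by linarith)

theorem side_sub_le_of_norm {x y : EuclideanSpace ℝ (Fin n)} (r : ℝ) (u v : EuclideanSpace ℝ (Fin n)) :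
    side x y r u ≤ side x y r v + ‖u - v‖ * dist x y := by
  have h1 := real_inner_le_norm (u - v) (y - x)
  rw [← dist_eq_norm y x, dist_comm y x] at h1
  have h2 : side x y r u - side x y r v = inner ℝ (u - v) (y - x) := by
    simp only [side, inner_sub_left]; ring
  linarith

/-- The factor by which a cut at distance `μ` of the vertices reduces the inner radius. -/
noncomputable def cutFactor (μ R : ℝ) : ℝ := min 1 (μ / (2 * R))

theorem cutFactor_pos (hμ : 0 < μ) (hR : 0 < R) : 0 < cutFactor μ R := by
  unfold cutFactor; positivity

theorem cutFactor_mul {ρ : ℝ} (hρ : 0 < ρ) (μ R : ℝ) :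
    cutFactor (ρ * μ) (ρ * R) = cutFactor μ R := by
  rw [cutFactor, cutFactor, mul_left_comm, mul_div_mul_left _ _ hρ.ne']

theorem exists_relBall_of_inter_side {P : Set (EuclideanSpace ℝ (Fin n))} (hP : IsPolyhedron P)
    {x y : EuclideanSpace ℝ (Fin n)} (hxy : x ≠ y) {l : ℝ} (hr : 0 ≤ r) (hμ : 0 < μ) (hR : 0 < R)
    (hdiam : ∀ u ∈ P, ∀ v ∈ P, ‖u - v‖ ≤ R)
    (hball : ∀ F ∈ subfaces P, dimension F ≠ 0 → ∃ c, RelBall c r F)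
    (hvert : ∀ v ∈ P.extremePoints ℝ, μ * dist x y ≤ |side x y l v|)
    (hne : (P ∩ {t | side x y l t ≤ 0}).Nonempty) :
    IsPolyhedron (P ∩ {t | side x y l t ≤ 0}) ∧
      ∀ F ∈ subfaces (P ∩ {t | side x y l t ≤ 0}), dimension F ≠ 0 →
        ∃ c, RelBall c (cutFactor μ R * r) F := by
  obtain ⟨b, c, hb, hside⟩ := exists_side_eq hxy l
  have hd := dist_pos.2 hxy
  rw [setOf_side_nonpos hxy hside] at hne ⊢
  have hb0 : b ≠ 0 := fun h0 => by rw [h0, norm_zero] at hb; exact zero_ne_one hb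
  refine ⟨hP.inter_halfSpace hb0 c hne, fun F hF hdim =>
    exists_relBall_of_inter_halfSpace hP hb hr hμ hR hdiam hball (fun v hv => ?_) hF hdim⟩
  have h1 := hvert v hv
  rw [hside, abs_mul, abs_of_pos hd, mul_comm] at h1
  exact le_of_mul_le_mul_left h1 hd

theorem mem_extremePoints_of_inter_side {P : Set (EuclideanSpace ℝ (Fin n))} (hP : Convex ℝ P)
    {x y : EuclideanSpace ℝ (Fin n)} (hxy : x ≠ y) {l : ℝ} {v : EuclideanSpace ℝ (Fin n)}
    (hv : v ∈ (P ∩ {t | side x y l t ≤ 0}).extremePoints ℝ) (hlt : side x y l v < 0) :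
    v ∈ P.extremePoints ℝ := by
  obtain ⟨b, c, -, hside⟩ := exists_side_eq hxy l
  have hd := dist_pos.2 hxy
  rw [setOf_side_nonpos hxy hside] at hv
  rw [hside] at hlt
  exact mem_extremePoints_of_inter_halfSpace hP hv (by
    by_contra hc
    exact absurd hlt (not_lt.2 (mul_nonneg hd.le (by linarith))))

namespace TubularSystem

variable (T : TubularSystem S G O f g a) (hh : h ∈ cuts f g)
include T hh

/-- A vertex of the graph has at most two neighbours, so a piece is `δ` cut by at most two
half-spaces. The second cut also has to avoid the vertices created by the first, which holds because
no point of a closed cell is close to two walls. -/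
theorem exists_relBall_of_cutComplex (hμ : 0 < μ) (hμe : μ ≤ e) (hr : 0 < r)
    (hR : 0 < R)
    (hroom : ∀ x y, G.graph.Adj x y → min (f x y) (g x y) + 2 * e ≤ h x y ∧
      h x y + 2 * e ≤ max (f x y) (g x y))
    (hdiam : ∀ δ ∈ S, ∀ u ∈ δ, ∀ v ∈ δ, ‖u - v‖ ≤ R)
    (hball : ∀ φ ∈ allSubfaces S, dimension φ ≠ 0 → ∃ c, RelBall c r φ)
    (hvert : ∀ x y : G.T, G.graph.Adj x y → ∀ δ ∈ relevant S G O f g e x, ∀ v ∈ δ.extremePoints ℝ,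
      μ * dist (x : EuclideanSpace ℝ (Fin n)) y ≤ |side (x : EuclideanSpace ℝ (Fin n)) y (h x y) v|)
    (hdeg : ∀ x, (G.graph.neighborSet x).ncard ≤ 2)
    {F : Set (EuclideanSpace ℝ (Fin n))} (hF : F ∈ allSubfaces (cutComplex S G O h))
    (hdim : dimension F ≠ 0) : ∃ c, RelBall c (cutFactor μ R * (cutFactor μ R * r)) F := by
  have he : 0 < e := hμ.trans_le hμe
  obtain ⟨_, ⟨hpdim, δ, hδ, x, rfl⟩, hF⟩ := mem_iUnion₂.1 hF
  have hpiece := T.piece_eq hh hδ hpdim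
  have hne := (T.isPolyhedron_piece hh hδ hpdim).1
  have hrel : δ ∈ relevant S G O f g e x := by
    obtain ⟨q, hq, hqc, -⟩ := T.exists_mem_sector hh hδ hpdim
    exact mem_relevant hh hδ hq hqc fun y hy => by linarith [(hroom x y hy).2]
  have hP := T.isComplex.isPolyhedron hδ
  have hfaces : ∀ φ ∈ subfaces δ, dimension φ ≠ 0 → ∃ c, RelBall c r φ := fun φ hφ =>
    hball φ (mem_allSubfaces hδ hφ)
  have hmemD : ∀ t ∈ δ, t ∈ closedSector G h x → t ∈ closure (cell G O h x) := fun t ht hs =>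
    (hpiece.ge ⟨ht, hs⟩).2
  rw [hpiece] at hF hne
  have hneq : ∀ {y : G.T}, G.graph.Adj x y → (x : EuclideanSpace ℝ (Fin n)) ≠ y := fun hxy he =>
    hxy.ne (Subtype.ext he)
  set τ := cutFactor μ R with hτ
  have hτ1 : τ * (τ * r) ≤ τ * r := by
    have h0 := (cutFactor_pos hμ hR).le
    have h1 : τ ≤ 1 := min_le_left _ _
    have h2 : 0 ≤ τ * r := mul_nonneg h0 hr.le
    nlinarith
  have single : ∀ y, G.graph.Adj x y →
      δ ∩ closedSector G h x = δ ∩ {t | side (x : EuclideanSpace ℝ (Fin n)) y (h x y) t ≤ 0} →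
      ∃ c, RelBall c (τ * (τ * r)) F := by
    intro y hxy heq
    rw [heq] at hF hne
    obtain ⟨c, hc⟩ := (exists_relBall_of_inter_side hP (hneq hxy) hr.le hμ hR (hdiam δ hδ) hfaces
      (hvert x y hxy δ hrel) hne).2 F hF hdim
    exact ⟨c, hc.mono hτ1⟩
  obtain ⟨y, hxy⟩ := T.exists_adj x
  by_cases hz : ∃ z, G.graph.Adj x z ∧ z ≠ y
  swap
  · push Not at hz
    refine single y hxy (Subset.antisymm (fun t ht => ⟨ht.1, ht.2 y hxy⟩) fun t ht =>
      ⟨ht.1, fun z hxz => ?_⟩)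
    rw [hz z hxz]; exact ht.2
  obtain ⟨z, hxz, hzy⟩ := hz
  have hall : ∀ w, G.graph.Adj x w → w = y ∨ w = z := by
    intro w hxw
    by_contra hcon
    push Not at hcon
    have hsub : ({w, y, z} : Set G.T) ⊆ G.graph.neighborSet x := by
      rintro b (rfl | rfl | rfl) <;> assumption
    have h1 := Set.ncard_le_ncard hsub (Set.toFinite _)
    rw [Set.ncard_eq_three.2 ⟨w, y, z, hcon.1, hcon.2, hzy.symm, rfl⟩] at h1
    linarith [hdeg x]
  set σy := side (x : EuclideanSpace ℝ (Fin n)) y (h x y) with hσy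
  set σz := side (x : EuclideanSpace ℝ (Fin n)) z (h x z) with hσz
  have hsector : ∀ t, t ∈ closedSector G h x ↔ σy t ≤ 0 ∧ σz t ≤ 0 := fun t =>
    ⟨fun ht => ⟨ht y hxy, ht z hxz⟩, fun ht w hxw => by
      rcases hall w hxw with rfl | rfl
      · exact ht.1
      · exact ht.2⟩
  have hclose : ∀ t ∈ δ, σy t = 0 → σz t ≤ 0 →
      σz t ≤ -(e * dist (x : EuclideanSpace ℝ (Fin n)) z) := by
    intro t ht hy hz
    by_contra hcon
    push Not at hcon
    refine T.not_close_of_adj_adj hh hxy hxz hzy.symm he.le (by linarith [(hroom x y hxy).1])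
      (by linarith [(hroom x z hxz).1]) (hmemD t ht ((hsector t).2 ⟨hy.le, hz⟩)) ?_ ?_
    · rw [side_sub _ _ _ _ (h x y), ← hσy, hy, zero_add, sub_sub_cancel]
      exact mul_pos he (dist_pos_of_adj hxy)
    · rw [side_sub _ _ _ _ (h x z), ← hσz, sub_sub_cancel]
      linarith
  have hcombo : ∀ {α β : ℝ}, α + β = 1 → ∀ u v, σy (α • u + β • v) = α * σy u + β * σy v :=
    fun hαβ u v => side_combo _ _ _ hαβ u v
  have hcombo' : ∀ {α β : ℝ}, α + β = 1 → ∀ u v, σz (α • u + β • v) = α * σz u + β * σz v :=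
    fun hαβ u v => side_combo _ _ _ hαβ u v
  by_cases hcase : ∃ t ∈ δ, σy t = 0 ∧ σz t ≤ 0
  · obtain ⟨t₀, ht₀, hy0, hz0⟩ := hcase
    -- On the section of `δ` by the first hyperplane, `σz` starts nonpositive at `t₀`. To become
    -- positive it would have to vanish, which `hclose` excludes.
    have hfar : ∀ t ∈ δ, σy t = 0 → σz t ≤ -(e * dist (x : EuclideanSpace ℝ (Fin n)) z) := by
      intro t ht hy
      by_cases hz : σz t ≤ 0
      · exact hclose t ht hy hz
      · obtain ⟨α, β, hα, hβ, hαβ, h0⟩ := exists_segment_side_eq_zero hσz hz0 (not_le.1 hz)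
        have h1 := hclose _ (hP.convex ht₀ ht hα hβ hαβ) (by rw [hcombo hαβ, hy0, hy]; ring) h0.le
        rw [h0] at h1
        have := mul_pos he (dist_pos_of_adj hxz)
        linarith
    have heq : δ ∩ closedSector G h x = (δ ∩ {t | σy t ≤ 0}) ∩ {t | σz t ≤ 0} := by
      ext t
      rw [mem_inter_iff, hsector]
      exact and_assoc.symm
    rw [heq] at hF hne
    obtain ⟨hP1, hball1⟩ := exists_relBall_of_inter_side hP (hneq hxy) hr.le hμ hR (hdiam δ hδ) hfaces
      (hvert x y hxy δ hrel) (hne.mono inter_subset_left)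
    refine (exists_relBall_of_inter_side hP1 (hneq hxz)
      (mul_nonneg (cutFactor_pos hμ hR).le hr.le) hμ hR
      (fun u hu v hv => hdiam δ hδ u hu.1 v hv.1) hball1 (fun v hv => ?_) hne).2 F hF hdim
    have hvy : σy v ≤ 0 := hv.1.2
    -- A vertex of the once-cut polyhedron is a vertex of `δ` or a point of the first hyperplane.
    rcases hvy.lt_or_eq with hlt | hzero
    · exact hvert x z hxz δ hrel v (mem_extremePoints_of_inter_side hP.convex (hneq hxy) hv hlt)
    · have h1 := hfar v hv.1.1 hzero
      have h2 := mul_le_mul_of_nonneg_right hμe (dist_pos_of_adj hxz).le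
      exact (h2.trans (by linarith)).trans (neg_le_abs _)
  -- Here the first hyperplane does not meet `δ` inside the second half-space, so the second cut
  -- alone gives the piece.
  · push Not at hcase
    refine single z hxz (Subset.antisymm (fun t ht => ⟨ht.1, ht.2 z hxz⟩) fun t ht =>
      ⟨ht.1, (hsector t).2 ⟨?_, ht.2⟩⟩)
    by_contra hy
    obtain ⟨t₁, ht₁, hs₁⟩ := hne
    obtain ⟨hy1, hz1⟩ := (hsector t₁).1 hs₁
    obtain ⟨α, β, hα, hβ, hαβ, h0⟩ := exists_segment_side_eq_zero hσy hy1 (not_le.1 hy)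
    have h1 := hcase _ (hP.convex ht₁ ht.1 hα hβ hαβ) h0
    rw [hcombo' hαβ] at h1
    have ht2 : σz t ≤ 0 := ht.2
    nlinarith [mul_nonneg hα (neg_nonneg.2 hz1), mul_nonneg hβ (neg_nonneg.2 ht2)]

omit hh in
/-- A relevant polyhedron contains a ball of controlled radius inside the widest cell. -/
theorem exists_relBall_of_relevant (he : 0 < e) (hr : 0 < r) (hR : 0 < R)
    (hdiam : ∀ δ ∈ S, ∀ u ∈ δ, ∀ v ∈ δ, ‖u - v‖ ≤ R) (hball : ∀ δ ∈ S, ∃ c, RelBall c r δ)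
    {x : G.T} {δ : Set (EuclideanSpace ℝ (Fin n))} (hδ : δ ∈ relevant S G O f g e x) :
    ∃ c, RelBall c (cutFactor e (r + R) * r) δ ∧
      δ ∩ closure (cell G O (widest f g x) x) ∈ cutComplex S G O (widest f g x) ∧
      closedBall c (cutFactor e (r + R) * r) ∩ affineSpan ℝ δ
        ⊆ δ ∩ closure (cell G O (widest f g x) x) := by
  obtain ⟨hδ, q, hq, hqc, hqs⟩ := hδ
  have hh := widest_mem_cuts T.anti_left T.anti_right x
  set t := cutFactor e (r + R) with ht
  have ht0 : 0 < t := cutFactor_pos he (by linarith)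
  have ht1 : t ≤ 1 := min_le_left _ _
  -- The ball contracted towards `q` stays within `e / 2` of `q`, which has room `e` before each
  -- wall.
  have hte : t * (r + R) ≤ e / 2 := by
    have h1 : t ≤ e / (2 * (r + R)) := min_le_right _ _
    rw [le_div_iff₀ (by positivity)] at h1
    linarith
  obtain ⟨c, hc⟩ := hball δ hδ
  have hqδ := intrinsicInterior_subset hq
  have hc' := hc.homothety (T.isComplex.isPolyhedron hδ).convex hqδ ht0 ht1
  have hsector : ∀ v, ‖v - q‖ ≤ e / 2 → v ∈ sector G (widest f g x) x := by
    intro v hv y hxy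
    rw [widest_self]
    have h1 := hqs y hxy
    have h2 := side_sub_le_of_norm (x := (x : EuclideanSpace ℝ (Fin n))) (y := y)
      (max (f x y) (g x y)) v q
    have h3 := side_sub (x : EuclideanSpace ℝ (Fin n)) y q (max (f x y) (g x y))
      (max (f x y) (g x y) - e)
    have hd := dist_pos_of_adj hxy
    nlinarith [mul_le_mul_of_nonneg_right hv hd.le, mul_pos he hd]
  have hqs' := hsector q (by rw [sub_self, norm_zero]; positivity)
  refine ⟨_, hc', T.piece_mem_cutComplex hh hδ hq hqc hqs', fun v hv => ?_⟩
  have hvδ := hc'.2 hv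
  refine ⟨hvδ, T.inter_closedSector_subset hh hδ hq hqc hqs' ⟨hvδ, sector_subset_closedSector
    (hsector v ?_)⟩⟩
  have h1 := hv.1
  rw [mem_closedBall, dist_eq_norm] at h1
  have h2 : v - q = (v - (q + t • (c - q))) + t • (c - q) := by module
  have h3 := hdiam δ hδ c (hc.mem hr.le) q hqδ
  rw [h2]
  refine (norm_add_le _ _).trans ?_
  rw [norm_smul, Real.norm_eq_abs, abs_of_pos ht0]
  nlinarith [mul_le_mul_of_nonneg_left h3 ht0.le]

end TubularSystem

/-- The centres of two balls on pieces attached to the same vertex are not close. -/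
theorem mem_of_centers_near {U δ : Set (EuclideanSpace ℝ (Fin n))} {x c₁ c₂ : EuclideanSpace ℝ (Fin n)}
    (hn : 1 ≤ n) (hdim : dimension δ = n - 1) (hU : SimpleOcclusion U {x}) (ha : 0 < a) (hr : 0 < r)
    (hR : 0 ≤ R) (hx : ∀ u ∈ affineSpan ℝ δ, a ≤ ‖x - u‖) (hc₁ : c₁ ∈ affineSpan ℝ δ)
    (hball : closedBall c₁ r ∩ affineSpan ℝ δ ⊆ δ ∩ U) (hc₂ : c₂ ∈ U) (hxc : ‖c₂ - x‖ ≤ R)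
    (hnear : ‖c₁ - c₂‖ < min (a / 2) (r / (1 + 2 * R / a))) : c₂ ∈ δ := by
  obtain ⟨ν, c, hν, haff⟩ := exists_normal hn
    ⟨c₁, (hball ⟨mem_closedBall_self hr.le, hc₁⟩).1⟩ hdim
  have hνν : inner ℝ ν ν = (1 : ℝ) := by rw [real_inner_self_eq_norm_sq, hν, one_pow]
  have hc₁c := (haff c₁).1 hc₁
  set D := c - inner ℝ ν x with hD
  set E := inner ℝ ν (c₂ - c₁) with hE
  have hDa : a ≤ |D| := by
    have h1 := hx (x + D • ν) ((haff _).2 (by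
      rw [inner_add_right, real_inner_smul_right, hνν, hD]; ring))
    rwa [sub_add_cancel_left, norm_neg, norm_smul, hν, mul_one] at h1
  have hEs : |E| ≤ ‖c₁ - c₂‖ := by
    have := abs_real_inner_le_norm ν (c₂ - c₁)
    rwa [hν, one_mul, norm_sub_rev] at this
  have hn1 : ‖c₁ - c₂‖ < a / 2 := hnear.trans_le (min_le_left _ _)
  have hn2 : ‖c₁ - c₂‖ < r / (1 + 2 * R / a) := hnear.trans_le (min_le_right _ _)
  have hED : |E| < |D| / 2 := by linarith
  have hDE : |D| / 2 ≤ |D + E| := by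
    have := abs_sub_abs_le_abs_sub D (-E)
    rw [abs_neg, sub_neg_eq_add] at this
    linarith
  have hD0 : 0 < |D| := ha.trans_le hDa
  have hDE0 : D + E ≠ 0 := fun h0 => by rw [h0, abs_zero] at hDE; linarith
  -- `x + k • (c₂ - x)` is the point where the line from `x` through `c₂` meets the hyperplane of
  -- `δ`. It is within `r` of `c₁`, hence in `U`.
  set k := D / (D + E) with hk
  have hk1 : k - 1 = -E / (D + E) := by rw [hk]; field_simp; ring
  have hkabs : |k - 1| * a ≤ 2 * ‖c₁ - c₂‖ := by
    rw [hk1, abs_div, abs_neg, div_mul_eq_mul_div, div_le_iff₀ (by linarith)]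
    nlinarith [abs_nonneg E, norm_nonneg (c₁ - c₂)]
  have hk0 : 0 < k := by
    have : |k - 1| < 1 := by
      by_contra hcon
      push Not at hcon
      nlinarith
    linarith [(abs_lt.1 this).1]
  have hua : x + k • (c₂ - x) ∈ affineSpan ℝ δ := by
    refine (haff _).2 ?_
    have h1 : inner ℝ ν (c₂ - x) = D + E := by
      rw [hD, hE, inner_sub_right, inner_sub_right, hc₁c]; ring
    rw [inner_add_right, real_inner_smul_right, h1, hk, div_mul_cancel₀ _ hDE0, hD]; ring
  have huc : ‖x + k • (c₂ - x) - c₁‖ ≤ r := by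
    have h1 : x + k • (c₂ - x) - c₁ = (k - 1) • (c₂ - x) + (c₂ - c₁) := by module
    rw [h1]
    refine (norm_add_le _ _).trans ?_
    rw [norm_smul, Real.norm_eq_abs, norm_sub_rev c₂ c₁]
    have h2 : |k - 1| ≤ 2 * ‖c₁ - c₂‖ / a := (le_div_iff₀ ha).2 hkabs
    have h3 : 0 < 1 + 2 * R / a := by positivity
    rw [lt_div_iff₀ h3] at hn2
    have h4 : |k - 1| * ‖c₂ - x‖ ≤ 2 * ‖c₁ - c₂‖ / a * R :=
      mul_le_mul h2 hxc (norm_nonneg _) (by positivity)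
    have h5 : ‖c₁ - c₂‖ * (1 + 2 * R / a) = 2 * ‖c₁ - c₂‖ / a * R + ‖c₁ - c₂‖ := by
      field_simp; ring
    linarith
  obtain ⟨huδ, huU⟩ := hball ⟨mem_closedBall.2 (by rw [dist_eq_norm]; exact huc), hua⟩
  -- Two points of `U` on one ray from `x` coincide by occlusion, whichever comes first.
  have heq : x + k • (c₂ - x) = c₂ := by
    rcases le_total k 1 with h1 | h1
    · have h2 := hU c₂ hc₂ x rfl
      have h3 : x + k • (c₂ - x) ∈ segment ℝ c₂ x ∩ U :=
        ⟨⟨k, 1 - k, hk0.le, by linarith, by ring, by module⟩, huU⟩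
      rw [h2] at h3
      exact h3
    · have h2 := hU _ huU x rfl
      have h3 : c₂ ∈ segment ℝ (x + k • (c₂ - x)) x ∩ U := by
        refine ⟨⟨k⁻¹, 1 - k⁻¹, by positivity, sub_nonneg.2 (inv_le_one_of_one_le₀ h1), by ring, ?_⟩,
          hc₂⟩
        rw [smul_add, smul_smul, inv_mul_cancel₀ hk0.ne']
        module
      rw [h2] at h3
      exact h3.symm
  rwa [heq] at huδ

/-- All the relevant polyhedra have pieces in the widest cell of `x`, so their balls lie in one set
in occlusion with respect to `x`. By `mem_of_centers_near`, close centres give a relative interior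
point of one polyhedron in another, and the two are equal. -/
theorem exists_bound_ncard_relevant (n : ℕ) {a e r R : ℝ} (ha : 0 < a) (he : 0 < e) (hr : 0 < r)
    (hR : 0 < R) : ∃ N : ℕ, ∀ (S : Set (Set (EuclideanSpace ℝ (Fin n)))) (G : EuclideanGraph n)
      (O : Set (EuclideanSpace ℝ (Fin n))) (f g : G.T → G.T → ℝ) (ρ : ℝ), 0 < ρ →
      TubularSystem S G O f g (ρ * a) →
      (∀ δ ∈ S, ∀ u ∈ δ, ∀ v ∈ δ, ‖u - v‖ ≤ ρ * R) → (∀ δ ∈ S, ∃ c, RelBall c (ρ * r) δ) →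
      (∀ h ∈ cuts f g, ∀ x : G.T, ∀ u ∈ frontier O, u ∈ closure (cell G O h x) →
        ‖u - (x : EuclideanSpace ℝ (Fin n))‖ ≤ ρ * R) →
      ∀ x, (relevant S G O f g (ρ * e) x).ncard ≤ N := by
  classical
  set r' := cutFactor e (r + R) * r with hr'
  have hr'0 : 0 < r' := mul_pos (cutFactor_pos he (by linarith)) hr
  obtain ⟨N, hN⟩ := exists_packing_bound (E := EuclideanSpace ℝ (Fin n)) R
    (s := min (a / 2) (r' / (1 + 2 * R / a))) (by positivity)
  refine ⟨N, fun S G O f g ρ hρ T hdiam hball hdist x => ?_⟩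
  have hh := widest_mem_cuts T.anti_left T.anti_right x
  have hfin : (relevant S G O f g (ρ * e) x).Finite := T.isComplex.1.subset fun δ hδ => hδ.1
  have hcen : ∀ δ ∈ relevant S G O f g (ρ * e) x, ∃ c, RelBall c (ρ * r') δ ∧
      δ ∩ closure (cell G O (widest f g x) x) ∈ cutComplex S G O (widest f g x) ∧
      closedBall c (ρ * r') ∩ affineSpan ℝ δ ⊆ δ ∩ closure (cell G O (widest f g x) x) := by
    intro δ hδ
    have := T.exists_relBall_of_relevant (mul_pos hρ he) (mul_pos hρ hr) (mul_pos hρ hR) hdiam hball hδ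
    rwa [← mul_add, cutFactor_mul hρ, mul_left_comm] at this
  choose! cen hcen using hcen
  obtain ⟨-, p, hp, hocc, -, htot⟩ := T.good _ hh
  set U := fiberUnion (cutComplex S G O (widest f g x)) G p x with hU
  have hpiece : ∀ δ ∈ relevant S G O f g (ρ * e) x,
      δ ∩ closure (cell G O (widest f g x) x) ⊆ U := fun δ hδ =>
    Suspendable.mem_fiberUnion (hcen δ hδ).2.1 ((hp _ (hcen δ hδ).2.1 x).2 inter_subset_right)
  have hmem : ∀ δ ∈ relevant S G O f g (ρ * e) x,
      cen δ ∈ δ ∩ closure (cell G O (widest f g x) x) := fun δ hδ =>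
    (hcen δ hδ).2.2 ⟨mem_closedBall_self (mul_pos hρ hr'0).le, (hcen δ hδ).1.1⟩
  have hR' : ∀ δ ∈ relevant S G O f g (ρ * e) x,
      ‖cen δ - (x : EuclideanSpace ℝ (Fin n))‖ ≤ ρ * R := fun δ hδ =>
    hdist _ hh x _ (by rw [T.frontier_eq]; exact ⟨δ, hδ.1, (hmem δ hδ).1⟩) (hmem δ hδ).2
  obtain ⟨y, hxy⟩ := T.exists_adj x
  rw [Set.ncard_eq_toFinset_card _ hfin]
  refine hN _ hfin.toFinset cen x ρ hρ (fun δ hδ => hR' δ (hfin.mem_toFinset.1 hδ)) ?_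
  intro δ₁ hδ₁ δ₂ hδ₂ hnear
  rw [hfin.mem_toFinset] at hδ₁ hδ₂
  rw [mul_min_of_nonneg _ _ hρ.le] at hnear
  refine T.isComplex.eq_of_mem_intrinsicInterior hδ₁.1 hδ₂.1 ?_
    ((hcen δ₂ hδ₂).1.mem_intrinsicInterior (mul_pos hρ hr'0))
  refine mem_of_centers_near (a := ρ * a) (r := ρ * r') (R := ρ * R) (U := U) T.one_le
    (T.isComplex.2.1 δ₁ hδ₁.1).2 (hocc.2.1 x) T.pos (mul_pos hρ hr'0) (mul_pos hρ hR).le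
    (fun u hu => T.transversal _ hh x y hxy δ₁ hδ₁.1 _
      ((hcen δ₁ hδ₁).1.mem_intrinsicInterior (mul_pos hρ hr'0)) (hmem δ₁ hδ₁).2 x
      (left_mem_segment ℝ _ _) u hu)
    (hcen δ₁ hδ₁).1.1 (fun v hv => ⟨((hcen δ₁ hδ₁).2.2 hv).1, hpiece δ₁ hδ₁ ((hcen δ₁ hδ₁).2.2 hv)⟩)
    (hpiece δ₂ hδ₂ (hmem δ₂ hδ₂)) (hR' δ₂ hδ₂) ?_
  rw [show 2 * (ρ * R) / (ρ * a) = 2 * R / a by rw [mul_left_comm, mul_div_mul_left _ _ hρ.ne'],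
    mul_div_assoc, mul_div_assoc]
  exact hnear

end TubularSuspension

end

/-! ### Choice of the cuts by the pigeonhole principle. -/

section

open Set Metric Topology

namespace TubularSuspension

/-- Of the `N + 1` levels `lo + j * w`, a point of `V` can be at distance less than `w / 2` from at
most one. -/
theorem exists_level {V : Set ℝ} (hV : V.Finite) {N : ℕ} (hcard : V.ncard ≤ N) {lo hi w : ℝ}
    (hw : 0 < w) (hlen : lo + N * w ≤ hi) :
    ∃ c, lo ≤ c ∧ c ≤ hi ∧ ∀ v ∈ V, w / 2 ≤ |c - v| := by
  by_contra hcon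
  push Not at hcon
  have h1 : ∀ j ∈ Finset.range (N + 1), ∃ v ∈ V, |lo + j * w - v| < w / 2 := fun j hj => by
    have hjN : (j : ℝ) ≤ N := by exact_mod_cast Finset.mem_range_succ_iff.1 hj
    exact hcon _ (by have : 0 ≤ (j : ℝ) * w := by positivity
                     linarith) (by nlinarith)
  choose! v hvV hv using h1
  obtain ⟨i, hi, j, hj, hij, he⟩ := Finset.exists_ne_map_eq_of_card_lt_of_maps_to
    (s := Finset.range (N + 1)) (t := hV.toFinset) (f := v)
    (by rw [Finset.card_range, ← ncard_eq_toFinset_card V hV]; omega)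
    (fun j hj => hV.mem_toFinset.2 (hvV j hj))
  have h2 := abs_lt.1 (hv i hi)
  have h3 := abs_lt.1 (hv j hj)
  rw [he] at h2
  rcases lt_or_gt_of_ne hij with h4 | h4
  · have h5 : (i : ℝ) + 1 ≤ j := by exact_mod_cast h4
    nlinarith
  · have h5 : (j : ℝ) + 1 ≤ i := by exact_mod_cast h4
    nlinarith

variable {n : ℕ} {G : EuclideanGraph n} {f g : G.T → G.T → ℝ} {e w : ℝ}

/-- The cuts can be chosen away from given finite sets of points. -/
theorem exists_cut (hf : Anticommutative f) (hg : Anticommutative g)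
    {V : G.T → Set (EuclideanSpace ℝ (Fin n))} (hV : ∀ x, (V x).Finite) {N : ℕ}
    (hN : ∀ x, (V x).ncard ≤ N) (he : 0 ≤ e) (hw : 0 < w) (hNw : 4 * e + (N + N : ℕ) * w ≤ 8 * e)
    (hgap : ∀ x y, G.graph.Adj x y → 8 * e ≤ |f x y - g x y|) :
    ∃ h ∈ cuts f g, ∀ x y, G.graph.Adj x y → min (f x y) (g x y) + 2 * e ≤ h x y ∧
      h x y + 2 * e ≤ max (f x y) (g x y) ∧ ∀ v ∈ V x,
        w / 2 * dist (x : EuclideanSpace ℝ (Fin n)) y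
          ≤ |side (x : EuclideanSpace ℝ (Fin n)) y (h x y) v| := by
  classical
  -- The hyperplane of an edge cuts the polyhedra of both its ends, so it avoids `V x ∪ V y`. The
  -- condition is invariant under exchanging `x` and `y`.
  set Good : G.T → G.T → ℝ → Prop := fun x y c => min (f x y) (g x y) + 2 * e ≤ c ∧
      c + 2 * e ≤ max (f x y) (g x y) ∧ ∀ v ∈ V x ∪ V y,
        w / 2 * dist (x : EuclideanSpace ℝ (Fin n)) y
          ≤ |side (x : EuclideanSpace ℝ (Fin n)) y c v| with hGood
  have hsymm : ∀ x y c, Good x y c → Good y x (-c) := by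
    rintro x y c ⟨h1, h2, h3⟩
    refine ⟨?_, ?_, fun v hv => ?_⟩
    · rw [hf y x, hg y x, min_neg_neg]; linarith
    · rw [hf y x, hg y x, max_neg_neg]; linarith
    · rw [side_swap, abs_neg, dist_comm]
      exact h3 v (union_comm _ _ ▸ hv)
  have hex : ∀ x y, G.graph.Adj x y → ∃ c, Good x y c := by
    intro x y hxy
    have hd := dist_pos_of_adj hxy
    have hfin := (hV x).union (hV y)
    obtain ⟨c, h1, h2, h3⟩ := exists_level (hfin.image fun v =>
      side (x : EuclideanSpace ℝ (Fin n)) y 0 v / dist (x : EuclideanSpace ℝ (Fin n)) y)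
      ((ncard_image_le hfin).trans ((ncard_union_le _ _).trans (add_le_add (hN x) (hN y)))) hw
      (lo := min (f x y) (g x y) + 2 * e) (hi := max (f x y) (g x y) - 2 * e)
      (by have := hgap x y hxy
          rw [← max_sub_min_eq_abs'] at this
          linarith)
    refine ⟨c, h1, by linarith, fun v hv => ?_⟩
    have h4 := h3 _ ⟨v, hv, rfl⟩
    have h5 : side (x : EuclideanSpace ℝ (Fin n)) y c v
        = -((c - side (x : EuclideanSpace ℝ (Fin n)) y 0 v / dist (x : EuclideanSpace ℝ (Fin n)) y)
          * dist (x : EuclideanSpace ℝ (Fin n)) y) := by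
      rw [side_sub _ _ v c 0]; field_simp; ring
    rw [h5, abs_neg, abs_mul, abs_of_pos hd]
    exact mul_le_mul_of_nonneg_right h4 hd.le
  choose! c hc using hex
  -- An arbitrary order on the vertices selects one orientation of each edge, to make `h`
  -- anticommutative.
  set ι := Fintype.equivFin G.T
  set h : G.T → G.T → ℝ := fun x y =>
    if G.graph.Adj x y then (if ι x < ι y then c x y else -c y x) else f x y with hh
  have hgood : ∀ x y, G.graph.Adj x y → Good x y (h x y) := by
    intro x y hxy
    simp only [hh, if_pos hxy]
    split_ifs
    · exact hc x y hxy
    · exact hsymm _ _ _ (hc y x hxy.symm)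
  refine ⟨h, ⟨fun x y => ?_, fun x y => ?_⟩, fun x y hxy => ?_⟩
  · by_cases hxy : G.graph.Adj x y
    · have hne : ι x ≠ ι y := fun h0 => hxy.ne (ι.injective h0)
      simp only [hh, if_pos hxy, if_pos hxy.symm]
      rcases lt_or_gt_of_ne hne with h1 | h1
      · rw [if_pos h1, if_neg h1.not_gt, neg_neg]
      · rw [if_pos h1, if_neg h1.not_gt]
    · simp only [hh, if_neg hxy, if_neg fun h0 : G.graph.Adj y x => hxy h0.symm]
      exact hf x y
  · by_cases hxy : G.graph.Adj x y
    · obtain ⟨h1, h2, -⟩ := hgood x y hxy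
      exact ⟨by linarith, by linarith⟩
    · simp only [hh, if_neg hxy]
      exact ⟨min_le_left _ _, le_max_left _ _⟩
  · obtain ⟨h1, h2, h3⟩ := hgood x y hxy
    exact ⟨h1, h2, fun v hv => h3 v (Or.inl hv)⟩

end TubularSuspension

end

/-! ### Roundness of the suspension for a well-chosen cut. -/

section

open Set Metric Topology

namespace TubularSuspension

theorem ncard_biUnion_le {ι α : Type*} {s : Set ι} (hs : s.Finite) {t : ι → Set α}
    (ht : ∀ i ∈ s, (t i).Finite) {M N : ℕ} (hM : s.ncard ≤ M) (hN : ∀ i ∈ s, (t i).ncard ≤ N) :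
    (⋃ i ∈ s, t i).ncard ≤ M * N := by
  classical
  have hsub : (⋃ i ∈ s, t i) ⊆ ⋃ i ∈ hs.toFinset, t i :=
    biUnion_subset_biUnion_left fun i hi => hs.mem_toFinset.2 hi
  have hfin : (⋃ i ∈ hs.toFinset, t i).Finite :=
    hs.toFinset.finite_toSet.biUnion fun i hi => ht i (hs.mem_toFinset.1 hi)
  rw [ncard_eq_toFinset_card _ hs] at hM
  exact (ncard_le_ncard hsub hfin).trans ((Finset.set_ncard_biUnion_le _ _).trans
    ((Finset.sum_le_card_nsmul _ _ N fun i hi => hN i (hs.mem_toFinset.1 hi)).trans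
      (Nat.mul_le_mul_right _ hM)))

/-- The suspension of a well-chosen cut complex of a tubular complex is round. -/
theorem exists_round_cut {n : ℕ} (hn : 2 ≤ n) {r a e R : ℝ} (hr : 0 < r) (ha : 0 < a) (he : 0 < e)
    (hR : 0 < R) : ∃ κ : ℝ, 0 < κ ∧
      ∀ (S : Set (Set (EuclideanSpace ℝ (Fin n)))) (G : EuclideanGraph n)
        (O : Set (EuclideanSpace ℝ (Fin n))) (f g : G.T → G.T → ℝ) (ρ : ℝ), 0 < ρ →
      TubularSystem S G O f g (ρ * a) → (∀ x, (G.graph.neighborSet x).ncard ≤ 2) →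
      (∀ x y, G.graph.Adj x y → 8 * (ρ * e) ≤ |f x y - g x y|) →
      (∀ h ∈ cuts f g, ∀ x : G.T, ∀ u ∈ frontier O, u ∈ closure (cell G O h x) →
        ‖u - (x : EuclideanSpace ℝ (Fin n))‖ ≤ ρ * R) →
      (∀ x y : G.T, G.graph.Adj x y → dist (x : EuclideanSpace ℝ (Fin n)) y ≤ ρ * R) →
      (∀ δ ∈ S, ∀ u ∈ δ, ∀ v ∈ δ, ‖u - v‖ ≤ ρ * R) →
      (∀ φ ∈ allSubfaces S, dimension φ ≠ 0 → ∃ c, RelBall c (ρ * r) φ) →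
      ∃ h ∈ cuts f g, ∃ p, IsCellChoice S G O h p ∧ Suspendable (cutComplex S G O h) G O h p ∧
        (∀ F, Suspendable.Face (cutComplex S G O h) G p F → ∃ q, F ⊆ closedBall q (ρ * R)) ∧
        ∀ F, Suspendable.Face (cutComplex S G O h) G p F → dimension F ≠ 0 → ∃ c, RelBall c (ρ * κ) F := by
  obtain ⟨N₁, hN₁⟩ := exists_bound_ncard_relevant n ha he hr hR
  obtain ⟨N₂, hN₂⟩ := exists_bound_card_extremePoints n (R := R) hr
  -- There are at most `N₁ * N₂` vertices to avoid at each end of an edge. With this width the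
  -- levels fit in the middle band, of length at least `4 * e`, and `w / 2 ≤ e`; the final `1`
  -- avoids division by zero.
  set w : ℝ := 2 * e / ((N₁ * N₂ + N₁ * N₂ : ℕ) + 1) with hw
  have hw0 : 0 < w := by positivity
  have hN0 : (0 : ℝ) ≤ (N₁ * N₂ + N₁ * N₂ : ℕ) := by positivity
  have hwN : ((N₁ * N₂ + N₁ * N₂ : ℕ) + 1) * w = 2 * e := by
    rw [hw]; field_simp
  have hwe : w ≤ 2 * e := by nlinarith
  -- `2 * e` is the room that the cuts leave before the ends of the allowed intervals, hence before
  -- the vertices of the graph.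
  set b : ℝ := min a (2 * e) with hb
  have hb0 : 0 < b := lt_min ha (by linarith)
  set σ := cutFactor (w / 2) R with hσ
  have hσ0 : 0 < σ := cutFactor_pos (by linarith) hR
  refine ⟨coneRadius (coneRadius (σ * (σ * r)) b R) b R,
    coneRadius_pos (coneRadius_pos (by positivity) hb0 hR.le) hb0 hR.le,
    fun S G O f g ρ hρ T hdeg hgap hdist hedge hdiam hball => ?_⟩
  have hfin := fun x => T.isComplex.1.subset (sep_subset S _ : relevant S G O f g (ρ * e) x ⊆ S)
  have hpoly : ∀ x, ∀ δ ∈ relevant S G O f g (ρ * e) x, IsPolyhedron δ := fun x δ hδ =>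
    T.isComplex.isPolyhedron hδ.1
  have hcard := hN₁ S G O f g ρ hρ T hdiam
    (fun δ hδ => hball δ (mem_allSubfaces hδ (T.isComplex.isPolyhedron hδ).self_mem_subfaces)
      (by rw [(T.isComplex.2.1 δ hδ).2]; omega)) hdist
  obtain ⟨h, hh, hgood⟩ := exists_cut T.anti_left T.anti_right
    (V := fun x => ⋃ δ ∈ relevant S G O f g (ρ * e) x, δ.extremePoints ℝ)
    (fun x => (hfin x).biUnion fun δ hδ => (hpoly x δ hδ).extremePoints_finite)
    (N := N₁ * N₂) (fun x => ncard_biUnion_le (hfin x)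
      (fun δ hδ => (hpoly x δ hδ).extremePoints_finite) (hcard x)
      fun δ hδ => hN₂ δ ρ hρ (hpoly x δ hδ) (hdiam δ hδ.1)
        fun F hF => hball F (mem_allSubfaces hδ.1 hF))
    (e := ρ * e) (w := ρ * w) (by positivity) (by positivity)
    (by have := mul_le_mul_of_nonneg_left (show ((N₁ * N₂ + N₁ * N₂ : ℕ) : ℝ) * w ≤ 4 * e by
          nlinarith) hρ.le
        nlinarith) hgap
  have hroom : ∀ x y, G.graph.Adj x y → min (f x y) (g x y) + 2 * (ρ * e) ≤ h x y ∧
      h x y + 2 * (ρ * e) ≤ max (f x y) (g x y) := fun x y hxy =>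
    ⟨(hgood x y hxy).1, (hgood x y hxy).2.1⟩
  have hvert : ∀ x y : G.T, G.graph.Adj x y → ∀ δ ∈ relevant S G O f g (ρ * e) x,
      ∀ v ∈ δ.extremePoints ℝ, ρ * (w / 2) * dist (x : EuclideanSpace ℝ (Fin n)) y
        ≤ |side (x : EuclideanSpace ℝ (Fin n)) y (h x y) v| := fun x y hxy δ hδ v hv => by
    rw [← mul_div_assoc]
    exact (hgood x y hxy).2.2 v (mem_iUnion₂.2 ⟨δ, hδ, hv⟩)
  obtain ⟨p, hp, H⟩ := T.suspendable hh (by positivity) hroom fun x y hxy δ hδ v hv h0 => by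
    have h1 := hvert x y hxy δ hδ v hv
    rw [h0, abs_zero] at h1
    have h2 := dist_pos_of_adj hxy
    exact absurd h1 (not_le.2 (by positivity))
  have hb_le : ρ * b ≤ ρ * a := mul_le_mul_of_nonneg_left (min_le_left _ _) hρ.le
  have hseg : ∀ δ ∈ cutComplex S G O h, ∀ y, G.graph.Adj (p δ) y →
      ∀ z ∈ segment ℝ (p δ : EuclideanSpace ℝ (Fin n)) y, ∀ u ∈ affineSpan ℝ δ, ρ * b ≤ ‖z - u‖ := by
    rintro _ hδ y hy z hz u hu
    obtain ⟨hdim, δ, hδS, x, rfl⟩ := id hδ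
    rw [(hp _ hδ x).2 inter_subset_right] at hy hz
    obtain ⟨q, hq, hqc, -⟩ := T.exists_mem_sector hh hδS hdim
    rw [T.affineSpan_piece hh hδS hdim] at hu
    exact hb_le.trans (T.transversal h hh x y hy δ hδS q hq hqc z hz u hu)
  have hapex : ∀ δ ∈ cutComplex S G O h, ∀ u ∈ affineSpan ℝ δ,
      ρ * b ≤ ‖(p δ : EuclideanSpace ℝ (Fin n)) - u‖ := fun δ hδ u hu => by
    obtain ⟨y, hy⟩ := T.exists_adj (p δ)
    exact hseg δ hδ y hy _ (left_mem_segment ℝ _ _) u hu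
  have hreach : ∀ δ ∈ cutComplex S G O h, ∀ u ∈ δ,
      ‖(p δ : EuclideanSpace ℝ (Fin n)) - u‖ ≤ ρ * R := fun δ hδ u hu => by
    rw [norm_sub_rev]
    exact hdist h hh _ u (H.fiber_mem_frontier (Suspendable.mem_fiberUnion hδ rfl hu))
      ((hp δ hδ _).1 rfl hu)
  have hlevel : ∀ x y : G.T, G.graph.Adj x y →
      ρ * b ≤ dist (x : EuclideanSpace ℝ (Fin n)) y / 2 - h x y := fun x y hxy => by
    have h1 : ρ * b ≤ ρ * (2 * e) := mul_le_mul_of_nonneg_left (min_le_right _ _) hρ.le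
    have h2 := (abs_lt.1 (T.bound _ (widest_mem_cuts T.anti_left T.anti_right x) x y hxy)).2
    rw [widest_self] at h2
    linarith [(hroom x y hxy).2]
  have hρR : 0 < ρ * R := by positivity
  refine ⟨h, hh, p, hp, H, fun F hF => Suspendable.subset_closedBall_of_face hreach hρR.le hedge hF,
    fun F hF hdim => ?_⟩
  rw [← coneRadius_mul hρ, ← coneRadius_mul hρ]
  refine H.exists_relBall_of_face (by positivity) (by positivity) (fun φ hφ hφdim => ?_) hapex hseg
    hreach hρR.le hedge hlevel hF hdim
  have h1 := T.exists_relBall_of_cutComplex hh (μ := ρ * (w / 2)) (e := ρ * e) (by positivity)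
    (mul_le_mul_of_nonneg_left (by linarith) hρ.le) (r := ρ * r) (by positivity) hρR hroom hdiam
    hball hvert hdeg hφ hφdim
  rw [cutFactor_mul hρ, ← hσ] at h1
  rwa [show ρ * (σ * (σ * r)) = σ * (σ * (ρ * r)) by ring]

end TubularSuspension

end

/-! ### Graphs with a single vertex. -/

section

open Set Metric Topology

namespace TubularSuspension

theorem frontier_nonempty {n : ℕ} (hn : 1 ≤ n) {O : Set (EuclideanSpace ℝ (Fin n))}
    (hO : Bornology.IsBounded O) (hne : O.Nonempty) : (frontier O).Nonempty := by
  have : Nonempty (Fin n) := ⟨⟨0, hn⟩⟩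
  rw [nonempty_frontier_iff]
  exact ⟨hne, fun h => NormedSpace.unbounded_univ ℝ (EuclideanSpace ℝ (Fin n)) (h ▸ hO)⟩

variable {n : ℕ} {S : Set (Set (EuclideanSpace ℝ (Fin n)))} {G : EuclideanGraph n}
  {O : Set (EuclideanSpace ℝ (Fin n))} {f g h : G.T → G.T → ℝ} {x : G.T}

/-- A boundary made of polyhedra whose hyperplanes avoid the centre of a star-shaped open set is met
once by every ray. -/
theorem eq_of_mem_segment_frontier (hS : S.Finite) (hO : IsOpen O) (hfr : frontier O = ⋃₀ S)
    {x u w : EuclideanSpace ℝ (Fin n)} (hx : x ∈ O) (hstar : StarConvex ℝ x O)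
    (hspan : ∀ δ ∈ S, x ∉ affineSpan ℝ δ) (hu : u ∈ frontier O) (hw : w ∈ frontier O)
    (hwu : w ∈ segment ℝ u x) : w = u := by
  by_contra hne
  rw [segment_symm, segment_eq_image'] at hwu
  obtain ⟨t₀, ⟨h0, h1⟩, rfl⟩ := hwu
  beta_reduce at hw hne
  have hnotO : ∀ v ∈ frontier O, v ∉ O := fun v hv => by
    rw [hO.frontier_eq] at hv; exact hv.2
  have h1' : t₀ < 1 := lt_of_le_of_ne h1 fun h => hne (by rw [h, one_smul, add_sub_cancel])
  have h0' : 0 < t₀ := lt_of_le_of_ne h0 fun h => hnotO _ hw (by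
    rw [← h, zero_smul, add_zero]; exact hx)
  -- The whole segment from `w` to `u` is in the frontier: a point of `O` beyond `w` would put `w`
  -- in `O` by star-shapedness.
  have hmem : ∀ t ∈ Icc t₀ 1, ∃ δ ∈ S, x + t • (u - x) ∈ δ := by
    intro t ht
    have ht0 : 0 < t := h0'.trans_le ht.1
    have h2 : x + t • (u - x) ∈ frontier O := by
      rw [hO.frontier_eq]
      refine ⟨(starConvex_closure hstar).add_smul_sub_mem (frontier_subset_closure hu) ht0.le ht.2,
        fun h3 => hnotO _ hw ?_⟩
      have h4 := hstar.add_smul_sub_mem h3 (t := t₀ / t) (by positivity)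
        ((div_le_one ht0).2 ht.1)
      rwa [add_sub_cancel_left, smul_smul, div_mul_cancel₀ _ ht0.ne'] at h4
    rw [hfr] at h2
    exact h2
  choose! D hDS hD using hmem
  -- Infinitely many points and finitely many polyhedra: two points of the ray are in the same
  -- polyhedron, whose affine hull then contains `x`.
  obtain ⟨s, hs, t, ht, hst, he⟩ := (Icc_infinite h1').exists_ne_map_eq_of_mapsTo
    (fun t ht => hDS t ht) hS
  refine hspan (D s) (hDS s hs) ?_
  have h2 := AffineMap.lineMap_mem (-s / (t - s)) (subset_affineSpan ℝ _ (hD s hs))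
    (subset_affineSpan ℝ _ (he ▸ hD t ht))
  have h3 : t - s ≠ 0 := sub_ne_zero.2 hst.symm
  rw [AffineMap.lineMap_apply, vsub_eq_sub, vadd_eq_add, add_sub_add_left_eq_sub, ← sub_smul,
    smul_smul, div_mul_cancel₀ _ h3, neg_smul] at h2
  convert h2 using 1
  abel

theorem cell_eq_of_subsingleton [Subsingleton G.T] (hx : (x : EuclideanSpace ℝ (Fin n)) ∈ O)
    (hstar : StarConvex ℝ (x : EuclideanSpace ℝ (Fin n)) O) : cell G O h x = O := by
  refine Subset.antisymm (fun t ht => (cell_subset ht).1) fun t ht => ?_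
  have hmem : (x : EuclideanSpace ℝ (Fin n)) ∈ cell G O h x := TubularSuspension.self_mem_cell hx
    fun y hy => absurd (Subsingleton.elim x y) hy.ne
  exact subset_cell_of_isPreconnected (convex_segment (x : EuclideanSpace ℝ (Fin n)) t).isPreconnected
    (subset_inter (hstar.segment_subset ht) fun _ _ y hy => absurd (Subsingleton.elim x y) hy.ne)
    ⟨x, left_mem_segment ℝ _ _, hmem⟩ (right_mem_segment ℝ _ _)

/-- There are no edges and the only cell is `O`; the substantial condition left is occlusion from
the vertex, given by `eq_of_mem_segment_frontier`. -/
theorem suspendable_of_subsingleton [Subsingleton G.T] (hn : 1 ≤ n) (hS : IsComplex (n - 1) S)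
    (hO : IsOpen O) (hfr : frontier O = ⋃₀ S) (hmem : ∀ x : G.T, (x : EuclideanSpace ℝ (Fin n)) ∈ O)
    (hbdd : Bornology.IsBounded O)
    (hstar : ∀ x : G.T, StarConvex ℝ (x : EuclideanSpace ℝ (Fin n)) O) (hh : Anticommutative h)
    (hspan : ∀ x : G.T, ∀ δ ∈ S, (x : EuclideanSpace ℝ (Fin n)) ∉ affineSpan ℝ δ)
    (p : Set (EuclideanSpace ℝ (Fin n)) → G.T) :
    cutComplex S G O h = S ∧ IsCellChoice S G O h p ∧ Suspendable S G O h p := by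
  have hno : ∀ x y : G.T, ¬ G.graph.Adj x y := fun x y hy => hy.ne (Subsingleton.elim x y)
  have hcell : ∀ x, cell G O h x = O := fun x => cell_eq_of_subsingleton (hmem x) (hstar x)
  have hsub : ∀ δ ∈ S, ∀ x, δ ⊆ closure (cell G O h x) := fun δ hδ x => by
    rw [hcell]
    exact (subset_sUnion_of_mem hδ).trans (hfr ▸ frontier_subset_closure)
  have hfib : ∀ x, fiberUnion S G p x = frontier O := fun x => by
    rw [hfr, fiberUnion]
    congr 1
    exact sep_eq_self_iff_mem_true.2 fun δ _ => Subsingleton.elim _ _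
  obtain ⟨x₀, hx₀⟩ := G.nonempty
  have hcut : cutComplex S G O h = S := by
    ext δ
    constructor
    · rintro ⟨-, δ, hδ, x, rfl⟩
      rwa [inter_eq_left.2 (hsub δ hδ x)]
    · intro hδ
      exact ⟨(hS.2.1 δ hδ).2, δ, hδ, ⟨x₀, hx₀⟩, (inter_eq_left.2 (hsub δ hδ _)).symm⟩
  refine ⟨hcut, fun δ hδ x => ⟨fun _ => hsub δ (hcut ▸ hδ) x, fun _ => Subsingleton.elim _ _⟩,
    ⟨hS, hmem, fun x y hy => absurd hy (hno x y), hh,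
    ⟨fun _ _ x y hy => absurd hy (hno x y), ?_, fun x y hy => absurd hy (hno x y)⟩,
    ⟨fun x => ?_, fun x y hxy => absurd (Subsingleton.elim x y) hxy, fun x => ?_,
      fun x => ?_, fun x y _ hy => absurd hy (hno x y), fun x y _ _ hy => absurd hy (hno x y)⟩,
    ⟨fun x => ?_, hO, hbdd, hfr.symm, ?_, fun x y _ => Or.inl (Subsingleton.elim x y)⟩,
    fun x y _ _ hy => absurd hy (hno x y), fun x y _ hy => absurd hy (hno x y), fun x t ht _ => ?_⟩⟩
  · rintro x u hu y rfl
    rw [hfib] at hu ⊢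
    refine Subset.antisymm ?_ (singleton_subset_iff.2 ⟨left_mem_segment ℝ _ _, hu⟩)
    rintro w ⟨hw, hwf⟩
    exact eq_of_mem_segment_frontier hS.1 hO hfr (hmem x) (hstar x) (hspan x) hu hwf hw
  · rw [hcell]; exact hO
  · rw [hcell]; exact hstar x
  · rw [hcell, hfib]; exact frontier_subset_closure
  · obtain ⟨t, ht⟩ := frontier_nonempty hn hbdd ⟨_, hmem x⟩
    rw [hfr] at ht
    obtain ⟨δ, hδ, -⟩ := ht
    exact ⟨δ, hδ, Subsingleton.elim _ _⟩
  · simp only [hcell]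
    have : Nonempty G.T := ⟨⟨x₀, hx₀⟩⟩
    rw [iUnion_const]
  · rw [hfib]; exact ht

end TubularSuspension

end

/-! ### From the shape parameters to uniform constants. -/

section

open Set Metric Topology

namespace TubularSuspension

variable {n : ℕ} {S : Set (Set (EuclideanSpace ℝ (Fin n)))} {G : EuclideanGraph n}
  {O : Set (EuclideanSpace ℝ (Fin n))} {f g h : G.T → G.T → ℝ}
  {p : Set (EuclideanSpace ℝ (Fin n)) → G.T} {ε C ρ κ R : ℝ}

theorem exists_adj_of_connected {V : Type*} {Γ : SimpleGraph V} (hΓ : Γ.Connected) [Nontrivial V]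
    (x : V) : ∃ y, Γ.Adj x y := by
  obtain ⟨y, hy⟩ := exists_ne x
  cases (hΓ.preconnected x y).some with
  | nil => exact absurd rfl hy
  | cons hxz _ => exact ⟨_, hxz⟩

/-- The height `ρ * C⁻²` is the product of the lower bounds on `η` and `β₋`, by
`le_norm_sub_of_normal`. -/
theorem IsTubular.tubularSystem (H : IsTubular ε S G O f g) (hn : 1 ≤ n) (hcard : 1 < G.T.card)
    (hC : 0 < C) (hρ : 0 < ρ) (heta : C⁻¹ ≤ eta G O f g) (hβ : ρ * C⁻¹ ≤ betaMinus G O f g) :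
    TubularSystem S G O f g (ρ * (C⁻¹ * C⁻¹)) := by
  obtain ⟨hS, ⟨hconn, -, hfree⟩, -, hfr, hmem, hf, hg, -, hT⟩ := H
  obtain ⟨hbound, hgood⟩ := hT hcard
  have : Nontrivial G.T := Finset.one_lt_card_iff_nontrivial.1 hcard |>.coe_sort
  refine ⟨hn, hS, hfr, hfree, hmem, hf, hg, fun h hh x y hxy => ?_, hgood,
    exists_adj_of_connected hconn, by positivity, fun h hh x y hxy δ hδ t ht hc z hz u hu => ?_⟩
  · obtain ⟨h1, h2, -⟩ := hbound x y hxy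
    rw [← Subtype.dist_eq]
    rw [abs_lt] at h1 h2 ⊢
    exact ⟨(lt_min h1.1 h2.1).trans_le (hh.2 x y).1, (hh.2 x y).2.trans_lt (max_lt h1.2 h2.2)⟩
  · have htw : t ∈ wall G O h x y :=
      ⟨hfr ▸ mem_sUnion_of_mem (intrinsicInterior_subset ht) hδ, Or.inl hc⟩
    rw [mul_left_comm]
    exact le_norm_sub_of_normal hS hn hfr hδ ht (by positivity) (by positivity)
      (hβ.trans (betaMinus_le_of_card hcard.ne' hh hxy hz htw))
      (fun ν hν => heta.trans (eta_le_of_card hcard.ne' hh hxy hz htw hν)) hu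

theorem exists_round_cut_of_tubular (hn : 2 ≤ n) (hC : 0 < C) : ∃ κ : ℝ, 0 < κ ∧
    ∀ (S : Set (Set (EuclideanSpace ℝ (Fin n)))) (G : EuclideanGraph n)
      (O : Set (EuclideanSpace ℝ (Fin n))) (f g : G.T → G.T → ℝ) (ε ρ : ℝ), 0 < ρ →
    IsTubular ε S G O f g → complexOuterRadius S < ρ → ρ * C⁻¹ < complexInnerRadius S →
    C⁻¹ ≤ eta G O f g → ρ * C⁻¹ ≤ ε → alphaPlus G O f g ≤ ρ * C → ρ * C⁻¹ ≤ betaMinus G O f g →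
    betaPlus G O f g ≤ ρ * C →
    ∃ h ∈ cuts f g, ∃ p, IsCellChoice S G O h p ∧ Suspendable (cutComplex S G O h) G O h p ∧
      (∀ F, Suspendable.Face (cutComplex S G O h) G p F → ∃ q, F ⊆ closedBall q (ρ * (C + 2))) ∧
      ∀ F, Suspendable.Face (cutComplex S G O h) G p F → dimension F ≠ 0 →
        ∃ c, RelBall c (ρ * κ) F := by
  have hC' : 0 < C⁻¹ := inv_pos.2 hC
  -- In units of `ρ`: `e` is one eighth of the lower bound for `ε`, and `C + 2` dominates the edges,
  -- the distances to the walls, and the diameters of the polyhedra, which are at most `2`.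
  obtain ⟨κ, hκ, hround⟩ := exists_round_cut hn (r := C⁻¹) (a := C⁻¹ * C⁻¹) (e := C⁻¹ / 8)
    (R := C + 2) hC' (by positivity) (by positivity) (by positivity)
  -- The factor for a single vertex, where nothing is cut.
  set κ' := coneRadius (coneRadius C⁻¹ (C⁻¹ * C⁻¹) (C + 2)) (C⁻¹ * C⁻¹) (C + 2) with hκ'
  have hκ'0 : 0 < κ' := coneRadius_pos (coneRadius_pos hC' (by positivity) (by positivity))
    (by positivity) (by positivity)
  refine ⟨min κ κ', lt_min hκ hκ'0, fun S G O f g ε ρ hρ H hout hin heta hε hα hβ hβ' => ?_⟩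
  obtain ⟨hS, hlin, hO, hfr, hmem, hf, hg, hone, hT⟩ := id H
  have hball : ∀ φ ∈ allSubfaces S, dimension φ ≠ 0 → ∃ c, RelBall c (ρ * C⁻¹) φ := fun φ hφ =>
    exists_relBall_of_lt_complexInnerRadius (by positivity) hin hφ
  have hle : ρ * C ≤ ρ * (C + 2) := mul_le_mul_of_nonneg_left (by linarith) hρ.le
  have hR : 0 < ρ * (C + 2) := by positivity
  have hfcut : f ∈ cuts f g := ⟨hf, fun x y => ⟨min_le_left _ _, le_max_left _ _⟩⟩
  rcases Nat.lt_or_ge 1 G.T.card with hcard | hcard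
  · have T := H.tubularSystem (by omega) hcard hC hρ heta hβ
    have hbdd : Bornology.IsBounded O := (T.good f hfcut).2.choose_spec.2.2.2.2.2.1
    obtain ⟨h, hh, p, hp, HS, hF, hF'⟩ := hround S G O f g ρ hρ T hlin.2.1
      (fun x y hxy => by linarith [((hT hcard).1 x y hxy).2.2])
      (fun h hh x u hu huc => by
        obtain ⟨y, hxy⟩ := T.exists_adj x
        rw [norm_sub_rev]
        exact (le_betaPlus_of_card hcard.ne' hbdd hh hxy ⟨hu, Or.inl huc⟩).trans (hβ'.trans hle))
      (fun x y hxy => (le_alphaPlus hcard.ne' hxy).trans (hα.trans hle))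
      (fun δ hδ u hu v hv => by
        obtain ⟨q, hq⟩ := hS.exists_subset_closedBall hout
          (mem_allSubfaces hδ (hS.isPolyhedron hδ).self_mem_subfaces)
        have h1 := mem_closedBall.1 (hq hu)
        have h2 := mem_closedBall.1 (hq hv)
        rw [← dist_eq_norm]
        nlinarith [dist_triangle_right u v q]) hball
    refine ⟨h, hh, p, hp, HS, hF, fun F hF hdim => ?_⟩
    obtain ⟨c, hc⟩ := hF' F hF hdim
    exact ⟨c, hc.mono (mul_le_mul_of_nonneg_left (min_le_left _ _) hρ.le)⟩
  · have hcard : G.T.card = 1 := le_antisymm hcard G.nonempty.card_pos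
    have : Subsingleton G.T := Finset.card_le_one_iff_subsingleton_coe.1 hcard.le
    obtain ⟨hbdd, hstar⟩ := hone hcard
    have hfront : ∀ δ ∈ S, δ ⊆ frontier O := fun δ hδ => hfr ▸ subset_sUnion_of_mem hδ
    have htrans : ∀ x : G.T, ∀ δ ∈ S, ∀ u ∈ affineSpan ℝ δ,
        ρ * (C⁻¹ * C⁻¹) ≤ ‖(x : EuclideanSpace ℝ (Fin n)) - u‖ := by
      intro x δ hδ u hu
      obtain ⟨t, ht⟩ := (hS.isPolyhedron hδ).1.intrinsicInterior (hS.isPolyhedron hδ).convex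
      rw [mul_left_comm]
      exact le_norm_sub_of_normal hS (by omega) hfr hδ ht (by positivity) (by positivity)
        (hβ.trans (betaMinus_le_of_card_eq hcard (hfront δ hδ (intrinsicInterior_subset ht))))
        (fun ν hν => heta.trans (eta_le_of_card_eq hcard hν)) hu
    have hno : ∀ x y : G.T, ¬ G.graph.Adj x y := fun x y hy => hy.ne (Subsingleton.elim x y)
    obtain ⟨p⟩ : Nonempty (Set (EuclideanSpace ℝ (Fin n)) → G.T) :=
      ⟨fun _ => ⟨_, G.nonempty.choose_spec⟩⟩
    obtain ⟨hcut, hp, HS⟩ := suspendable_of_subsingleton (by omega) hS hO hfr hmem hbdd hstar hf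
      (fun x δ hδ hx => by
        have h1 := htrans x δ hδ _ hx
        rw [sub_self, norm_zero] at h1
        exact absurd h1 (not_le.2 (by positivity))) p
    have hreach : ∀ δ ∈ S, ∀ u ∈ δ, ‖(p δ : EuclideanSpace ℝ (Fin n)) - u‖ ≤ ρ * (C + 2) :=
      fun δ hδ u hu => (le_betaPlus_of_card_eq hcard hbdd (hfront δ hδ hu)).trans (hβ'.trans hle)
    refine ⟨f, hfcut, p, hp, ?_⟩
    rw [hcut]
    refine ⟨HS, fun F hF => Suspendable.subset_closedBall_of_face hreach hR.le
      (fun x y hy => absurd hy (hno x y)) hF, fun F hF hdim => ?_⟩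
    obtain ⟨c, hc⟩ := HS.exists_relBall_of_face (r := ρ * C⁻¹) (a := ρ * (C⁻¹ * C⁻¹))
      (by positivity) (by positivity) hball (fun δ => htrans (p δ) δ) (fun δ _ y hy => absurd hy (hno _ y)) hreach hR.le
      (fun x y hy => absurd hy (hno x y)) (fun x y hy => absurd hy (hno x y)) hF hdim
    rw [coneRadius_mul hρ, coneRadius_mul hρ] at hc
    exact ⟨c, hc.mono (mul_le_mul_of_nonneg_left (min_le_right _ _) hρ.le)⟩

theorem Suspendable.round_suspension (H : Suspendable S G O h p) (hn : 1 ≤ n) (hR : 0 < R)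
    (hκ : 0 < κ) (hout : ∀ F, Suspendable.Face S G p F → ∃ q, F ⊆ closedBall q R)
    (hin : ∀ F, Suspendable.Face S G p F → dimension F ≠ 0 → ∃ c, RelBall c κ F) :
    complexOuterRadius (suspension (n - 1) S G p) ≤ R ∧
      κ ≤ complexInnerRadius (suspension (n - 1) S G p) := by
  have hface : ∀ F ∈ allSubfaces (suspension (n - 1) S G p), Face S G p F := fun F hF => by
    obtain ⟨Δ, hΔ, hFΔ⟩ := mem_iUnion₂.1 hF
    exact H.face_of_mem_subfaces hΔ hFΔ
  refine ⟨complexOuterRadius_le hR fun F hF => hout F (hface F hF),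
    (H.isComplex_suspension hn).le_complexInnerRadius (by omega) ?_ hκ fun F hF => hin F (hface F hF)⟩
  -- The suspension is nonempty since it covers the vertices of the graph, so its inner radius is
  -- not the default infimum of the empty set.
  obtain ⟨x, hx⟩ := G.nonempty
  have h1 : x ∈ closure O := subset_closure (H.mem ⟨x, hx⟩)
  rw [← H.sUnion_suspension hn] at h1
  obtain ⟨Δ, hΔ, -⟩ := h1
  exact ⟨Δ, hΔ⟩

theorem IsTubular.nonempty (H : IsTubular ε S G O f g) (hn : 1 ≤ n) : S.Nonempty := by
  obtain ⟨-, -, -, hfr, hmem, hf, -, hone, hT⟩ := H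
  have hbdd : Bornology.IsBounded O := by
    rcases Nat.lt_or_ge 1 G.T.card with hcard | hcard
    · exact ((hT hcard).2 f ⟨hf, fun x y => ⟨min_le_left _ _, le_max_left _ _⟩⟩).2.choose_spec.2.2.2.2.2.1
    · exact (hone (le_antisymm hcard G.nonempty.card_pos)).1
  obtain ⟨x, hx⟩ := G.nonempty
  obtain ⟨t, ht⟩ := frontier_nonempty hn hbdd ⟨x, hmem ⟨x, hx⟩⟩
  rw [hfr] at ht
  obtain ⟨δ, hδ, -⟩ := ht
  exact ⟨δ, hδ⟩

theorem exists_inv_le_and_le {ι : Type*} [Fintype ι] {K : Set (ι → ℝ)} (hK : IsCompact K)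
    (hpos : ∀ v ∈ K, ∀ i, 0 < v i) : ∃ C : ℝ, 0 < C ∧ ∀ v ∈ K, ∀ i, C⁻¹ ≤ v i ∧ v i ≤ C := by
  obtain ⟨R, hR⟩ := hK.isBounded.exists_norm_le
  have hcont : ContinuousOn (fun v : ι → ℝ => fun i => (v i)⁻¹) K :=
    continuousOn_pi.2 fun i => (continuous_apply i).continuousOn.inv₀ fun v hv => (hpos v hv i).ne'
  obtain ⟨R', hR'⟩ := (hK.image_of_continuousOn hcont).isBounded.exists_norm_le
  refine ⟨max 1 (max R R'), by positivity, fun v hv i => ⟨?_, ?_⟩⟩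
  · have h1 := (norm_le_pi_norm (fun i => (v i)⁻¹) i).trans (hR' _ ⟨v, hv, rfl⟩)
    rw [Real.norm_eq_abs, abs_of_pos (inv_pos.2 (hpos v hv i))] at h1
    exact inv_le_of_inv_le₀ (hpos v hv i) (h1.trans ((le_max_right _ _).trans (le_max_right _ _)))
  · exact (le_abs_self _).trans ((norm_le_pi_norm v i).trans ((hR v hv).trans
      ((le_max_left _ _).trans (le_max_right _ _))))

end TubularSuspension

end

theorem mainTheorem2 (K : Set (Fin 9 → ℝ)) (hK : IsCompact K) (hKpos : ∀ v ∈ K, ∀ i, 0 < v i) :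
    ∃ c₁ c₂ : ℝ, 0 < c₁ ∧ 0 < c₂ ∧
      ∀ (n : ℕ), 2 ≤ n →
      ∀ (S : Set (Set (EuclideanSpace ℝ (Fin n)))) (G : TubularSuspension.EuclideanGraph n)
        (O : Set (EuclideanSpace ℝ (Fin n))) (f g : G.T → G.T → ℝ) (ε ρplus ρminus : ℝ),
      0 < ε →
      TubularSuspension.IsTubular ε S G O f g →
      TubularSuspension.complexOuterRadius S < ρplus →
      ρminus < TubularSuspension.complexInnerRadius S →
      0 < ρminus →
      ![(n : ℝ), TubularSuspension.eta G O f g, ρplus / ρminus, ε / ρplus,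
        TubularSuspension.alphaMinus G O f g / ρplus, TubularSuspension.alphaPlus G O f g / ρplus,
        TubularSuspension.betaMinus G O f g / ρplus, TubularSuspension.betaPlus G O f g / ρplus,
        TubularSuspension.gamma G O f g / ρminus] ∈ K →
      ∃ h ∈ TubularSuspension.cuts f g, ∃ p : Set (EuclideanSpace ℝ (Fin n)) → G.T,
        TubularSuspension.IsCellChoice S G O h p ∧
        TubularSuspension.IsComplex n
          (TubularSuspension.suspension (n - 1) (TubularSuspension.cutComplex S G O h) G p) ∧
        ⋃₀ TubularSuspension.suspension (n - 1) (TubularSuspension.cutComplex S G O h) G p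
          = closure O ∧
        TubularSuspension.complexOuterRadius
            (TubularSuspension.suspension (n - 1) (TubularSuspension.cutComplex S G O h) G p)
          ≤ c₁ * TubularSuspension.complexOuterRadius S ∧
        c₂ * TubularSuspension.complexInnerRadius S ≤
          TubularSuspension.complexInnerRadius
            (TubularSuspension.suspension (n - 1) (TubularSuspension.cutComplex S G O h) G p) := by
  obtain ⟨C, hC, hKC⟩ := TubularSuspension.exists_inv_le_and_le hK hKpos
  have hex : ∀ n : ℕ, 2 ≤ n → _ := fun n hn => TubularSuspension.exists_round_cut_of_tubular (n := n) hn hC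
  choose! κ hκ hround using hex
  obtain ⟨N, hN⟩ := exists_nat_ge C
  have hne : (Finset.Icc 2 (N + 2)).Nonempty := ⟨2, Finset.mem_Icc.2 ⟨le_rfl, by omega⟩⟩
  -- The outer radius is at most `ρ * (C + 2)`, and `ρ` is less than `C` times the inner radius of
  -- `S`, itself at most its outer radius. Since `n ≤ C`, the factors `κ n` have a positive minimum
  -- over finitely many dimensions.
  refine ⟨(C + 2) * C, (Finset.Icc 2 (N + 2)).inf' hne κ, by positivity,
    (Finset.lt_inf'_iff hne).2 fun n hn => hκ n (Finset.mem_Icc.1 hn).1,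
    fun n hn S G O f g ε ρ ρ' hε H hout hin hρ' hmem => ?_⟩
  have hρ : 0 < ρ := (Real.sSup_nonneg (by
    rintro _ ⟨F, -, rfl⟩; exact TubularSuspension.outerRadius_nonneg F)).trans_lt hout
  have hv := hKC _ hmem
  have h0 : (n : ℝ) ≤ C := (hv 0).2
  have h1 : C⁻¹ ≤ TubularSuspension.eta G O f g := (hv 1).1
  have h2 : ρ / ρ' ≤ C := (hv 2).2
  have h3 : C⁻¹ ≤ ε / ρ := (hv 3).1
  have h5 : TubularSuspension.alphaPlus G O f g / ρ ≤ C := (hv 5).2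
  have h6 : C⁻¹ ≤ TubularSuspension.betaMinus G O f g / ρ := (hv 6).1
  have h7 : TubularSuspension.betaPlus G O f g / ρ ≤ C := (hv 7).2
  rw [div_le_iff₀ hρ'] at h2
  rw [le_div_iff₀ hρ, mul_comm] at h3 h6
  rw [div_le_iff₀ hρ, mul_comm] at h5 h7
  have h2' : ρ * C⁻¹ < TubularSuspension.complexInnerRadius S := by
    refine lt_of_le_of_lt ?_ hin
    rw [← div_eq_mul_inv, div_le_iff₀ hC, mul_comm]
    exact h2
  obtain ⟨h, hh, p, hp, HS, hF, hF'⟩ :=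
    hround n hn S G O f g ε ρ hρ H hout h2' h1 h3 h5 h6 h7
  have hn1 : 1 ≤ n := by omega
  have hκn := hκ n hn
  obtain ⟨h8, h9⟩ := HS.round_suspension hn1 (by positivity) (by positivity) hF hF'
  -- As `n ≥ 2`, the polyhedra of `S` have positive dimension, so the two radii can be compared.
  have h10 := H.1.complexInnerRadius_le_complexOuterRadius (by omega) (H.nonempty hn1)
  refine ⟨h, hh, p, hp, HS.isComplex_suspension hn1, HS.sUnion_suspension hn1, h8.trans ?_,
    le_trans ?_ h9⟩
  · rw [← div_eq_mul_inv, div_lt_iff₀ hC] at h2'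
    nlinarith [mul_le_mul_of_nonneg_right h10 hC.le]
  · have h11 : (Finset.Icc 2 (N + 2)).inf' hne κ ≤ κ n := Finset.inf'_le _ (Finset.mem_Icc.2
      ⟨hn, by have : (n : ℝ) ≤ N := h0.trans hN
              have : n ≤ N := by exact_mod_cast this
              omega⟩)
    have h12 : 0 < ρ * C⁻¹ := by positivity
    rw [mul_comm ρ]
    exact mul_le_mul h11 (h10.trans hout.le) (h12.trans h2').le hκn.le
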